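/- Let $M$ be a nonempty real-analytic manifold of dimension $2n+1$ with a real-analytic CR structure of hypersurface type, i.e. a real-analytic complex rank $n$ distribution $H\subset\mathbb C TM$ with $[H,H]\subset H$ and $H\cap\overline H=0$. Let $K$ be the kernel of the Levi form $(X_p,Y_p)\mapsto\frac i2[X,\overline Y]_p \bmod H_p\oplus\overline H_p$. Assume that $K$ is a distribution of constant rank $r$ and that $H$ is 2-nondegenerate: at every $p$ one has $K_p\neq 0$, and for every $Y\in\Gamma(K)$ with $Y_p\ne0$ there is $X\in\Gamma(H)$ with $[X,\overline Y]_p\notin K_p\oplus\overline K_p\oplus\overline H_p$. Let $\mathbb CM$ be a (sufficiently small) complexification of $M$, with antiholomorphic involution $\tau$ whose fixed point set is $M$, and with holomorphic extensions of $H$ and $K$, denoted by the same letters, such that on all of $\mathbb CM$ the distribution $H$ is involutive, $H\cap\overline H=0$ where $\overline H=\tau_*H$, and $K$ consists of all $v\in H$ with $[v,\overline H]\subset H\oplus\overline H$; put $\overline K=\tau_*K$. Let $\pi:\mathbb CM\to\mathcal N$ be the holomorphic submersion onto the space of leaves of $K\oplus\overline K$ (with $\mathcal N$ a complex manifold and the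 fibres of $\pi$ connected). For $\gamma\in\mathcal N$ and $p\in\pi^{-1}(\gamma)$ put $\mathcal D_\gamma=\pi_*(H\oplus\overline H)$, $J^-(p)=\pi_*H_p$, $J^+(p)=\pi_*\overline H_p$. Let $\mathfrak g_-(p)=\mathcal D_\gamma\oplus T_\gamma\mathcal N/\mathcal D_\gamma$ with the bracket induced by the Lie bracket of sections of $\mathcal D$. Let $\delta^{\mp}(p)\subset\mathrm{Hom}(J^{\mp}(p),\mathcal D_\gamma/J^\mp(p))=\mathrm{Hom}(J^\mp(p),J^\pm(p))$ be the tangent space at $J^\mp(p)$ of the family of subspaces $\{J^\mp(q):q\in\pi^{-1}(\gamma)\}$, where homomorphisms are extended by $0$ on $J^\pm(p)$ to endomorphisms of $\mathcal D_\gamma$. Let $S$ be a CR symbol of the following form: a Heisenberg algebra $\mathfrak g_-=\mathfrak g_{-1}\oplus\mathfrak g_{-2}$, $\dim \mathfrak g_{-2}=1$, whose bracket $\mathfrak g_{-1}\times\mathfrak g_{-1}\to\mathfrak g_{-2}$ is a symplectic form; an antilinear involution $\sigma$ of $\mathfrak g_{-1}$ preserving the conformal symplectic structure; a Lagrangian splitting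 $\mathfrak g_{-1}=\mathfrak g_{-1,-1}\oplus\mathfrak g_{-1,1}$ with $\sigma(\mathfrak g_{-1,-1})=\mathfrak g_{-1,1}$; and two $r$-dimensional spaces $\mathfrak g_{0,2}$ and $\mathfrak g_{0,-2}$, interchanged by $\sigma$, of symmetric maps $\mathfrak g_{-1,-1}\to\mathfrak g_{-1,1}$ and $\mathfrak g_{-1,1}\to\mathfrak g_{-1,-1}$ respectively, extended by $0$ to $\mathfrak g_{-1}$. Let $P^0$ be the set of all pairs $\psi=(p,\varphi)$ with $p\in\mathbb CM$ and $\varphi:\mathfrak g_-\to\mathfrak g_-(p)$ a graded Lie algebra isomorphism such that $\varphi(\mathfrak g_{-1,\pm1})=J^\pm(p)$, $\varphi^{-1}\circ\delta^-(p)\circ\varphi=\mathfrak g_{0,2}$ and $\varphi^{-1}\circ\delta^+(p)\circ\varphi=\mathfrak g_{0,-2}$. Assume that the CR structure has constant symbol $S$, i.e. that $P^0\to\mathbb CM$ is onto. For $\psi=(p,\varphi)\in P^0$ with $\gamma=\pi(p)$ let $\mathfrak g_0^{\mathrm{mod}}(\psi)$ be the set of all endomorphisms $\varphi^{-1}\circ\varphi'(0)$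 of $\mathfrak g_-$, where $t\mapsto(p(t),\varphi(t))$ runs over the smooth curves through $\psi$ at $t=0$ in the fibre of $P^0$ over $\gamma$; this is the degree-zero component of the modified symbol $\mathfrak g_-\oplus\mathfrak g_0^{\mathrm{mod}}(\psi)$ at $\psi$. Assume that the modified symbol is constant, i.e. that there is a linear space $\mathfrak g_0^{\mathrm{mod}}$ with $\mathfrak g_0^{\mathrm{mod}}(\psi)=\mathfrak g_0^{\mathrm{mod}}$ for every $\psi\in P^0$. Then $\mathfrak g_0^{\mathrm{mod}}$ is a Lie subalgebra of $\mathfrak{csp}(\mathfrak g_-)$, the Lie algebra of grading-preserving derivations of $\mathfrak g_-$ (which restriction to $\mathfrak g_{-1}$ identifies with the conformal symplectic algebra $\mathfrak{csp}(\mathfrak g_{-1})$). -/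

import Mathlib

open scoped Manifold ContDiff Topology

attribute [local instance] LieRing.ofAssociativeRing

noncomputable section

namespace CRGeom

/-! ## Real and complex coordinate spaces -/

/-- The model space of real manifolds of dimension `d`. -/
abbrev RModel (d : ℕ) := EuclideanSpace ℝ (Fin d)

/-- The model space of complex manifolds of dimension `d`; it is also the complexification of
`RModel d`. -/
abbrev CModel (d : ℕ) := EuclideanSpace ℂ (Fin d)

/-- Real part of a complexified tangent vector. -/
def reV {d : ℕ} (v : CModel d) : RModel d := WithLp.toLp 2 fun i => (v i).re

/-- Imaginary part of a complexified tangent vector. -/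
def imV {d : ℕ} (v : CModel d) : RModel d := WithLp.toLp 2 fun i => (v i).im

/-- The complexified vector `a + i b`. -/
def ofReIm {d : ℕ} (a b : RModel d) : CModel d :=
  WithLp.toLp 2 fun i => (a i : ℂ) + Complex.I * (b i : ℂ)

/-- Complex conjugation on the complexification of `RModel d`. -/
def conjV (d : ℕ) : CModel d →ₛₗ[starRingEnd ℂ] CModel d where
  toFun v := WithLp.toLp 2 fun i => starRingEnd ℂ (v i)
  map_add' v w := by ext i; simp
  map_smul' c v := by ext i; simp

/-- The complex-linear extension of a real-linear map to the complexification. -/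
def complexify {d k : ℕ} (L : RModel d →ₗ[ℝ] CModel k) : CModel d →ₗ[ℂ] CModel k where
  toFun v := L (reV v) + Complex.I • L (imV v)
  map_add' v w := by
    have h1 : reV (v + w) = reV v + reV w := by ext i; simp [reV]
    have h2 : imV (v + w) = imV v + imV w := by ext i; simp [imV]
    rw [h1, h2, map_add, map_add, smul_add]; abel
  map_smul' c v := by
    have h1 : reV (c • v) = c.re • reV v - c.im • imV v := by ext i; simp [reV, imV]
    have h2 : imV (c • v) = c.re • imV v + c.im • reV v := by ext i; simp [reV, imV]
    rw [h1, h2, map_sub, map_add, map_smul, map_smul, map_smul, map_smul]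
    ext i
    simp only [PiLp.add_apply, PiLp.sub_apply, PiLp.smul_apply, smul_eq_mul, Complex.real_smul,
      RingHom.id_apply]
    conv_rhs => rw [← Complex.re_add_im c]
    linear_combination (-(c.im : ℂ) * (L (imV v)) i) * Complex.I_sq

/-- The differential `T_q Y → T_{f q} Y'` of a map between manifolds modelled on `E` and `E'`, where
the tangent spaces at all points are the model spaces (through the preferred chart at the point). -/
def diff (𝕜 : Type*) [NontriviallyNormedField 𝕜] (E E' : Type*)
    [NormedAddCommGroup E] [NormedSpace 𝕜 E] [NormedAddCommGroup E'] [NormedSpace 𝕜 E']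
    {Y Y' : Type*} [TopologicalSpace Y] [ChartedSpace E Y] [TopologicalSpace Y']
    [ChartedSpace E' Y'] (f : Y → Y') (q : Y) : E →ₗ[𝕜] E' where
  toFun v := mfderiv 𝓘(𝕜, E) 𝓘(𝕜, E') f q v
  map_add' v w := map_add (mfderiv 𝓘(𝕜, E) 𝓘(𝕜, E') f q) v w
  map_smul' c v := map_smul (mfderiv 𝓘(𝕜, E) 𝓘(𝕜, E') f q) c v

/-! ## CR structures of hypersurface type on real-analytic manifolds -/

section Real

variable {d : ℕ} {M : Type*} [TopologicalSpace M] [ChartedSpace (RModel d) M]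
  [IsManifold 𝓘(ℝ, RModel d) ω M]

/-- A complex vector field on `M`, i.e. a section of `ℂTM` (the fibre of `ℂTM` at a point is the
complexification `CModel d` of the tangent space `RModel d`), is of class `C^m` at `p`. -/
def CFieldSmoothAt (m : WithTop ℕ∞) (Z : M → CModel d) (p : M) : Prop :=
  ContMDiffAt 𝓘(ℝ, RModel d) 𝓘(ℝ, RModel d).tangent m
      (fun q => (⟨q, reV (Z q)⟩ : TangentBundle 𝓘(ℝ, RModel d) M)) p ∧
    ContMDiffAt 𝓘(ℝ, RModel d) 𝓘(ℝ, RModel d).tangent m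
      (fun q => (⟨q, imV (Z q)⟩ : TangentBundle 𝓘(ℝ, RModel d) M)) p

/-- Lie bracket of real vector fields on `M`. -/
def rBracket (X Y : M → RModel d) (p : M) : RModel d :=
  VectorField.mlieBracket 𝓘(ℝ, RModel d) (fun q => (X q : TangentSpace 𝓘(ℝ, RModel d) q))
    (fun q => (Y q : TangentSpace 𝓘(ℝ, RModel d) q)) p

/-- Lie bracket of complex vector fields on `M`: the complex-bilinear extension of the Lie
bracket of real vector fields. -/
def cBracket (Z W : M → CModel d) (p : M) : CModel d :=
  ofReIm
    (rBracket (fun q => reV (Z q)) (fun q => reV (W q)) p -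
      rBracket (fun q => imV (Z q)) (fun q => imV (W q)) p)
    (rBracket (fun q => reV (Z q)) (fun q => imV (W q)) p +
      rBracket (fun q => imV (Z q)) (fun q => reV (W q)) p)

/-- `Z` is a smooth section of the complex distribution `Δ` near `p`. -/
def IsCSection (Δ : M → Submodule ℂ (CModel d)) (Z : M → CModel d) (p : M) : Prop :=
  ∀ᶠ q in 𝓝 p, CFieldSmoothAt ∞ Z q ∧ Z q ∈ Δ q

/-- `Δ` is a real-analytic complex distribution of rank `k` in `ℂTM`. -/
def IsAnalyticDistribution (k : ℕ) (Δ : M → Submodule ℂ (CModel d)) : Prop :=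
  ∀ p, Module.finrank ℂ (Δ p) = k ∧ ∃ Z : Fin k → M → CModel d,
    (∀ i, CFieldSmoothAt ω (Z i) p) ∧
      ∀ᶠ q in 𝓝 p, Δ q = Submodule.span ℂ (Set.range fun i => Z i q)

/-- The complex conjugate distribution in `ℂTM`. -/
def conjDist (Δ : M → Submodule ℂ (CModel d)) (p : M) : Submodule ℂ (CModel d) :=
  (Δ p).map (conjV d)

/-- A real-analytic CR structure of rank `n`. It is of hypersurface type when the dimension
of `M` is `2 n + 1`. -/
structure IsCRStructure (n : ℕ) (H : M → Submodule ℂ (CModel d)) : Prop where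
  analytic : IsAnalyticDistribution n H
  involutive : ∀ p Z W, IsCSection H Z p → IsCSection H W p → cBracket Z W p ∈ H p
  totally_real : ∀ p, H p ⊓ conjDist H p = ⊥

/-- `K` is the kernel of the Levi form
`(X_p, Y_p) ↦ (i/2) [X, conj Y]_p mod H_p ⊕ conj H_p` of `H`. -/
def IsLeviKernel (H K : M → Submodule ℂ (CModel d)) : Prop :=
  ∀ p v, v ∈ K p ↔ v ∈ H p ∧ ∀ X Y, IsCSection H X p → IsCSection H Y p → X p = v →
    (Complex.I / 2) • cBracket X (fun q => conjV d (Y q)) p ∈ H p ⊔ conjDist H p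

/-- 2-nondegeneracy at every point of a CR structure `H` with Levi kernel `K`. -/
def IsTwoNondegenerate (H K : M → Submodule ℂ (CModel d)) : Prop :=
  ∀ p, K p ≠ ⊥ ∧ ∀ Y, IsCSection K Y p → Y p ≠ 0 →
    ∃ X, IsCSection H X p ∧
      cBracket X (fun q => conjV d (Y q)) p ∉ K p ⊔ conjDist K p ⊔ conjDist H p

end Real

/-! ## Holomorphic distributions on complex manifolds -/

section Complex

variable {k : ℕ} {Y : Type*} [TopologicalSpace Y] [ChartedSpace (CModel k) Y]
  [IsManifold 𝓘(ℂ, CModel k) ω Y]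

/-- The vector field `Z` is holomorphic near `y`. -/
def HolFieldAt (Z : Y → CModel k) (y : Y) : Prop :=
  ContMDiffAt 𝓘(ℂ, CModel k) 𝓘(ℂ, CModel k).tangent ω
    (fun q => (⟨q, Z q⟩ : TangentBundle 𝓘(ℂ, CModel k) Y)) y

/-- Lie bracket of holomorphic vector fields. -/
def hBracket (Z W : Y → CModel k) (y : Y) : CModel k :=
  VectorField.mlieBracket 𝓘(ℂ, CModel k) (fun q => (Z q : TangentSpace 𝓘(ℂ, CModel k) q))
    (fun q => (W q : TangentSpace 𝓘(ℂ, CModel k) q)) y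

/-- `Z` is a holomorphic section of `Δ` near `y`. -/
def IsHolSection (Δ : Y → Submodule ℂ (CModel k)) (Z : Y → CModel k) (y : Y) : Prop :=
  HolFieldAt Z y ∧ ∀ᶠ q in 𝓝 y, Z q ∈ Δ q

/-- `Δ` is a holomorphic distribution of rank `m`. -/
def IsHolDistribution (m : ℕ) (Δ : Y → Submodule ℂ (CModel k)) : Prop :=
  ∀ y, Module.finrank ℂ (Δ y) = m ∧ ∃ Z : Fin m → Y → CModel k,
    (∀ i, HolFieldAt (Z i) y) ∧
      ∀ᶠ q in 𝓝 y, Δ q = Submodule.span ℂ (Set.range fun i => Z i q)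

/-- The distribution `τ_* Δ`. For an antiholomorphic involution `τ` the image under the
differential of `τ` of a complex subspace is a complex subspace, so it equals its span. -/
def barDist (τ : Y → Y) (Δ : Y → Submodule ℂ (CModel k)) (y : Y) : Submodule ℂ (CModel k) :=
  Submodule.span ℂ
    (diff ℝ (CModel k) (CModel k) τ (τ y) '' (Δ (τ y) : Set (CModel k)))

end Complex

/-! ## Complexification and Levi leaf space -/

/-- `CM` (with the antiholomorphic involution `τ` and the inclusion `ι` of `M` as its set of fixed
points) is a complexification of the real-analytic manifold `M` with CR structure `H` of
rank `n` and Levi kernel `K` of rank `r`; the holomorphic distributions `Hc` and `Kc` on `CM`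
extend `H` and `K`. As usual `CM` is taken so small that the conditions defining a CR structure and
its Levi kernel hold for the extended distributions on all of `CM`. -/
structure IsComplexification {d : ℕ}
    {M : Type*} [TopologicalSpace M] [ChartedSpace (RModel d) M]
    {CM : Type*} [TopologicalSpace CM] [ChartedSpace (CModel d) CM]
    [IsManifold 𝓘(ℂ, CModel d) ω CM]
    (n r : ℕ) (H K : M → Submodule ℂ (CModel d)) (ι : M → CM) (τ : CM → CM)
    (Hc Kc : CM → Submodule ℂ (CModel d)) : Prop where
  ι_embedding : Topology.IsEmbedding ι
  ι_analytic : ContMDiff 𝓘(ℝ, RModel d) 𝓘(ℝ, CModel d) ω ι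
  ι_complexifies : ∀ p, Function.Bijective
    (complexify (diff ℝ (RModel d) (CModel d) ι p))
  τ_analytic : ContMDiff 𝓘(ℝ, CModel d) 𝓘(ℝ, CModel d) ω τ
  τ_involutive : Function.Involutive τ
  τ_antiholomorphic : ∀ (q : CM) (v : CModel d),
    diff ℝ (CModel d) (CModel d) τ q (Complex.I • v) =
      -(Complex.I • diff ℝ (CModel d) (CModel d) τ q v)
  fixed_points : Set.range ι = {q | τ q = q}
  H_holomorphic : IsHolDistribution n Hc
  K_holomorphic : IsHolDistribution r Kc
  H_extends : ∀ p, Hc (ι p) =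
    (H p).map (complexify (diff ℝ (RModel d) (CModel d) ι p))
  K_extends : ∀ p, Kc (ι p) =
    (K p).map (complexify (diff ℝ (RModel d) (CModel d) ι p))
  H_involutive : ∀ q Z W, IsHolSection Hc Z q → IsHolSection Hc W q → hBracket Z W q ∈ Hc q
  H_transversal : ∀ q, Hc q ⊓ barDist τ Hc q = ⊥
  K_kernel : ∀ q v, v ∈ Kc q ↔ v ∈ Hc q ∧ ∀ Z W, IsHolSection Hc Z q →
    IsHolSection (barDist τ Hc) W q → Z q = v → hBracket Z W q ∈ Hc q ⊔ barDist τ Hc q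

section LeafSpace

variable {d : ℕ} (k : ℕ) {CM : Type*} [TopologicalSpace CM] [ChartedSpace (CModel d) CM]
  {N : Type*} [TopologicalSpace N] [ChartedSpace (CModel k) N]

/-- `π : CM → N` is the projection onto the space of leaves of the foliation tangent to
`K ⊕ τ_* K`: a holomorphic submersion whose fibres are connected and tangent to this
distribution. -/
structure IsLeviLeafSpace (τ : CM → CM) (Kc : CM → Submodule ℂ (CModel d)) (π : CM → N) :
    Prop where
  holomorphic : ContMDiff 𝓘(ℂ, CModel d) 𝓘(ℂ, CModel k) ω π
  submersion : ∀ q, Function.Surjective (diff ℂ (CModel d) (CModel k) π q)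
  kernel : ∀ q, LinearMap.ker (diff ℂ (CModel d) (CModel k) π q) = Kc q ⊔ barDist τ Kc q
  leaves : ∀ γ, IsConnected (π ⁻¹' {γ})

/-- The contact distribution `π_* (H ⊕ τ_* H)` on the Levi leaf space. -/
def leafD (τ : CM → CM) (Hc : CM → Submodule ℂ (CModel d)) (π : CM → N) (γ : N) :
    Submodule ℂ (CModel k) :=
  ⨆ q : {q : CM // π q = γ}, (Hc q.1 ⊔ barDist τ Hc q.1).map (diff ℂ (CModel d) (CModel k) π q.1)

/-- `J⁻(q) = π_* H_q`, a subspace of the tangent space of the leaf space at `π q`. -/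
def Jminus (Hc : CM → Submodule ℂ (CModel d)) (π : CM → N) (q : CM) : Submodule ℂ (CModel k) :=
  (Hc q).map (diff ℂ (CModel d) (CModel k) π q)

/-- `J⁺(q) = π_* (τ_* H)_q`. -/
def Jplus (τ : CM → CM) (Hc : CM → Submodule ℂ (CModel d)) (π : CM → N) (q : CM) :
    Submodule ℂ (CModel k) :=
  (barDist τ Hc q).map (diff ℂ (CModel d) (CModel k) π q)

/-- Let `J, J' : CM → {subspaces}` with `J q ⊕ J' q = D` for `q` in the fibre of `π` over `γ`.
This is the tangent space at `J q` of the family of subspaces `{J q' | π q' = γ}`, where a tangent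
vector to the Grassmannian at `J q` is regarded as an element of
`Hom (J q, D / J q) = Hom (J q, J' q)`, which is extended by zero on `J' q` to an endomorphism
of `D`. The tangent vector of a curve of subspaces `J (c t)` maps `e 0` to the class of `e' 0`,
for every smooth curve of vectors `e t ∈ J (c t)`. -/
def tangentFamily (π : CM → N) (γ : N) (D : Submodule ℂ (CModel k))
    (J J' : CM → Submodule ℂ (CModel k)) (q : CM) : Set (Module.End ℂ D) :=
  {A | (∀ x : D, (x : CModel k) ∈ J' q → A x = 0) ∧
    (∀ x : D, (x : CModel k) ∈ J q → (A x : CModel k) ∈ J' q) ∧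
    ∃ ε : ℝ, 0 < ε ∧ ∃ c : ℝ → CM,
      ContMDiffOn 𝓘(ℝ, ℝ) 𝓘(ℝ, CModel d) ∞ c (Set.Ioo (-ε) ε) ∧
      (∀ t ∈ Set.Ioo (-ε) ε, π (c t) = γ) ∧ c 0 = q ∧
      ∀ x : D, (x : CModel k) ∈ J q → ∃ η : ℝ, 0 < η ∧ η ≤ ε ∧ ∃ e : ℝ → CModel k,
        ContDiffOn ℝ ∞ e (Set.Ioo (-η) η) ∧ (∀ t ∈ Set.Ioo (-η) η, e t ∈ J (c t)) ∧
        e 0 = x ∧ deriv e 0 - A x ∈ J q}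

end LeafSpace

/-! ## CR symbols -/

/-- A CR symbol with involution, on the space `V = 𝔤₋₁`. The conformal symplectic
structure of `𝔤₋₁` is given by one of its representatives `form`. -/
structure CRSymbol (V : Type*) [AddCommGroup V] [Module ℂ V] (r : ℕ) where
  form : V →ₗ[ℂ] V →ₗ[ℂ] ℂ
  form_alt : ∀ x, form x x = 0
  form_nondeg : ∀ x, (∀ y, form x y = 0) → x = 0
  /-- the antilinear involution -/
  σ : V →ₛₗ[starRingEnd ℂ] V
  σ_involutive : Function.Involutive σ
  σ_conformal : ∃ c : ℂ, c ≠ 0 ∧ ∀ x y, form (σ x) (σ y) = c * starRingEnd ℂ (form x y)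
  /-- `𝔤₋₁,₋₁` -/
  Vm : Submodule ℂ V
  /-- `𝔤₋₁,₁` -/
  Vp : Submodule ℂ V
  splitting : IsCompl Vm Vp
  lagrangian_m : ∀ x ∈ Vm, ∀ y ∈ Vm, form x y = 0
  lagrangian_p : ∀ x ∈ Vp, ∀ y ∈ Vp, form x y = 0
  σ_swaps : Vm.map σ = Vp
  /-- `𝔤₀,₂`, a space of symmetric maps `𝔤₋₁,₋₁ → 𝔤₋₁,₁`, extended by zero -/
  g2 : Submodule ℂ (Module.End ℂ V)
  /-- `𝔤₀,₋₂`, a space of symmetric maps `𝔤₋₁,₁ → 𝔤₋₁,₋₁`, extended by zero -/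
  gm2 : Submodule ℂ (Module.End ℂ V)
  g2_degree : ∀ A ∈ g2, (∀ x ∈ Vp, A x = 0) ∧ (∀ x ∈ Vm, A x ∈ Vp)
  gm2_degree : ∀ A ∈ gm2, (∀ x ∈ Vm, A x = 0) ∧ (∀ x ∈ Vp, A x ∈ Vm)
  g2_symm : ∀ A ∈ g2, ∀ x y, form (A x) y + form x (A y) = 0
  gm2_symm : ∀ A ∈ gm2, ∀ x y, form (A x) y + form x (A y) = 0
  g2_rank : Module.finrank ℂ g2 = r
  gm2_rank : Module.finrank ℂ gm2 = r
  σ_g2 : ∀ A ∈ g2, ∃ B ∈ gm2, ∀ x, B x = σ (A (σ x))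

section Symbol

variable {V : Type*} [NormedAddCommGroup V] [NormedSpace ℂ V] {r : ℕ}

/-- The bracket of the Heisenberg algebra `𝔤₋ = 𝔤₋₁ ⊕ 𝔤₋₂ = V × ℂ`. -/
def heis (S : CRSymbol V r) (x y : V × ℂ) : V × ℂ := (0, S.form x.1 y.1)

/-- The conformal symplectic algebra `𝔠𝔰𝔭(𝔤₋)`: the Lie algebra of derivations of the Heisenberg
algebra `𝔤₋` that preserve the grading. Restriction to `𝔤₋₁` identifies it with `𝔠𝔰𝔭(𝔤₋₁)`. -/
def csp (S : CRSymbol V r) : LieSubalgebra ℂ (Module.End ℂ (V × ℂ)) where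
  carrier := {A | (∀ v, (A (v, 0)).2 = 0) ∧ (∀ z, (A (0, z)).1 = 0) ∧
    ∀ x y, A (heis S x y) = heis S (A x) y + heis S x (A y)}
  add_mem' := by
    rintro A B ⟨h1, h2, h3⟩ ⟨k1, k2, k3⟩
    refine ⟨fun v => by simp [h1, k1], fun z => by simp [h2, k2], fun x y => ?_⟩
    simp only [LinearMap.add_apply, h3, k3]
    ext <;> simp [heis]; ring
  zero_mem' := ⟨by simp, by simp, fun x y => by ext <;> simp [heis]⟩
  smul_mem' := by
    rintro c A ⟨h1, h2, h3⟩
    refine ⟨fun v => by simp [h1], fun z => by simp [h2], fun x y => ?_⟩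
    simp only [LinearMap.smul_apply, h3]
    ext <;> simp [heis]; ring
  lie_mem' := by
    rintro A B ⟨h1, h2, h3⟩ ⟨k1, k2, k3⟩
    have e1 : ∀ (C : Module.End ℂ (V × ℂ)), (∀ v, (C (v, 0)).2 = 0) →
        ∀ v, C (v, 0) = ((C (v, 0)).1, 0) := fun C h v => Prod.ext rfl (h v)
    have e2 : ∀ (C : Module.End ℂ (V × ℂ)), (∀ z, (C (0, z)).1 = 0) →
        ∀ z, C (0, z) = (0, (C (0, z)).2) := fun C h z => Prod.ext (h z) rfl
    have ha : ∀ (C : Module.End ℂ (V × ℂ)) (x y z w : V × ℂ),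
        C (heis S x y + heis S z w) = C (heis S x y) + C (heis S z w) :=
      fun C x y z w => map_add C _ _
    refine ⟨fun v => ?_, fun z => ?_, fun x y => ?_⟩
    · rw [Ring.lie_def, LinearMap.sub_apply, Module.End.mul_apply, Module.End.mul_apply,
        Prod.snd_sub, e1 B k1 v, e1 A h1 v, h1, k1, sub_zero]
    · rw [Ring.lie_def, LinearMap.sub_apply, Module.End.mul_apply, Module.End.mul_apply,
        Prod.fst_sub, e2 B k2 z, e2 A h2 z, h2, k2, sub_zero]
    · rw [Ring.lie_def, LinearMap.sub_apply, Module.End.mul_apply, Module.End.mul_apply, k3, h3,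
        ha, ha, h3, h3, k3, k3]
      ext <;> simp [heis]; ring

/-! ## The bundle of adapted frames and the modified symbol -/

/-- A graded linear isomorphism from `𝔤₋ = V ⊕ ℂ` to `D ⊕ T/D`, where `D` is a subspace of
a tangent space `T` of the leaf space. -/
structure GrFrame (V : Type*) [AddCommGroup V] [Module ℂ V] {k : ℕ}
    (D : Submodule ℂ (CModel k)) where
  deg1 : V ≃ₗ[ℂ] D
  deg2 : ℂ ≃ₗ[ℂ] (CModel k ⧸ D)

/-- The endomorphism `φ⁻¹ ∘ ψ` of `𝔤₋`. -/
def GrFrame.rel {k : ℕ} {D : Submodule ℂ (CModel k)} (φ ψ : GrFrame V D) :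
    Module.End ℂ (V × ℂ) :=
  LinearMap.prodMap (φ.deg1.symm.toLinearMap ∘ₗ ψ.deg1.toLinearMap)
    (φ.deg2.symm.toLinearMap ∘ₗ ψ.deg2.toLinearMap)

variable {d : ℕ} (k : ℕ) {CM : Type*} [TopologicalSpace CM] [ChartedSpace (CModel d) CM]
  {N : Type*} [TopologicalSpace N] [ChartedSpace (CModel k) N]
  [IsManifold 𝓘(ℂ, CModel k) ω N]

/-- The frame `φ` is adapted at the point `q` of the fibre over `γ`, i.e. it is an isomorphism of
bigraded Lie algebras from `𝔤₋` to `𝔤₋(q) = D_γ ⊕ T_γ N / D_γ`, with the Lie bracket induced by the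
Lie bracket of sections of `D`, that takes `𝔤₀,₂` and `𝔤₀,₋₂` to the tangent spaces
of `J⁻` and `J⁺`. -/
structure IsAdapted (S : CRSymbol V r) (τ : CM → CM) (Hc : CM → Submodule ℂ (CModel d))
    (π : CM → N) (γ : N) (q : CM) (φ : GrFrame V (leafD k τ Hc π γ)) : Prop where
  minus : (S.Vm.map φ.deg1.toLinearMap).map (leafD k τ Hc π γ).subtype = Jminus k Hc π q
  plus : (S.Vp.map φ.deg1.toLinearMap).map (leafD k τ Hc π γ).subtype = Jplus k τ Hc π q
  conj_g2 : (fun A => φ.deg1.symm.conj A) ''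
    tangentFamily (d := d) k π γ (leafD k τ Hc π γ) (Jminus k Hc π) (Jplus k τ Hc π) q = S.g2
  conj_gm2 : (fun A => φ.deg1.symm.conj A) ''
    tangentFamily (d := d) k π γ (leafD k τ Hc π γ) (Jplus k τ Hc π) (Jminus k Hc π) q = S.gm2
  bracket : ∀ (x y : V) (X Y : N → CModel k), IsHolSection (leafD k τ Hc π) X γ →
    IsHolSection (leafD k τ Hc π) Y γ → X γ = φ.deg1 x → Y γ = φ.deg1 y →
    φ.deg2 (S.form x y) = (leafD k τ Hc π γ).mkQ (hBracket X Y γ)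

/-- The fibre over the point `γ` of the leaf space of the bundle `P⁰` of adapted frames. -/
def P0 (S : CRSymbol V r) (τ : CM → CM) (Hc : CM → Submodule ℂ (CModel d)) (π : CM → N)
    (γ : N) : Set (CM × GrFrame V (leafD k τ Hc π γ)) :=
  {ψ | π ψ.1 = γ ∧ IsAdapted k S τ Hc π γ ψ.1 ψ.2}

/-- The CR structure has constant symbol, with model `S`: the symbols at all points of `CM` are
isomorphic to `S`, i.e. the projection `P⁰ → CM` is onto. -/
def HasConstantSymbol (S : CRSymbol V r) (τ : CM → CM) (Hc : CM → Submodule ℂ (CModel d))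
    (π : CM → N) : Prop :=
  ∀ q, ∃ φ, (q, φ) ∈ P0 k S τ Hc π (π q)

/-- The degree zero component `𝔤₀ᵐᵒᵈ(ψ)` of the modified symbol at the point `ψ` of `P⁰`: the set
of all `ψ(0)⁻¹ ψ'(0)`, for the smooth curves `t ↦ ψ(t)` with `ψ(0) = ψ` in the fibre of `P⁰`
over `γ`. -/
def modSymbol (S : CRSymbol V r) (τ : CM → CM) (Hc : CM → Submodule ℂ (CModel d)) (π : CM → N)
    (γ : N) (ψ : CM × GrFrame V (leafD k τ Hc π γ)) : Set (Module.End ℂ (V × ℂ)) :=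
  {A | ∃ ε : ℝ, 0 < ε ∧ ∃ c : ℝ → CM × GrFrame V (leafD k τ Hc π γ),
    (∀ t ∈ Set.Ioo (-ε) ε, c t ∈ P0 k S τ Hc π γ) ∧ c 0 = ψ ∧
    ContMDiffOn 𝓘(ℝ, ℝ) 𝓘(ℝ, CModel d) ∞ (fun t => (c t).1) (Set.Ioo (-ε) ε) ∧
    (∀ x, ContDiffOn ℝ ∞ (fun t => ψ.2.rel (c t).2 x) (Set.Ioo (-ε) ε)) ∧
    ∀ x, HasDerivAt (fun t => ψ.2.rel (c t).2 x) (A x) 0}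

/-- The CR structure has constant modified symbol `𝔤₋ ⊕ g₀`. -/
def HasConstantModifiedSymbol (S : CRSymbol V r) (τ : CM → CM)
    (Hc : CM → Submodule ℂ (CModel d)) (π : CM → N)
    (g₀ : Submodule ℂ (Module.End ℂ (V × ℂ))) : Prop :=
  ∀ γ, ∀ ψ ∈ P0 k S τ Hc π γ, modSymbol k S τ Hc π γ ψ = g₀

end Symbol

end CRGeom

end

/-! Fix a leaf `γ` and an adapted frame `φ₀` over it. Each adapted frame `φ` over `γ` becomes a unit
`φ₀⁻¹ ∘ φ` of `End (V × ℂ)`, and `g₀` consists of the left logarithmic derivatives, at any chosen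
frame, of smooth curves of such units.

Suppose first that a smooth family `Φ` of adapted frames is given over a nonempty open part of the
leaf, and put `Γ = φ₀⁻¹ ∘ Φ`. The Maurer-Cartan form `η = Γ⁻¹ dΓ` takes values in `g₀`. Derivatives
of functions with values in a linear space stay in that space, so the structure equation `dη = -η ∧
η` gives `[η v, η w] ∈ g₀` (`lie_mem_of_maurerCartan`).

A curve of frames through `Φ u` with logarithmic derivative `x` differs from `Φ` over its base curve
by a curve `κ` of automorphisms of the symbol, with `κ 0 = 1`. Hence `x = z + η v` with `z = κ' 0`.
Composition with `κ t` turns adapted frames, at whatever point, into adapted frames; because `g₀` is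
the same at all frames, conjugation by `κ t` preserves it (`conj_relL_mem`), and differentiation
gives `[z, g₀] ⊆ g₀`. If also `y = z' + η v'`, then `[x, y] = [z, y] - [z', η v] + [η v, η v']`, and
all three terms lie in `g₀` (`lie_mem_of_smooth_frames`).

It remains to find `Φ`: the constancy of the symbol supplies frames only point by point. Read
through `φ₀`, the geometry at the parameter `u` of a leaf chart consists of the symplectic form up
to scale, the projection `P u` onto `J⁻` along `J⁺`, and the ranges of `dP · P` and `d(1 - P) · (1 -
P)`, which are the tangent spaces of the two families of subspaces (`conj_tangentFamily`). These
data are smooth in `u` and pointwise conjugate to those of the model, so they define a smooth map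
into one orbit of a linear group. Such a map lifts to the group over some nonempty open set
(`exists_smooth_lift_of_orbit`): the orbit map has constant rank, hence local sections over its
image, and Baire's theorem finds an open set whose image lies in one translate of a small compact
piece. Passing to a smaller open set is harmless, since the claim concerns the single space `g₀`.

The inclusion in `csp S` holds because the bracket on `D` depends on `γ` alone, so any two adapted
frames over `γ` differ by a conformal symplectic map. This needs holomorphic sections of `D` through
every vector, hence local holomorphic frames of `τ_* H`. -/

noncomputable section

namespace CRGeom

section

/-! ### Maps of constant rank. -/

section ConstantRank

variable {E X : Type*} [NormedAddCommGroup E] [NormedSpace ℝ E] [FiniteDimensional ℝ E]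
  [NormedAddCommGroup X] [NormedSpace ℝ X] [FiniteDimensional ℝ X]

/-- Every linear map has a reflexive generalized inverse. -/
theorem exists_generalizedInverse (T : E →L[ℝ] X) :
    ∃ Q : X →L[ℝ] E, (∀ x, T (Q (T x)) = T x) ∧ ∀ y, Q (T (Q y)) = Q y := by
  obtain ⟨R, hR⟩ := T.toLinearMap.rangeRestrict.exists_rightInverse_of_surjective
    (LinearMap.range_rangeRestrict _)
  obtain ⟨p, hp⟩ := (LinearMap.range T.toLinearMap).subtype.exists_leftInverse_of_injective
    (Submodule.ker_subtype _)
  have hR' : ∀ y : LinearMap.range T.toLinearMap, T (R y) = (y : X) := fun y =>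
    congrArg Subtype.val (LinearMap.congr_fun hR y)
  have hp' : ∀ y : LinearMap.range T.toLinearMap, p y = y := fun y => LinearMap.congr_fun hp y
  refine ⟨LinearMap.toContinuousLinearMap (R ∘ₗ p), fun x => ?_, fun y => ?_⟩
  · have := hp' ⟨T x, x, rfl⟩
    simp only [LinearMap.coe_toContinuousLinearMap', LinearMap.comp_apply]
    rw [hR']
    exact congrArg Subtype.val this
  · simp only [LinearMap.coe_toContinuousLinearMap', LinearMap.comp_apply]
    rw [hR', hp']

/-- A map of constant rank has local sections over its image. -/
theorem exists_section_of_constant_rank {o : E → X} {a₀ : E}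
    (ho : ∀ᶠ a in 𝓝 a₀, ContDiffAt ℝ ω o a)
    (hrank : ∀ᶠ a in 𝓝 a₀, Module.finrank ℝ (LinearMap.ker (fderiv ℝ o a).toLinearMap) =
      Module.finrank ℝ (LinearMap.ker (fderiv ℝ o a₀).toLinearMap)) :
    ∃ s : X → E, s (o a₀) = a₀ ∧ (∀ᶠ x in 𝓝 (o a₀), ContDiffAt ℝ ω s x) ∧
      ∀ᶠ a in 𝓝 a₀, o (s (o a)) = o a := by
  -- With `T` the derivative of `o` at `a₀`, the reflexive inverse `Q` makes `p = Q T` an idempotent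
  -- with the same kernel as `T`.
  obtain ⟨Q, hTQT, hQTQ⟩ := exists_generalizedInverse (fderiv ℝ o a₀)
  set T := fderiv ℝ o a₀ with hT
  set p : E →L[ℝ] E := Q ∘L T with hp
  have hpp : ∀ x, p (p x) = p x := fun x => hQTQ (T x)
  have hpQ : ∀ x, p (Q x) = Q x := fun x => hQTQ x
  have hker : ∀ x, T x = 0 ↔ p x = 0 := fun x =>
    ⟨fun h => by simp [hp, h], fun h => by
      rw [← hTQT x]; change T (p x) = 0; rw [h, map_zero]⟩
  -- `Θ` has identity derivative at `a₀`, since `Q T + (1 - p) = 1`. In the coordinates `Θ` the map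
  -- `o` depends only on the component in the range of `p`.
  set Θ : E → E := fun a => Q (o a) + (a - p a) with hΘ
  have hΘd : ∀ᶠ a in 𝓝 a₀, HasFDerivAt Θ (Q ∘L fderiv ℝ o a + (.id ℝ E - p)) a := by
    filter_upwards [ho] with a ha
    exact (Q.hasFDerivAt.comp a (ha.differentiableAt (by simp)).hasFDerivAt).add
      ((hasFDerivAt_id a).sub p.hasFDerivAt)
  have hΘ0 : HasFDerivAt Θ ((ContinuousLinearEquiv.refl ℝ E : E ≃L[ℝ] E) : E →L[ℝ] E) a₀ := by
    convert! hΘd.self_of_nhds using 1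
    ext x
    simp [hp, hT]
  have hΘc : ContDiffAt ℝ ω Θ a₀ :=
    (Q.contDiff.contDiffAt.comp a₀ ho.self_of_nhds).add
      (contDiffAt_id.sub p.contDiff.contDiffAt)
  let e := hΘc.toOpenPartialHomeomorph Θ hΘ0 (by simp)
  have he : (e : E → E) = Θ := rfl
  have ha₀ : a₀ ∈ e.source := hΘc.mem_toOpenPartialHomeomorph_source hΘ0 (by simp)
  set y₀ := Θ a₀ with hy₀
  have hy₀t : y₀ ∈ e.target := e.map_source ha₀
  have hsymm0 : e.symm y₀ = a₀ := e.left_inv ha₀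
  have hsymmc : ContDiffAt ℝ ω e.symm y₀ :=
    e.contDiffAt_symm hy₀t (by rw [hsymm0]; exact hΘ0) (by rw [hsymm0]; exact hΘc)
  -- on a neighbourhood of `y₀`, `o ∘ e.symm` is constant along `ker T`
  have hgood : ∀ᶠ y in 𝓝 y₀, HasFDerivAt (fun y => o (e.symm y))
      (fderiv ℝ (fun y => o (e.symm y)) y) y ∧
      ∀ w, p w = 0 → fderiv ℝ (fun y => o (e.symm y)) y w = 0 := by
    have ht : Filter.Tendsto e.symm (𝓝 y₀) (𝓝 a₀) := by
      have := (e.continuousAt_symm hy₀t).tendsto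
      rwa [hsymm0] at this
    filter_upwards [ht.eventually hΘd, ht.eventually hrank, ht.eventually ho,
      hsymmc.eventually (by simp), e.open_target.mem_nhds hy₀t] with y h1 h2 h3 h4 h5
    have d4 := (h4.differentiableAt (by simp)).hasFDerivAt
    have d3 := (h3.differentiableAt (by simp)).hasFDerivAt
    have d : HasFDerivAt (fun y => o (e.symm y)) (fderiv ℝ o (e.symm y) ∘L fderiv ℝ e.symm y) y :=
      d3.comp y d4
    rw [d.fderiv]
    refine ⟨d, fun w hw => ?_⟩
    -- the derivatives of `Θ` and `e.symm` are inverse to each other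
    have hinv : HasFDerivAt (fun z => Θ (e.symm z)) (ContinuousLinearMap.id ℝ E) y := by
      refine (hasFDerivAt_id y).congr_of_eventuallyEq ?_
      filter_upwards [e.open_target.mem_nhds h5] with z hz
      exact e.right_inv hz
    have hcomp := (h1.comp y d4).unique hinv
    set D := fderiv ℝ o (e.symm y) with hD
    set G := fderiv ℝ e.symm y with hG
    have hc : ∀ z, Q (D (G z)) + (G z - p (G z)) = z := fun z => by
      simpa using DFunLike.congr_fun hcomp z
    have hinj : Function.Surjective G := by
      have : Function.Injective G.toLinearMap := fun z z' h => by
        have h' : G z = G z' := h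
        rw [← hc z, ← hc z', h']
      exact (LinearMap.injective_iff_surjective (f := G.toLinearMap)).1 this
    have hinjG : Function.Injective G := fun z z' h => by rw [← hc z, ← hc z', h]
    -- `G` maps `ker T` onto `ker D`
    have hle : (LinearMap.ker D.toLinearMap) ≤ (LinearMap.ker T.toLinearMap).map G.toLinearMap := by
      intro k hk
      obtain ⟨z, rfl⟩ := hinj k
      refine ⟨z, ?_, rfl⟩
      have hk' : D (G z) = 0 := hk
      have : p z = 0 := by
        rw [← hc z, hk']
        simp [hpp]
      exact (hker z).2 this
    have heq := Submodule.eq_of_le_of_finrank_eq hle (by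
      rw [h2]; exact (Submodule.equivMapOfInjective G.toLinearMap hinjG _).finrank_eq)
    have : G w ∈ LinearMap.ker D.toLinearMap := by
      rw [heq]
      exact ⟨w, (hker w).2 hw, rfl⟩
    exact this
  obtain ⟨ε, hε, hball⟩ := Metric.eventually_nhds_iff_ball.1 hgood
  have hconst : ∀ y ∈ Metric.ball y₀ ε, ∀ z ∈ Metric.ball y₀ ε, p (z - y) = 0 →
      o (e.symm z) = o (e.symm y) := by
    intro y hy z hz hyz
    have hseg : ∀ t ∈ Set.Icc (0 : ℝ) 1, y + t • (z - y) ∈ Metric.ball y₀ ε := by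
      intro t ht
      exact (convex_ball y₀ ε).add_smul_sub_mem hy hz ht
    have hd : ∀ t ∈ Set.Icc (0 : ℝ) 1,
        HasDerivAt (fun t : ℝ => o (e.symm (y + t • (z - y)))) 0 t := by
      intro t ht
      obtain ⟨h1, h2⟩ := hball _ (hseg t ht)
      have hl : HasDerivAt (fun t : ℝ => y + t • (z - y)) (z - y) t := by
        simpa using ((hasDerivAt_id t).smul_const (z - y)).const_add y
      have := h1.comp_hasDerivAt t hl
      rwa [h2 _ hyz] at this
    have := constant_of_has_deriv_right_zero (f := fun t : ℝ => o (e.symm (y + t • (z - y))))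
      (fun t ht => (hd t ht).continuousAt.continuousWithinAt)
      (fun t ht => (hd t ⟨ht.1, ht.2.le⟩).hasDerivWithinAt) 1 (by simp)
    simpa using this
  have hbase : Q (o a₀) + (y₀ - p y₀) = y₀ := by
    have : p y₀ = Q (o a₀) := by simp [hy₀, hΘ, hpp, hpQ]
    rw [this]; abel
  have hpΘ : ∀ a, p (Θ a) = Q (o a) := fun a => by simp [hΘ, hpp, hpQ]
  -- `Q x` prescribes the `p`-component of the point, because `p (Θ a) = Q (o a)`; the complementary
  -- component is frozen at its value at `y₀`.
  refine ⟨fun x => e.symm (Q x + (y₀ - p y₀)), by simp only [hbase, hsymm0], ?_, ?_⟩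
  · have h1 : ∀ᶠ y in 𝓝 y₀, ContDiffAt ℝ ω e.symm y := hsymmc.eventually (by simp)
    have h2 : Filter.Tendsto (fun x => Q x + (y₀ - p y₀)) (𝓝 (o a₀)) (𝓝 y₀) := by
      have : Continuous fun x => Q x + (y₀ - p y₀) := by fun_prop
      have := this.tendsto (o a₀)
      rwa [hbase] at this
    filter_upwards [h2.eventually h1] with x hx
    exact hx.comp x ((Q.contDiff.add contDiff_const).contDiffAt)
  · have hc0 : ContinuousAt Θ a₀ := hΘ0.continuousAt
    have hoc : ContinuousAt o a₀ := ho.self_of_nhds.continuousAt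
    have h1 : ∀ᶠ a in 𝓝 a₀, Θ a ∈ Metric.ball y₀ ε :=
      hc0.eventually (Metric.ball_mem_nhds _ hε)
    have h2 : ∀ᶠ a in 𝓝 a₀, Q (o a) + (y₀ - p y₀) ∈ Metric.ball y₀ ε := by
      have hcc : ContinuousAt (fun a => Q (o a) + (y₀ - p y₀)) a₀ :=
        (Q.continuous.continuousAt.comp hoc).add continuousAt_const
      refine hcc.eventually_mem ?_
      simp only [hbase]
      exact Metric.ball_mem_nhds _ hε
    filter_upwards [h1, h2, e.open_source.mem_nhds ha₀] with a h1 h2 h3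
    rw [hconst _ h1 _ h2, ← he, e.left_inv h3]
    rw [map_sub, map_add, map_sub, hpQ, hpp, hpΘ a]
    abel

end ConstantRank

end

section

/-! ### Lifting smooth maps with values in an orbit. -/

section Orbit

variable {𝒜 X U : Type*} [NormedRing 𝒜] [NormedAlgebra ℝ 𝒜] [FiniteDimensional ℝ 𝒜]
  [NormedAddCommGroup X] [NormedSpace ℝ X] [FiniteDimensional ℝ X]
  [NormedAddCommGroup U] [NormedSpace ℝ U] [FiniteDimensional ℝ U]

/-- Orbit maps of the unit group of a finite-dimensional algebra have local sections over their
image. -/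
theorem exists_section_of_orbit {o : 𝒜 → X} {ρ : 𝒜ˣ → X →L[ℝ] X}
    (ho : ∀ g : 𝒜ˣ, ContDiffAt ℝ ω o g) (hmul : ∀ g h : 𝒜ˣ, o (g * h : 𝒜ˣ) = ρ g (o h))
    (hinv : ∀ g x, ρ g⁻¹ (ρ g x) = x) :
    ∃ s : X → 𝒜, s (o 1) = 1 ∧ (∀ᶠ x in 𝓝 (o 1), ContDiffAt ℝ ω s x) ∧
      ∀ᶠ a in 𝓝 (1 : 𝒜), o (s (o a)) = o a := by
  have : CompleteSpace 𝒜 := FiniteDimensional.complete ℝ 𝒜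
  have hU : ∀ᶠ a in 𝓝 (1 : 𝒜), IsUnit a := Units.isOpen.mem_nhds isUnit_one
  -- Equivariance gives `ker do_g = g · ker do_1` at every unit `g`, so the rank is constant near
  -- `1`.
  apply exists_section_of_constant_rank
  · filter_upwards [hU] with a ha
    obtain ⟨g, rfl⟩ := ha
    exact ho g
  · filter_upwards [hU] with a ha
    obtain ⟨g, rfl⟩ := ha
    -- `o (g * b) = ρ g (o b)` near `b = 1`
    have h1 : HasFDerivAt (fun b : 𝒜 => o (g * b))
        (fderiv ℝ o (g : 𝒜) ∘L ContinuousLinearMap.mul ℝ 𝒜 g) 1 := by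
      have hm : HasFDerivAt (fun b : 𝒜 => (g : 𝒜) * b) (ContinuousLinearMap.mul ℝ 𝒜 g) 1 :=
        (ContinuousLinearMap.mul ℝ 𝒜 (g : 𝒜)).hasFDerivAt
      have ho' : HasFDerivAt o (fderiv ℝ o (g : 𝒜)) ((g : 𝒜) * 1) := by
        rw [mul_one]
        exact ((ho g).differentiableAt (by simp)).hasFDerivAt
      exact ho'.comp (1 : 𝒜) hm
    have h2 : HasFDerivAt (fun b : 𝒜 => o (g * b)) (ρ g ∘L fderiv ℝ o 1) 1 := by
      have ho' : HasFDerivAt o (fderiv ℝ o (1 : 𝒜)) (1 : 𝒜) :=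
        ((ho 1).differentiableAt (by simp)).hasFDerivAt
      refine ((ρ g).hasFDerivAt.comp (1 : 𝒜) ho').congr_of_eventuallyEq ?_
      filter_upwards [hU] with b hb
      obtain ⟨h, rfl⟩ := hb
      exact hmul g h
    have h3 := h1.unique h2
    have h4 : ∀ ξ, fderiv ℝ o (g : 𝒜) (g * ξ) = ρ g (fderiv ℝ o 1 ξ) := fun ξ =>
      DFunLike.congr_fun h3 ξ
    let m : 𝒜 →ₗ[ℝ] 𝒜 := LinearMap.mulLeft ℝ (g : 𝒜)
    have hm : Function.Injective m := fun x y h => (Units.mul_right_inj g).1 h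
    have : LinearMap.ker (fderiv ℝ o (g : 𝒜)).toLinearMap =
        (LinearMap.ker (fderiv ℝ o (1 : 𝒜)).toLinearMap).map m := by
      ext x
      constructor
      · intro hx
        refine ⟨(g⁻¹ : 𝒜ˣ) * x, ?_, by simp [m]⟩
        have hx' : fderiv ℝ o (g : 𝒜) x = 0 := hx
        have := h4 ((g⁻¹ : 𝒜ˣ) * x)
        rw [Units.mul_inv_cancel_left, hx'] at this
        change fderiv ℝ o 1 _ = 0
        rw [← hinv g (fderiv ℝ o 1 _), ← this, map_zero]
      · rintro ⟨ξ, hξ, rfl⟩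
        have hξ' : fderiv ℝ o (1 : 𝒜) ξ = 0 := hξ
        change fderiv ℝ o (g : 𝒜) (g * ξ) = 0
        rw [h4, hξ', map_zero]
    rw [this]
    exact (Submodule.equivMapOfInjective m hm _).finrank_eq.symm

/-- A smooth map with values in one orbit of the unit group of a finite-dimensional algebra lifts,
over some nonempty open set, to a smooth map to the group. -/
theorem exists_smooth_lift_of_orbit {o : 𝒜 → X} {ρ : 𝒜ˣ → X →L[ℝ] X}
    (ho : ∀ g : 𝒜ˣ, ContDiffAt ℝ ω o g) (hmul : ∀ g h : 𝒜ˣ, o (g * h : 𝒜ˣ) = ρ g (o h))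
    (hinv : ∀ g x, ρ g⁻¹ (ρ g x) = x)
    {O : Set U} (hO : IsOpen O) (hne : O.Nonempty) {W : U → X}
    (hW : ∀ u ∈ O, ContDiffAt ℝ ∞ W u) (horb : ∀ u ∈ O, ∃ g : 𝒜ˣ, W u = o g) :
    ∃ O' ⊆ O, IsOpen O' ∧ O'.Nonempty ∧ ∃ γ : U → 𝒜,
      ∀ u ∈ O', ContDiffAt ℝ ∞ γ u ∧ IsUnit (γ u) ∧ o (γ u) = W u := by
  have : CompleteSpace 𝒜 := FiniteDimensional.complete ℝ 𝒜
  have : CompleteSpace U := FiniteDimensional.complete ℝ U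
  have : ProperSpace 𝒜 := FiniteDimensional.proper ℝ 𝒜
  obtain ⟨s, hs1, hs, hos⟩ := exists_section_of_orbit ho hmul hinv
  have hinv' : ∀ g x, ρ g (ρ g⁻¹ x) = x := fun g x => by simpa using hinv g⁻¹ x
  have hUo : IsOpen {a : 𝒜 | IsUnit a} := Units.isOpen
  have ho1 : ContinuousAt o 1 := (ho 1).continuousAt
  have hsu : ∀ᶠ x in 𝓝 (o 1), IsUnit (s x) := by
    have : ContinuousAt s (o 1) := hs.self_of_nhds.continuousAt
    exact this.eventually_mem (by rw [hs1]; exact hUo.mem_nhds isUnit_one)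
  have hev : ∀ᶠ a in 𝓝 (1 : 𝒜), o (s (o a)) = o a ∧ IsUnit a ∧ IsUnit (s (o a)) ∧
      ContDiffAt ℝ ω s (o a) := by
    filter_upwards [hos, hUo.mem_nhds isUnit_one, ho1.eventually hsu, ho1.eventually hs]
      with a h1 h2 h3 h4
    exact ⟨h1, h2, h3, h4⟩
  -- The orbit need not be locally closed. A compact ball `B` is taken so that the translates of `o
  -- '' B` are closed sets, to which Baire's theorem applies.
  obtain ⟨ε, hε, hB⟩ := Metric.nhds_basis_closedBall.eventually_iff.1 hev
  set B : Set 𝒜 := Metric.closedBall 1 ε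
  have hBc : IsCompact B := isCompact_closedBall 1 ε
  have hoB : ContinuousOn o B := fun a ha => by
    obtain ⟨g, hg⟩ := (hB ha).2.1
    rw [← hg]
    exact (ho g).continuousAt.continuousWithinAt
  -- countably many translates of `B` cover the group
  obtain ⟨t, htU, htc, hcov⟩ := TopologicalSpace.countable_cover_nhdsWithin
    (s := {a : 𝒜 | IsUnit a}) (f := fun g => {h | Ring.inverse g * h ∈ B}) (by
      rintro _ ⟨g, rfl⟩
      apply mem_nhdsWithin_of_mem_nhds
      have : Continuous fun h : 𝒜 => Ring.inverse (g : 𝒜) * h := by fun_prop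
      refine this.continuousAt.preimage_mem_nhds ?_
      rw [Ring.inverse_unit, Units.inv_mul]
      exact Metric.closedBall_mem_nhds _ hε)
  have htU' : ∀ g : t, ∃ h : 𝒜ˣ, (h : 𝒜) = g := fun g => htU g.2
  choose gu hgu using htU'
  have : Countable t := htc.to_subtype
  have : BaireSpace O := hO.baireSpace
  have : Nonempty O := hne.to_subtype
  have hWO : Continuous fun u : O => W u := by
    rw [continuous_iff_continuousAt]
    intro u
    exact (hW u u.2).continuousAt.comp continuousAt_subtype_val
  -- Countably many translates of `B` cover the units, so the closed sets of those `u` with `W u` in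
  -- the corresponding translate of `o '' B` cover `O`; one of them has an interior point.
  obtain ⟨g, hg⟩ := nonempty_interior_of_iUnion_of_closed
    (f := fun g : t => {u : O | W u ∈ (fun a => ρ (gu g) (o a)) '' B})
    (fun g => ((hBc.image_of_continuousOn
      ((ρ (gu g)).continuous.comp_continuousOn hoB)).isClosed).preimage hWO) (by
      rw [Set.eq_univ_iff_forall]
      intro u
      obtain ⟨h, hh⟩ := horb u u.2
      obtain ⟨g, hgt, hgh⟩ := Set.mem_iUnion₂.1 (hcov h.isUnit)
      refine Set.mem_iUnion.2 ⟨⟨g, hgt⟩, ?_⟩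
      have hgg := hgu ⟨g, hgt⟩
      set k := gu ⟨g, hgt⟩
      have hgh' : ((k⁻¹ * h : 𝒜ˣ) : 𝒜) ∈ B := by
        have : Ring.inverse g * (h : 𝒜) ∈ B := hgh
        rwa [← show (k : 𝒜) = g from hgg, Ring.inverse_unit] at this
      refine ⟨_, hgh', ?_⟩
      change ρ k (o _) = W u
      rw [hh, ← hmul, mul_inv_cancel_left])
  -- The lift moves `W u` back by `g⁻¹` into `o '' B`, applies the local section `s` there, and
  -- moves the result forward by `g`.
  refine ⟨Subtype.val '' interior {u : O | W u ∈ (fun a => ρ (gu g) (o a)) '' B}, ?_,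
    hO.isOpenMap_subtype_val _ isOpen_interior, hg.image _,
    fun u => gu g * s (ρ (gu g)⁻¹ (W u)), ?_⟩
  · rintro _ ⟨u, -, rfl⟩
    exact u.2
  · rintro _ ⟨u, hu, rfl⟩
    obtain ⟨b, hb, hbu⟩ := interior_subset hu
    obtain ⟨h1, h2, h3, h4⟩ := hB hb
    have hbu' : ρ (gu g)⁻¹ (W u) = o b := by
      rw [← hbu]; exact hinv _ _
    obtain ⟨k, hk⟩ := h3
    simp only [hbu']
    refine ⟨?_, ?_, ?_⟩
    · refine contDiffAt_const.mul ?_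
      have h5 : ContDiffAt ℝ ∞ s (ρ (gu g)⁻¹ (W u)) := by
        rw [hbu']; exact h4.of_le (by simp)
      exact h5.comp (u : U) ((ρ (gu g)⁻¹).contDiff.contDiffAt.comp (u : U) (hW u u.2))
    · rw [← hk, ← Units.val_mul]; exact Units.isUnit _
    · rw [← hk, ← Units.val_mul, hmul, hk, h1, ← hbu', hinv']

end Orbit

/-! ### Infinitesimal closure properties of a linear space in an algebra. -/

section LieClosure

variable {𝒜 U : Type*} [NormedRing 𝒜] [NormedAlgebra ℝ 𝒜] [FiniteDimensional ℝ 𝒜]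
  [NormedAddCommGroup U] [NormedSpace ℝ U]

/-- A linear space that contains the values of a curve contains the derivative. -/
theorem deriv_mem_submodule {E : Type*} [NormedAddCommGroup E] [NormedSpace ℝ E]
    [FiniteDimensional ℝ E] (g₀ : Submodule ℝ E) {f : ℝ → E} {f' : E} {t : ℝ}
    (hf : HasDerivAt f f' t) (h : ∀ᶠ s in 𝓝 t, f s ∈ g₀) : f' ∈ g₀ := by
  have hcl : IsClosed (g₀ : Set E) := g₀.closed_of_finiteDimensional
  refine hcl.mem_of_tendsto hf.tendsto_slope (b := 𝓝[≠] t) ?_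
  have ht := h.self_of_nhds
  filter_upwards [nhdsWithin_le_nhds h] with s hs
  exact g₀.smul_mem _ (g₀.sub_mem hs ht)

/-- Structure equation of a Maurer-Cartan form with values in a linear space. -/
theorem lie_mem_of_maurerCartan (g₀ : Submodule ℝ 𝒜) {O : Set U} (hO : IsOpen O) {γ : U → 𝒜}
    (hγ : ∀ u ∈ O, ContDiffAt ℝ ∞ γ u) (hu : ∀ u ∈ O, IsUnit (γ u))
    (hmem : ∀ u ∈ O, ∀ v, Ring.inverse (γ u) * fderiv ℝ γ u v ∈ g₀) {u : U} (huO : u ∈ O)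
    (v w : U) :
    (Ring.inverse (γ u) * fderiv ℝ γ u v) * (Ring.inverse (γ u) * fderiv ℝ γ u w) -
      (Ring.inverse (γ u) * fderiv ℝ γ u w) * (Ring.inverse (γ u) * fderiv ℝ γ u v) ∈ g₀ := by
  have : CompleteSpace 𝒜 := FiniteDimensional.complete ℝ 𝒜
  obtain ⟨g, hg⟩ := hu u huO
  have hd2 : HasFDerivAt (fderiv ℝ γ) (fderiv ℝ (fderiv ℝ γ) u) u :=
    (((hγ u huO).fderiv_right (m := 1) (by norm_num; exact ENat.LEInfty.out)).differentiableAt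
      (by simp)).hasFDerivAt
  have hd1 : HasFDerivAt γ (fderiv ℝ γ u) u :=
    ((hγ u huO).differentiableAt (by simp)).hasFDerivAt
  have hsymm : fderiv ℝ (fderiv ℝ γ) u v w = fderiv ℝ (fderiv ℝ γ) u w v :=
    ((hγ u huO).isSymmSndFDerivAt (by simpa using ENat.LEInfty.out)) v w
  -- derivative of `u ↦ γ(u)⁻¹ dγ(b)` in direction `a`
  have key : ∀ a b : U, -((Ring.inverse (γ u) * fderiv ℝ γ u a) *
      (Ring.inverse (γ u) * fderiv ℝ γ u b)) +
      Ring.inverse (γ u) * fderiv ℝ (fderiv ℝ γ) u a b ∈ g₀ := by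
    intro a b
    have hl : HasDerivAt (fun t : ℝ => u + t • a) a 0 := by
      simpa using ((hasDerivAt_id (0 : ℝ)).smul_const a).const_add u
    have hu0 : u + (0 : ℝ) • a = u := by simp
    have hi : HasDerivAt (fun t : ℝ => Ring.inverse (γ (u + t • a)))
        (-(Ring.inverse (γ u) * fderiv ℝ γ u a * Ring.inverse (γ u))) 0 := by
      have h1 : HasDerivAt (fun t : ℝ => γ (u + t • a)) (fderiv ℝ γ u a) 0 := by
        refine HasFDerivAt.comp_hasDerivAt (l := γ) (0 : ℝ) ?_ hl
        rw [hu0]; exact hd1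
      have h2 : HasFDerivAt Ring.inverse (-ContinuousLinearMap.mulLeftRight ℝ 𝒜 ↑g⁻¹ ↑g⁻¹)
          (γ (u + (0 : ℝ) • a)) := by
        rw [hu0, ← hg]; exact hasFDerivAt_ringInverse (𝕜 := ℝ) g
      have h3 := h2.comp_hasDerivAt (0 : ℝ) h1
      convert! h3 using 1
      simp [← hg]
    have hb : HasDerivAt (fun t : ℝ => fderiv ℝ γ (u + t • a) b)
        (fderiv ℝ (fderiv ℝ γ) u a b) 0 := by
      have h1 : HasDerivAt (fun t : ℝ => fderiv ℝ γ (u + t • a))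
          (fderiv ℝ (fderiv ℝ γ) u a) 0 := by
        refine HasFDerivAt.comp_hasDerivAt (l := fderiv ℝ γ) (0 : ℝ) ?_ hl
        rw [hu0]; exact hd2
      exact ((ContinuousLinearMap.apply ℝ 𝒜 b).hasFDerivAt).comp_hasDerivAt (0 : ℝ) h1
    have hprod := hi.mul hb
    have hm := deriv_mem_submodule g₀ hprod (by
      have hc : ContinuousAt (fun t : ℝ => u + t • a) 0 := hl.continuousAt
      filter_upwards [hc.eventually_mem (by rw [hu0]; exact hO.mem_nhds huO)] with t ht
      exact hmem _ ht b)
    convert hm using 1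
    simp only [zero_smul, add_zero]
    noncomm_ring
  -- Antisymmetrization cancels the second derivative of `γ` by symmetry and leaves the commutator.
  have := g₀.sub_mem (key w v) (key v w)
  rw [hsymm] at this
  convert this using 1
  abel

/-- Infinitesimal version of the invariance of a linear space under conjugation. -/
theorem lie_mem_of_conj_mem (g₀ : Submodule ℝ 𝒜) {κ : ℝ → 𝒜} {z x : 𝒜} (hκ : HasDerivAt κ z 0)
    (h0 : κ 0 = 1) (hmem : ∀ᶠ t in 𝓝 (0 : ℝ), κ t * x * Ring.inverse (κ t) ∈ g₀) :
    z * x - x * z ∈ g₀ := by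
  have : CompleteSpace 𝒜 := FiniteDimensional.complete ℝ 𝒜
  have h2 : HasFDerivAt Ring.inverse
      (-ContinuousLinearMap.mulLeftRight ℝ 𝒜 ↑(1 : 𝒜ˣ)⁻¹ ↑(1 : 𝒜ˣ)⁻¹) (κ 0) := by
    rw [h0]; exact hasFDerivAt_ringInverse (𝕜 := ℝ) (1 : 𝒜ˣ)
  have h3 := h2.comp_hasDerivAt (0 : ℝ) hκ
  have h4 := (hκ.mul_const x).mul h3
  convert deriv_mem_submodule g₀ h4 hmem using 1
  simp [h0, sub_eq_add_neg]

end LieClosure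

end

section

/-! ### Families of linear maps, tested on vectors. -/

section Pointwise

variable {W W' : Type*} [NormedAddCommGroup W] [NormedSpace ℂ W] [FiniteDimensional ℂ W]
  [NormedAddCommGroup W'] [NormedSpace ℂ W'] [FiniteDimensional ℂ W']
  {E : Type*} [NormedAddCommGroup E] [NormedSpace ℝ E]

/-- Linear maps are recovered linearly from their values on a finite set of vectors. -/
theorem exists_clm_of_values (W W' : Type*) [NormedAddCommGroup W] [NormedSpace ℂ W]
    [FiniteDimensional ℂ W] [NormedAddCommGroup W'] [NormedSpace ℂ W'] [FiniteDimensional ℂ W'] :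
    ∃ (n : ℕ) (b : Fin n → W) (Φ : (Fin n → W') →L[ℝ] W →L[ℂ] W'),
      ∀ a : W →L[ℂ] W', Φ (fun i => a (b i)) = a := by
  let b := Module.finBasis ℂ W
  let ev : (W →L[ℂ] W') →ₗ[ℝ] (Fin (Module.finrank ℂ W) → W') :=
    { toFun := fun a i => a (b i)
      map_add' := fun _ _ => rfl
      map_smul' := fun _ _ => rfl }
  have hev : LinearMap.ker ev = ⊥ := by
    rw [LinearMap.ker_eq_bot]
    intro a a' h
    apply ContinuousLinearMap.coe_injective
    exact b.ext fun i => congrFun h i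
  obtain ⟨Φ, hΦ⟩ := ev.exists_leftInverse_of_injective hev
  exact ⟨_, b, LinearMap.toContinuousLinearMap Φ, fun a => LinearMap.congr_fun hΦ a⟩

theorem contDiffAt_clm_of_apply {n : WithTop ℕ∞} {f : E → W →L[ℂ] W'} {t : E}
    (h : ∀ x, ContDiffAt ℝ n (fun s => f s x) t) : ContDiffAt ℝ n f t := by
  obtain ⟨_, b, Φ, hΦ⟩ := exists_clm_of_values W W'
  have : f = fun s => Φ (fun i => f s (b i)) := by
    ext1 s; exact (hΦ _).symm
  rw [this]
  exact Φ.contDiff.contDiffAt.comp t (contDiffAt_pi.2 fun i => h (b i))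

theorem contDiffOn_clm_of_apply {n : WithTop ℕ∞} {f : E → W →L[ℂ] W'} {s : Set E}
    (h : ∀ x, ContDiffOn ℝ n (fun s => f s x) s) : ContDiffOn ℝ n f s := by
  obtain ⟨_, b, Φ, hΦ⟩ := exists_clm_of_values W W'
  have : f = fun s => Φ (fun i => f s (b i)) := by
    ext1 s; exact (hΦ _).symm
  rw [this]
  exact Φ.contDiff.comp_contDiffOn (contDiffOn_pi.2 fun i => h (b i))

theorem hasDerivAt_clm_of_apply {f : ℝ → W →L[ℂ] W'} {f' : W →L[ℂ] W'} {t : ℝ}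
    (h : ∀ x, HasDerivAt (fun s => f s x) (f' x) t) : HasDerivAt f f' t := by
  obtain ⟨_, b, Φ, hΦ⟩ := exists_clm_of_values W W'
  have : f = fun s => Φ (fun i => f s (b i)) := by
    ext1 s; exact (hΦ _).symm
  rw [this, ← hΦ f']
  exact Φ.hasFDerivAt.comp_hasDerivAt t (hasDerivAt_pi.2 fun i => h (b i))

end Pointwise

/-! ### Real-analytic maps with complex-linear differential are complex analytic. -/

section Holomorphic

variable {E F : Type} [NormedAddCommGroup E] [NormedSpace ℂ E]
  [NormedAddCommGroup F] [NormedSpace ℂ F]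

/-- A real differentiable map whose derivative commutes with `i` is complex differentiable. -/
theorem differentiableAt_complex_of_map_I {f : E → F} {x : E} (h : DifferentiableAt ℝ f x)
    (hI : ∀ v, fderiv ℝ f x (Complex.I • v) = Complex.I • fderiv ℝ f x v) :
    DifferentiableAt ℂ f x := by
  rw [differentiableAt_iff_restrictScalars ℝ h]
  refine ⟨⟨{ toFun := fderiv ℝ f x, map_add' := map_add _, map_smul' := fun c v => ?_ },
    (fderiv ℝ f x).continuous⟩, ?_⟩
  · simp only [RingHom.id_apply]
    conv_lhs => rw [← Complex.re_add_im c]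
    rw [add_smul, mul_smul, map_add, Complex.coe_smul, Complex.coe_smul, map_smul, map_smul, hI]
    conv_rhs => rw [← Complex.re_add_im c]
    rw [add_smul, mul_smul, Complex.coe_smul, Complex.coe_smul]
  · ext v; rfl

variable [FiniteDimensional ℂ E] [FiniteDimensional ℂ F]

/-- A real-analytic map that is complex differentiable is infinitely complex differentiable. -/
theorem contDiffOn_complex_nat (n : ℕ) : ∀ {F : Type} [NormedAddCommGroup F] [NormedSpace ℂ F]
    [FiniteDimensional ℂ F] {f : E → F} {s : Set E}, IsOpen s → ContDiffOn ℝ ω f s →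
    DifferentiableOn ℂ f s → ContDiffOn ℂ n f s := by
  induction n with
  | zero =>
    intro F _ _ _ f s hs _ hd
    exact contDiffOn_zero.2 hd.continuousOn
  | succ n ih =>
    intro F _ _ _ f s hs hf hd
    have hds : ∀ x ∈ s, DifferentiableAt ℂ f x := fun x hx => (hd x hx).differentiableAt
      (hs.mem_nhds hx)
    have hres : ∀ x ∈ s, fderiv ℝ f x = (fderiv ℂ f x).restrictScalars ℝ := fun x hx =>
      (hds x hx).fderiv_restrictScalars ℝ
    have h2 : ContDiffOn ℝ ω (fderiv ℝ f) s := hf.fderiv_of_isOpen hs (by simp)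
    have h3 : ContDiffOn ℝ ω (fderiv ℂ f) s := by
      refine contDiffOn_clm_of_apply fun v => ?_
      refine (h2.clm_apply (contDiffOn_const (c := v))).congr fun x hx => ?_
      rw [hres x hx]; rfl
    push_cast
    rw [contDiffOn_succ_iff_fderiv_of_isOpen hs]
    refine ⟨hd, by simp, ih hs h3 fun x hx => ?_⟩
    have h3x : DifferentiableAt ℝ (fderiv ℂ f) x :=
      ((h3 x hx).contDiffAt (hs.mem_nhds hx)).differentiableAt (by simp)
    refine (differentiableAt_complex_of_map_I h3x fun v => ?_).differentiableWithinAt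
    -- the second derivative
    have hA : ∀ v w, fderiv ℝ (fderiv ℝ f) x v w = fderiv ℝ (fderiv ℂ f) x v w := by
      intro v w
      have e : fderiv ℝ f =ᶠ[𝓝 x] fun y =>
          ContinuousLinearMap.restrictScalarsL ℂ E F ℝ ℝ (fderiv ℂ f y) := by
        filter_upwards [hs.mem_nhds hx] with y hy
        exact hres y hy
      rw [e.fderiv_eq]
      have := ((ContinuousLinearMap.restrictScalarsL ℂ E F ℝ ℝ).hasFDerivAt.comp x
        h3x.hasFDerivAt).fderiv
      change fderiv ℝ (⇑(ContinuousLinearMap.restrictScalarsL ℂ E F ℝ ℝ) ∘ fderiv ℂ f) x v w = _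
      rw [this]
      rfl
    have hsymm : ∀ v w, fderiv ℝ (fderiv ℝ f) x v w = fderiv ℝ (fderiv ℝ f) x w v := fun v w =>
      (((hf x hx).contDiffAt (hs.mem_nhds hx)).isSymmSndFDerivAt_of_omega) v w
    -- The second derivative is complex linear in `w` because its values are complex-linear maps;
    -- symmetry transfers this to `v`, so `fderiv ℂ f` is again complex differentiable and the
    -- induction continues.
    ext w
    rw [← hA, hsymm, hA, smul_apply, ← hA v w, hsymm v w, hA w v, map_smul]

/-- A real-analytic map that is complex differentiable is complex analytic. -/
theorem contDiffOn_complex_omega {f : E → F} {s : Set E} (hs : IsOpen s)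
    (hf : ContDiffOn ℝ ω f s) (hd : DifferentiableOn ℂ f s) : ContDiffOn ℂ ω f s := by
  have : CompleteSpace F := FiniteDimensional.complete ℂ F
  intro x hx
  refine (AnalyticAt.contDiffAt ?_).contDiffWithinAt
  have hfx : ContDiffAt ℝ ω f x := (hf x hx).contDiffAt (hs.mem_nhds hx)
  obtain ⟨p, r, hp⟩ := hfx.analyticAt
  have hder : ∀ (n : ℕ) (v : Fin n → E), iteratedFDeriv ℂ n f x v =
      ∑ σ : Equiv.Perm (Fin n), p n (fun i => v (σ i)) := by
    intro n v
    have h1 : ContDiffAt ℂ n f x := (contDiffOn_complex_nat n hs hf hd x hx).contDiffAt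
      (hs.mem_nhds hx)
    rw [← hp.iteratedFDeriv_eq_sum_of_completeSpace, ← h1.restrictScalars_iteratedFDeriv (𝕜 := ℝ)]
    rfl
  -- `q n` is the symmetrization of the term `p n` of the real power series. Its norm is therefore
  -- at most that of `p n`, and both agree on the diagonal, so `q` has at least the same radius of
  -- convergence and the same sum.
  let q : FormalMultilinearSeries ℂ E F := fun n => ((n.factorial : ℂ)⁻¹) • iteratedFDeriv ℂ n f x
  have hfac : ∀ n : ℕ, (n.factorial : ℝ) ≠ 0 := fun n => by exact_mod_cast n.factorial_ne_zero
  have hq : ∀ n, ‖q n‖ ≤ ‖p n‖ := by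
    intro n
    refine ContinuousMultilinearMap.opNorm_le_bound (norm_nonneg _) fun v => ?_
    change ‖((n.factorial : ℂ)⁻¹) • iteratedFDeriv ℂ n f x v‖ ≤ _
    rw [hder, norm_smul, norm_inv, Complex.norm_natCast, inv_mul_le_iff₀ (by positivity)]
    refine (norm_sum_le _ _).trans ?_
    have : ∀ σ : Equiv.Perm (Fin n), ‖p n (fun i => v (σ i))‖ ≤ ‖p n‖ * ∏ i, ‖v i‖ := by
      intro σ
      refine ((p n).le_opNorm _).trans_eq ?_
      rw [Equiv.prod_comp σ (fun i => ‖v i‖)]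
    refine (Finset.sum_le_sum fun σ _ => this σ).trans_eq ?_
    simp [Fintype.card_perm]
  have hqp : ∀ n (v : E), q n (fun _ => v) = p n (fun _ => v) := by
    intro n v
    change ((n.factorial : ℂ)⁻¹) • iteratedFDeriv ℂ n f x (fun _ => v) = _
    rw [hder]
    have hc : (n.factorial : ℂ) ≠ 0 := by exact_mod_cast n.factorial_ne_zero
    simp only [Finset.sum_const, Finset.card_univ, Fintype.card_perm, Fintype.card_fin]
    rw [← Nat.cast_smul_eq_nsmul ℂ, inv_smul_smul₀ hc]
  refine ⟨q, r, ⟨hp.r_le.trans ?_, hp.r_pos, fun {y} hy => ?_⟩⟩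
  · refine ENNReal.le_of_forall_nnreal_lt fun t ht => ?_
    obtain ⟨C, -, hC⟩ := p.norm_mul_pow_le_of_lt_radius ht
    exact q.le_radius_of_bound C fun n => (by gcongr; exact hq n : _ ≤ _).trans (hC n)
  · simp only [hqp]
    exact hp.hasSum hy

end Holomorphic

end

section

/-! ### Passing from complex to real differentials. -/

section RestrictScalars

variable {E E' : Type*} [NormedAddCommGroup E] [NormedSpace ℂ E]
  [NormedAddCommGroup E'] [NormedSpace ℂ E']
  {Y Y' : Type*} [TopologicalSpace Y] [ChartedSpace E Y] [TopologicalSpace Y'] [ChartedSpace E' Y']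

theorem ContMDiffAt.restrict_real {n : WithTop ℕ∞} {f : Y → Y'} {q : Y}
    (h : ContMDiffAt 𝓘(ℂ, E) 𝓘(ℂ, E') n f q) : ContMDiffAt 𝓘(ℝ, E) 𝓘(ℝ, E') n f q := by
  rw [contMDiffAt_iff] at h ⊢
  exact ⟨h.1, h.2.restrict_scalars ℝ⟩

theorem HasMFDerivAt.restrict_real {f : Y → Y'} {q : Y} {f' : E →L[ℂ] E'}
    (h : HasMFDerivAt 𝓘(ℂ, E) 𝓘(ℂ, E') f q f') :
    HasMFDerivAt 𝓘(ℝ, E) 𝓘(ℝ, E') f q (f'.restrictScalars ℝ) :=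
  ⟨h.1, h.2.restrictScalars ℝ⟩

theorem diff_real_eq {f : Y → Y'} {q : Y} (h : MDifferentiableAt 𝓘(ℂ, E) 𝓘(ℂ, E') f q) (v : E) :
    diff ℝ E E' f q v = diff ℂ E E' f q v := by
  have := (HasMFDerivAt.restrict_real h.hasMFDerivAt).mfderiv
  change mfderiv 𝓘(ℝ, E) 𝓘(ℝ, E') f q v = _
  rw [this]
  rfl

end RestrictScalars

section Fields

variable {k l : ℕ} {Y : Type*} [TopologicalSpace Y] [ChartedSpace (CModel k) Y]
  [IsManifold 𝓘(ℂ, CModel k) ω Y]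
  {Y' : Type*} [TopologicalSpace Y'] [ChartedSpace (CModel l) Y']
  [IsManifold 𝓘(ℂ, CModel l) ω Y']

/-- The trivialization of the tangent bundle at `y` is the differential of the chart at `y`, so
holomorphy can be tested on a function with values in a fixed vector space. -/
theorem holFieldAt_iff {Z : Y → CModel k} {y : Y} :
    HolFieldAt Z y ↔ ContMDiffAt 𝓘(ℂ, CModel k) 𝓘(ℂ, CModel k) ω
      (fun q => diff ℂ (CModel k) (CModel k) (chartAt (CModel k) y) q (Z q)) y := by
  have : IsManifold 𝓘(ℂ, CModel k) 1 Y := .of_le (n := ω) (by simp)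
  refine (Bundle.contMDiffAt_section (IB := 𝓘(ℂ, CModel k)) (F := CModel k)
    (E := TangentSpace 𝓘(ℂ, CModel k)) (s := Z) y).trans ?_
  refine Filter.EventuallyEq.contMDiffAt_iff ?_
  filter_upwards [(chartAt (CModel k) y).open_source.mem_nhds (mem_chart_source _ y)] with q hq
  have h1 := TangentBundle.continuousLinearMapAt_trivializationAt (I := 𝓘(ℂ, CModel k)) hq
  have h2 := DFunLike.congr_fun h1 (Z q)
  refine Eq.trans ?_ h2
  exact (congrFun (Bundle.Trivialization.coe_linearMapAt_of_mem (R := ℂ)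
    (trivializationAt (CModel k) (TangentSpace 𝓘(ℂ, CModel k)) y) hq) (Z q)).symm

end Fields

end

section

/-! ### Antiholomorphic involutions and the conjugate distribution. -/

section Antiholomorphic

theorem contDiffAt_complex_omega {E F : Type} [NormedAddCommGroup E] [NormedSpace ℂ E]
    [NormedAddCommGroup F] [NormedSpace ℂ F] [FiniteDimensional ℂ E] [FiniteDimensional ℂ F]
    {f : E → F} {x : E} (h : ContDiffAt ℝ ω f x)
    (hI : ∀ᶠ y in 𝓝 x, ∀ v, fderiv ℝ f y (Complex.I • v) = Complex.I • fderiv ℝ f y v) :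
    ContDiffAt ℂ ω f x := by
  have h1 : ∀ᶠ y in 𝓝 x, ContDiffAt ℝ ω f y := h.eventually (by simp)
  obtain ⟨s, hs, hso, hxs⟩ := eventually_nhds_iff.1 (h1.and hI)
  exact (contDiffOn_complex_omega hso (fun y hy => (hs y hy).1.contDiffWithinAt) (fun y hy =>
    (differentiableAt_complex_of_map_I ((hs y hy).1.differentiableAt (by simp))
      (hs y hy).2).differentiableWithinAt) x hxs).contDiffAt (hso.mem_nhds hxs)

/-- Complex conjugation as a real-linear map. -/
def conjR (d : ℕ) : CModel d →L[ℝ] CModel d :=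
  LinearMap.toContinuousLinearMap
    { toFun := conjV d
      map_add' := map_add (conjV d)
      map_smul' := fun c v => by
        rw [← Complex.coe_smul, map_smulₛₗ, Complex.conj_ofReal, Complex.coe_smul]; rfl }

theorem conjR_conjR {d : ℕ} (v : CModel d) : conjR d (conjR d v) = v := by
  ext i
  change starRingEnd ℂ (starRingEnd ℂ (v i)) = v i
  simp

theorem conjR_I {d : ℕ} (v : CModel d) :
    conjR d (Complex.I • v) = -(Complex.I • conjR d v) := by
  change conjV d (Complex.I • v) = -(Complex.I • conjV d v)
  rw [map_smulₛₗ, Complex.conj_I, neg_smul]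

variable {k l : ℕ}

/-- Conjugation and `f` both anticommute with `i`, so their composite has complex-linear
differential. The next two lemmas use the same cancellation with conjugation on the target and on
both sides. -/
theorem contDiffAt_comp_conj {f : CModel k → CModel l} {x : CModel k} (h : ContDiffAt ℝ ω f x)
    (hI : ∀ᶠ y in 𝓝 x, ∀ v, fderiv ℝ f y (Complex.I • v) = -(Complex.I • fderiv ℝ f y v)) :
    ContDiffAt ℂ ω (fun y => f (conjR k y)) (conjR k x) := by
  have hx : Filter.Tendsto (conjR k) (𝓝 (conjR k x)) (𝓝 x) := by
    have := (conjR k).continuous.tendsto (conjR k x)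
    rwa [conjR_conjR] at this
  have h1 : ∀ᶠ y in 𝓝 x, ContDiffAt ℝ ω f y := h.eventually (by simp)
  refine contDiffAt_complex_omega ?_ ?_
  · exact ContDiffAt.comp (conjR k x) (by rw [conjR_conjR]; exact h) (conjR k).contDiff.contDiffAt
  · filter_upwards [hx.eventually h1, hx.eventually hI] with y h1 h2 v
    have := ((h1.differentiableAt (by simp)).hasFDerivAt.comp y (conjR k).hasFDerivAt).fderiv
    rw [show (fun y => f (conjR k y)) = f ∘ conjR k from rfl, this]
    simp only [ContinuousLinearMap.comp_apply]
    rw [conjR_I, map_neg, h2, neg_neg]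

theorem contDiffAt_conj_comp {f : CModel k → CModel l} {x : CModel k} (h : ContDiffAt ℝ ω f x)
    (hI : ∀ᶠ y in 𝓝 x, ∀ v, fderiv ℝ f y (Complex.I • v) = -(Complex.I • fderiv ℝ f y v)) :
    ContDiffAt ℂ ω (fun y => conjR l (f y)) x := by
  have h1 : ∀ᶠ y in 𝓝 x, ContDiffAt ℝ ω f y := h.eventually (by simp)
  refine contDiffAt_complex_omega ((conjR l).contDiff.contDiffAt.comp x h) ?_
  filter_upwards [h1, hI] with y h1 h2 v
  have := ((conjR l).hasFDerivAt.comp y (h1.differentiableAt (by simp)).hasFDerivAt).fderiv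
  rw [show (fun y => conjR l (f y)) = conjR l ∘ f from rfl, this]
  simp only [ContinuousLinearMap.comp_apply]
  rw [h2, map_neg, conjR_I, neg_neg]

theorem contDiffAt_conj_comp_conj {f : CModel k → CModel l} {x : CModel k}
    (h : ContDiffAt ℂ ω f x) :
    ContDiffAt ℂ ω (fun y => conjR l (f (conjR k y))) (conjR k x) := by
  have h1 : ∀ᶠ y in 𝓝 x, ContDiffAt ℂ ω f y := h.eventually (by simp)
  refine contDiffAt_comp_conj (f := fun y => conjR l (f y))
    ((conjR l).contDiff.contDiffAt.comp x (h.restrict_scalars ℝ)) ?_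
  filter_upwards [h1] with y h1 v
  have hd := (h1.differentiableAt (by simp)).hasFDerivAt
  have := ((conjR l).hasFDerivAt.comp y (hd.restrictScalars ℝ)).fderiv
  rw [show (fun y => conjR l (f y)) = conjR l ∘ f from rfl, this]
  simp only [ContinuousLinearMap.comp_apply, ContinuousLinearMap.coe_restrictScalars']
  rw [map_smul, conjR_I]

variable {Y : Type*} [TopologicalSpace Y] [ChartedSpace (CModel k) Y]

theorem diff_comp {𝕜 E E' E'' : Type*} [NontriviallyNormedField 𝕜]
    [NormedAddCommGroup E] [NormedSpace 𝕜 E] [NormedAddCommGroup E'] [NormedSpace 𝕜 E']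
    [NormedAddCommGroup E''] [NormedSpace 𝕜 E'']
    {Y Y' Y'' : Type*} [TopologicalSpace Y] [ChartedSpace E Y] [TopologicalSpace Y']
    [ChartedSpace E' Y'] [TopologicalSpace Y''] [ChartedSpace E'' Y''] {g : Y' → Y''} {f : Y → Y'}
    {q : Y} (hg : MDifferentiableAt 𝓘(𝕜, E') 𝓘(𝕜, E'') g (f q))
    (hf : MDifferentiableAt 𝓘(𝕜, E) 𝓘(𝕜, E') f q) (v : E) :
    diff 𝕜 E E'' (fun y => g (f y)) q v = diff 𝕜 E' E'' g (f q) (diff 𝕜 E E' f q v) := by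
  have := mfderiv_comp q hg hf
  exact DFunLike.congr_fun this v

theorem diff_eq_fderiv {𝕜 E E' : Type*} [NontriviallyNormedField 𝕜]
    [NormedAddCommGroup E] [NormedSpace 𝕜 E] [NormedAddCommGroup E'] [NormedSpace 𝕜 E']
    (f : E → E') (x v : E) : diff 𝕜 E E' f x v = fderiv 𝕜 f x v := by
  have := mfderiv_eq_fderiv (𝕜 := 𝕜) (f := f) (x := x)
  exact DFunLike.congr_fun this v

theorem diff_congr {𝕜 E E' : Type*} [NontriviallyNormedField 𝕜]
    [NormedAddCommGroup E] [NormedSpace 𝕜 E] [NormedAddCommGroup E'] [NormedSpace 𝕜 E']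
    {Y Y' : Type*} [TopologicalSpace Y] [ChartedSpace E Y] [TopologicalSpace Y']
    [ChartedSpace E' Y'] {f g : Y → Y'} {q : Y} (h : f =ᶠ[𝓝 q] g) (v : E) :
    diff 𝕜 E E' f q v = diff 𝕜 E E' g q v := by
  have := h.mfderiv_eq (I := 𝓘(𝕜, E)) (I' := 𝓘(𝕜, E'))
  exact DFunLike.congr_fun this v

variable [hY : IsManifold 𝓘(ℂ, CModel k) ω Y] {τ : Y → Y}

theorem chart_contMDiffAt (y : Y) {q : Y} (hq : q ∈ (chartAt (CModel k) y).source) :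
    ContMDiffAt 𝓘(ℂ, CModel k) 𝓘(ℂ, CModel k) ω (chartAt (CModel k) y) q :=
  contMDiffOn_chart.contMDiffAt ((chartAt (CModel k) y).open_source.mem_nhds hq)

theorem chart_symm_contMDiffAt (y : Y) {x : CModel k} (hx : x ∈ (chartAt (CModel k) y).target) :
    ContMDiffAt 𝓘(ℂ, CModel k) 𝓘(ℂ, CModel k) ω (chartAt (CModel k) y).symm x :=
  contMDiffOn_chart_symm.contMDiffAt ((chartAt (CModel k) y).open_target.mem_nhds hx)

/-- Coordinate expressions of an antiholomorphic map. -/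
theorem coord_antiholomorphic (hτ : ContMDiff 𝓘(ℝ, CModel k) 𝓘(ℝ, CModel k) ω τ)
    (hanti : ∀ (q : Y) (v : CModel k), diff ℝ (CModel k) (CModel k) τ q (Complex.I • v) =
      -(Complex.I • diff ℝ (CModel k) (CModel k) τ q v)) (y y' : Y) {x : CModel k}
    (hx : x ∈ (chartAt (CModel k) y').target)
    (hx' : τ ((chartAt (CModel k) y').symm x) ∈ (chartAt (CModel k) y).source) :
    ContDiffAt ℝ ω (fun x => chartAt (CModel k) y (τ ((chartAt (CModel k) y').symm x))) x ∧
    ∀ v, fderiv ℝ (fun x => chartAt (CModel k) y (τ ((chartAt (CModel k) y').symm x))) x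
      (Complex.I • v) = -(Complex.I • fderiv ℝ
        (fun x => chartAt (CModel k) y (τ ((chartAt (CModel k) y').symm x))) x v) := by
  have h1 := chart_symm_contMDiffAt y' hx
  have h2 := chart_contMDiffAt y hx'
  have h1r := ContMDiffAt.restrict_real h1
  have h2r := ContMDiffAt.restrict_real h2
  have h12 := (hτ ((chartAt (CModel k) y').symm x)).comp x h1r
  have h3 := h2r.comp x h12
  refine ⟨contMDiffAt_iff_contDiffAt.1 h3, fun v => ?_⟩
  have key : ∀ v, fderiv ℝ (fun x => chartAt (CModel k) y (τ ((chartAt (CModel k) y').symm x))) x v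
      = diff ℂ (CModel k) (CModel k) (chartAt (CModel k) y) (τ ((chartAt (CModel k) y').symm x))
        (diff ℝ (CModel k) (CModel k) τ ((chartAt (CModel k) y').symm x)
          (diff ℂ (CModel k) (CModel k) (chartAt (CModel k) y').symm x v)) := by
    intro v
    rw [← diff_eq_fderiv,
      diff_comp (f := fun x => τ ((chartAt (CModel k) y').symm x))
        (h2r.mdifferentiableAt (by simp)) (h12.mdifferentiableAt (by simp)),
      diff_comp ((hτ _).mdifferentiableAt (by simp)) (h1r.mdifferentiableAt (by simp)),
      diff_real_eq (h2.mdifferentiableAt (by simp)), diff_real_eq (h1.mdifferentiableAt (by simp))]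
  rw [key, key, map_smul, hanti, map_neg, map_smul]

/-- The image of a holomorphic vector field under an antiholomorphic involution is holomorphic. -/
theorem holFieldAt_pushforward_antiholomorphic
    (hτ : ContMDiff 𝓘(ℝ, CModel k) 𝓘(ℝ, CModel k) ω τ)
    (hanti : ∀ (q : Y) (v : CModel k), diff ℝ (CModel k) (CModel k) τ q (Complex.I • v) =
      -(Complex.I • diff ℝ (CModel k) (CModel k) τ q v)) (hinv : Function.Involutive τ)
    {Z : Y → CModel k} {y : Y} (hZ : HolFieldAt Z (τ y)) :
    HolFieldAt (fun q => diff ℝ (CModel k) (CModel k) τ (τ q) (Z (τ q))) y := by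
  set e := chartAt (CModel k) y with he
  set e' := chartAt (CModel k) (τ y) with he'
  -- `T` and `T'` express `τ` in the charts at `y` and `τ y`. In coordinates the image field is `x ↦
  -- dT (Z' (T' x))`, evaluated at `T' x`; inserting conjugations in pairs rewrites it in terms of
  -- `T ∘ conj`, `conj ∘ T'` and `conj ∘ Z' ∘ conj`, which are all holomorphic.
  set T : CModel k → CModel k := fun x => e (τ (e'.symm x)) with hT
  set T' : CModel k → CModel k := fun x => e' (τ (e.symm x)) with hT'
  have hy : y ∈ e.source := mem_chart_source _ y
  have hy' : τ y ∈ e'.source := mem_chart_source _ (τ y)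
  have hτc : Continuous τ := hτ.continuous
  set Z' : CModel k → CModel k := fun x =>
    diff ℂ (CModel k) (CModel k) e' (e'.symm x) (Z (e'.symm x)) with hZ'
  have hT'y : T' (e y) = e' (τ y) := by simp only [hT', e.left_inv hy]
  -- the coordinate expression of `Z`
  have hZ'c : ContDiffAt ℂ ω Z' (e' (τ y)) := by
    have h1 := holFieldAt_iff.1 hZ
    have h2 := chart_symm_contMDiffAt (τ y) (e'.map_source hy')
    have h3 : ContMDiffAt 𝓘(ℂ, CModel k) 𝓘(ℂ, CModel k) ω
        (fun q => diff ℂ (CModel k) (CModel k) e' q (Z q)) (e'.symm (e' (τ y))) := by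
      rw [e'.left_inv hy']
      exact h1
    exact contMDiffAt_iff_contDiffAt.1 (h3.comp (e' (τ y)) h2)
  have hgood : ∀ᶠ x in 𝓝 (e' (τ y)), x ∈ e'.target ∧ τ (e'.symm x) ∈ e.source := by
    have hc : ContinuousAt (fun x => τ (e'.symm x)) (e' (τ y)) :=
      hτc.continuousAt.comp (e'.continuousAt_symm (e'.map_source hy'))
    exact (e'.open_target.eventually_mem (e'.map_source hy')).and
      (hc.eventually_mem (by rw [e'.left_inv hy', hinv y]; exact e.open_source.mem_nhds hy))
  have hgood' : ∀ᶠ x in 𝓝 (e y), x ∈ e.target ∧ τ (e.symm x) ∈ e'.source := by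
    have hc : ContinuousAt (fun x => τ (e.symm x)) (e y) :=
      hτc.continuousAt.comp (e.continuousAt_symm (e.map_source hy))
    exact (e.open_target.eventually_mem (e.map_source hy)).and
      (hc.eventually_mem (by rw [e.left_inv hy]; exact e'.open_source.mem_nhds hy'))
  have hTa := hgood.mono fun x hx => coord_antiholomorphic hτ hanti y (τ y) hx.1 hx.2
  have hTa' := hgood'.mono fun x hx => coord_antiholomorphic hτ hanti (τ y) y hx.1 hx.2
  have ha : ContDiffAt ℂ ω (fun x => T (conjR k x)) (conjR k (e' (τ y))) :=
    contDiffAt_comp_conj hTa.self_of_nhds.1 (hTa.mono fun x hx => hx.2)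
  have hb : ContDiffAt ℂ ω (fun x => conjR k (T' x)) (e y) :=
    contDiffAt_conj_comp hTa'.self_of_nhds.1 (hTa'.mono fun x hx => hx.2)
  have hc := contDiffAt_conj_comp_conj hZ'c
  -- the coordinate expression of the image of `Z`
  have hG : ContDiffAt ℂ ω (fun x => fderiv ℂ (fun x => T (conjR k x)) (conjR k (T' x))
      (conjR k (Z' (conjR k (conjR k (T' x)))))) (e y) := by
    refine ContDiffAt.clm_apply ?_ ?_
    · refine ContDiffAt.comp (g := fderiv ℂ (fun x => T (conjR k x))) (e y) ?_ hb
      rw [hT'y]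
      exact ha.fderiv_right (by simp)
    · refine ContDiffAt.comp (g := fun y => conjR k (Z' (conjR k y))) (e y) ?_ hb
      rw [hT'y]
      exact hc
  rw [holFieldAt_iff]
  refine ((contMDiffAt_iff_contDiffAt.2 hG).comp y
    (chart_contMDiffAt y hy)).congr_of_eventuallyEq ?_
  have hae : ∀ᶠ x in 𝓝 (e' (τ y)), DifferentiableAt ℂ (fun x => T (conjR k x)) (conjR k x) := by
    have h1 : ∀ᶠ x in 𝓝 (conjR k (e' (τ y))), ContDiffAt ℂ ω (fun x => T (conjR k x)) x :=
      ha.eventually (by simp)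
    filter_upwards [(conjR k).continuous.continuousAt.eventually h1] with x hx
    exact hx.differentiableAt (by simp)
  have hcy : ContinuousAt (fun q => e' (τ q)) y :=
    (e'.continuousAt hy').comp hτc.continuousAt
  filter_upwards [e.open_source.mem_nhds hy,
    hτc.continuousAt.eventually_mem (e'.open_source.mem_nhds hy'),
    hcy.eventually hae] with q hq hq' hq''
  have h1 : T' (e q) = e' (τ q) := by simp only [hT', e.left_inv hq]
  simp only [Function.comp_apply]
  rw [conjR_conjR, h1]
  have hm1 := chart_contMDiffAt y hq
  have hm1r := (ContMDiffAt.restrict_real hm1).mdifferentiableAt (by simp)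
  have hm2 := chart_contMDiffAt (τ y) hq'
  have hm2r := (ContMDiffAt.restrict_real hm2).mdifferentiableAt (by simp)
  have hTd : ContDiffAt ℝ ω T (e' (τ q)) :=
    (coord_antiholomorphic hτ hanti y (τ y) (e'.map_source hq')
      (by rw [← he', e'.left_inv hq', hinv q]; exact hq)).1
  have hTd' : DifferentiableAt ℝ T (e' (τ q)) := hTd.differentiableAt (by simp)
  have s1 : diff ℂ (CModel k) (CModel k) e q (diff ℝ (CModel k) (CModel k) τ (τ q) (Z (τ q))) =
      diff ℝ (CModel k) (CModel k) (fun p => e (τ p)) (τ q) (Z (τ q)) := by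
    rw [diff_comp (g := e) (f := τ) (by rw [hinv q]; exact hm1r)
      ((hτ _).mdifferentiableAt (by simp)), hinv q, diff_real_eq (hm1.mdifferentiableAt (by simp))]
  have s2 : diff ℝ (CModel k) (CModel k) (fun p => e (τ p)) (τ q) (Z (τ q)) =
      fderiv ℝ T (e' (τ q)) (Z' (e' (τ q))) := by
    rw [diff_congr (g := fun p => T (e' p)), diff_comp (g := T) (f := e')
      hTd'.mdifferentiableAt hm2r, diff_eq_fderiv, diff_real_eq (hm2.mdifferentiableAt (by simp))]
    · simp only [hZ', e'.left_inv hq']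
      rfl
    · filter_upwards [e'.open_source.mem_nhds hq'] with p hp
      simp only [hT, e'.left_inv hp]
  rw [s1, s2]
  have hch := ((hq''.hasFDerivAt.restrictScalars ℝ).comp (e' (τ q)) (conjR k).hasFDerivAt).fderiv
  have hTe : (fun x => T (conjR k x)) ∘ (conjR k) = T := by
    ext1 x; simp only [Function.comp_apply, conjR_conjR]
  rw [hTe] at hch
  rw [hch]
  rfl

/-- The image of a holomorphic distribution under an antiholomorphic involution has local
holomorphic frames. -/
theorem exists_frame_barDist (hτ : ContMDiff 𝓘(ℝ, CModel k) 𝓘(ℝ, CModel k) ω τ)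
    (hanti : ∀ (q : Y) (v : CModel k), diff ℝ (CModel k) (CModel k) τ q (Complex.I • v) =
      -(Complex.I • diff ℝ (CModel k) (CModel k) τ q v)) (hinv : Function.Involutive τ)
    {m : ℕ} {Δ : Y → Submodule ℂ (CModel k)} (hΔ : IsHolDistribution m Δ) (y : Y) :
    ∃ Z : Fin m → Y → CModel k, (∀ i, HolFieldAt (Z i) y) ∧
      ∀ᶠ q in 𝓝 y, barDist τ Δ q = Submodule.span ℂ (Set.range fun i => Z i q) := by
  obtain ⟨-, Z, hZ, hspan⟩ := hΔ (τ y)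
  refine ⟨fun i q => diff ℝ (CModel k) (CModel k) τ (τ q) (Z i (τ q)),
    fun i => holFieldAt_pushforward_antiholomorphic hτ hanti hinv (hZ i), ?_⟩
  filter_upwards [hτ.continuous.continuousAt.eventually hspan] with q hq
  -- The differential of `τ` is conjugate-linear, so it carries the complex span of a frame into the
  -- complex span of the image frame.
  have hsm : ∀ (c : ℂ) (v : CModel k), diff ℝ (CModel k) (CModel k) τ (τ q) (c • v) =
      starRingEnd ℂ c • diff ℝ (CModel k) (CModel k) τ (τ q) v := by
    intro c v
    conv_lhs => rw [← Complex.re_add_im c]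
    conv_rhs => rw [← Complex.re_add_im c]
    rw [add_smul, mul_smul, map_add, Complex.coe_smul, Complex.coe_smul, map_smul, map_smul, hanti,
      map_add, map_mul, Complex.conj_I, Complex.conj_ofReal, Complex.conj_ofReal, add_smul,
      mul_smul, Complex.coe_smul, Complex.coe_smul, neg_smul]
  apply le_antisymm
  · refine Submodule.span_le.2 ?_
    rintro _ ⟨v, hv, rfl⟩
    rw [hq] at hv
    refine Submodule.span_induction (p := fun v _ => diff ℝ (CModel k) (CModel k) τ (τ q) v ∈
      Submodule.span ℂ (Set.range fun i => diff ℝ (CModel k) (CModel k) τ (τ q) (Z i (τ q))))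
      ?_ ?_ ?_ ?_ hv
    · rintro _ ⟨i, rfl⟩
      exact Submodule.subset_span ⟨i, rfl⟩
    · rw [map_zero]; exact zero_mem _
    · intro v w _ _ h1 h2
      rw [map_add]; exact add_mem h1 h2
    · intro c v _ h
      rw [hsm]; exact Submodule.smul_mem _ _ h
  · refine Submodule.span_le.2 ?_
    rintro _ ⟨i, rfl⟩
    refine Submodule.subset_span ⟨Z i (τ q), ?_, rfl⟩
    rw [hq]
    exact Submodule.subset_span ⟨i, rfl⟩

end Antiholomorphic

end

section

/-! ### Local structure of the projection onto the leaf space. -/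

section LocalProduct

variable {d k : ℕ} {CM : Type*} [TopologicalSpace CM] [ChartedSpace (CModel d) CM]
  [IsManifold 𝓘(ℂ, CModel d) ω CM]
  {N : Type*} [TopologicalSpace N] [ChartedSpace (CModel k) N] [IsManifold 𝓘(ℂ, CModel k) ω N]
  {π : CM → N}

/-- A holomorphic submersion is locally a projection. -/
theorem exists_local_product (hπ : ContMDiff 𝓘(ℂ, CModel d) 𝓘(ℂ, CModel k) ω π) (q₀ : CM)
    (hs : Function.Surjective (diff ℂ (CModel d) (CModel k) π q₀)) :
    ∃ (U : Submodule ℂ (CModel d)) (Φ : CModel k × U → CM) (ρ : CM → U) (G : Set (CModel k × U)),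
      IsOpen G ∧ (chartAt (CModel k) (π q₀) (π q₀), 0) ∈ G ∧
      Φ (chartAt (CModel k) (π q₀) (π q₀), 0) = q₀ ∧ ∀ z ∈ G,
      π (Φ z) = (chartAt (CModel k) (π q₀)).symm z.1 ∧
      ContMDiffAt 𝓘(ℂ, CModel k × U) 𝓘(ℂ, CModel d) ω Φ z ∧ ρ (Φ z) = z.2 ∧
      ContMDiffAt 𝓘(ℂ, CModel d) 𝓘(ℂ, U) ω ρ (Φ z) ∧
      ∀ᶠ q in 𝓝 (Φ z), Φ (chartAt (CModel k) (π q₀) (π q), ρ q) = q := by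
  set e := chartAt (CModel d) q₀ with he
  set e' := chartAt (CModel k) (π q₀) with he'
  have hq₀ : q₀ ∈ e.source := mem_chart_source _ q₀
  have hq₀' : π q₀ ∈ e'.source := mem_chart_source _ (π q₀)
  set x₀ := e q₀ with hx₀
  have hx₀t : x₀ ∈ e.target := e.map_source hq₀
  have hex₀ : e.symm x₀ = q₀ := e.left_inv hq₀
  set P : CModel d → CModel k := fun x => e' (π (e.symm x)) with hP
  have hPx₀ : P x₀ = e' (π q₀) := by simp only [hP, hex₀]
  have hPc : ContDiffAt ℂ ω P x₀ := by
    have h1 := chart_symm_contMDiffAt q₀ hx₀t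
    have h2 : ContMDiffAt 𝓘(ℂ, CModel k) 𝓘(ℂ, CModel k) ω e' (π (e.symm x₀)) := by
      rw [hex₀]; exact chart_contMDiffAt (π q₀) hq₀'
    exact contMDiffAt_iff_contDiffAt.1 (h2.comp x₀ ((hπ _).comp x₀ h1))
  have hP's : Function.Surjective (fderiv ℂ P x₀) := by
    -- The differential at `q₀` is by definition read in the preferred charts at `q₀` and `π q₀`,
    -- which are exactly the charts used in `P`.
    have h1 : ∀ v, diff ℂ (CModel d) (CModel k) π q₀ v = fderiv ℂ P x₀ v := by
      intro v
      have h1 := ((hπ q₀).mdifferentiableAt (by simp)).mfderiv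
      have h2 : fderivWithin ℂ (writtenInExtChartAt 𝓘(ℂ, CModel d) 𝓘(ℂ, CModel k) q₀ π)
          (Set.range 𝓘(ℂ, CModel d)) (extChartAt 𝓘(ℂ, CModel d) q₀ q₀) = fderiv ℂ P x₀ := by
        simp only [ModelWithCorners.range_eq_univ, fderivWithin_univ]
        rfl
      exact DFunLike.congr_fun (h1.trans h2) v
    intro y
    obtain ⟨v, hv⟩ := hs y
    exact ⟨v, by rw [← h1, hv]⟩
  set P' := fderiv ℂ P x₀ with hP'
  -- Adjoining to `P` a linear projection onto the kernel of its derivative gives a map with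
  -- invertible derivative; the inverse function theorem then straightens `π`.
  obtain ⟨p, hp⟩ := (LinearMap.ker P'.toLinearMap).subtype.exists_leftInverse_of_injective
    (Submodule.ker_subtype _)
  have hp' : ∀ w : LinearMap.ker P'.toLinearMap, p w = w := fun w => LinearMap.congr_fun hp w
  let pc : CModel d →L[ℂ] LinearMap.ker P'.toLinearMap := LinearMap.toContinuousLinearMap p
  have hpc : ∀ v, pc v = p v := fun v => rfl
  have hbij : Function.Bijective (P'.toLinearMap.prod p) := by
    constructor
    · rw [← LinearMap.ker_eq_bot, LinearMap.ker_eq_bot']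
      intro v hv
      have hv1 : P' v = 0 := congrArg Prod.fst hv
      have hv2 : p v = 0 := congrArg Prod.snd hv
      have := hp' ⟨v, hv1⟩
      rw [hv2] at this
      exact (congrArg Subtype.val this).symm
    · rintro ⟨y, w⟩
      obtain ⟨v, hv⟩ := hP's y
      have hw : ∀ w : LinearMap.ker P'.toLinearMap, P' w = 0 := fun w => w.2
      refine ⟨v + ((w - p v : LinearMap.ker P'.toLinearMap) : CModel d), Prod.ext ?_ ?_⟩
      · change P' (v + _) = y
        rw [map_add, hw, hv, add_zero]
      · change p (v + _) = w
        rw [map_add, hp']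
        abel
  let L : CModel d ≃L[ℂ] CModel k × LinearMap.ker P'.toLinearMap :=
    (LinearEquiv.ofBijective _ hbij).toContinuousLinearEquiv
  set Ψ : CModel d → CModel k × LinearMap.ker P'.toLinearMap := fun x => (P x, pc (x - x₀)) with hΨ
  have hΨd : HasFDerivAt Ψ (L : CModel d →L[ℂ] CModel k × LinearMap.ker P'.toLinearMap) x₀ := by
    have h1 : HasFDerivAt P P' x₀ := (hPc.differentiableAt (by simp)).hasFDerivAt
    have h2 : HasFDerivAt (fun x => pc (x - x₀)) pc x₀ := by
      have := (hasFDerivAt_id (𝕜 := ℂ) x₀).sub_const x₀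
      exact pc.hasFDerivAt.comp x₀ this
    exact h1.prodMk h2
  have hΨc : ContDiffAt ℂ ω Ψ x₀ :=
    hPc.prodMk (pc.contDiff.contDiffAt.comp x₀ (contDiffAt_id.sub contDiffAt_const))
  let g := hΨc.toOpenPartialHomeomorph Ψ hΨd (by simp)
  have hg : (g : CModel d → CModel k × LinearMap.ker P'.toLinearMap) = Ψ := rfl
  have hgx₀ : x₀ ∈ g.source := hΨc.mem_toOpenPartialHomeomorph_source hΨd (by simp)
  have hΨx₀ : Ψ x₀ = (e' (π q₀), 0) := by simp [hΨ, hPx₀]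
  have hz₀t : (e' (π q₀), 0) ∈ g.target := by rw [← hΨx₀]; exact g.map_source hgx₀
  have hgz₀ : g.symm (e' (π q₀), 0) = x₀ := by rw [← hΨx₀]; exact g.left_inv hgx₀
  have hgsc : ContDiffAt ℂ ω g.symm (e' (π q₀), 0) :=
    g.contDiffAt_symm hz₀t (by rw [hgz₀]; exact hΨd) (by rw [hgz₀]; exact hΨc)
  have hev : ∀ᶠ z in 𝓝 ((e' (π q₀), 0) : CModel k × LinearMap.ker P'.toLinearMap),
      z ∈ g.target ∧ g.symm z ∈ e.target ∧ π (e.symm (g.symm z)) ∈ e'.source ∧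
      ContDiffAt ℂ ω g.symm z := by
    have hc1 : ContinuousAt g.symm (e' (π q₀), 0) := g.continuousAt_symm hz₀t
    have hc2 : ContinuousAt (fun z => π (e.symm (g.symm z))) (e' (π q₀), 0) := by
      refine hπ.continuous.continuousAt.comp (ContinuousAt.comp ?_ hc1)
      rw [hgz₀]
      exact e.continuousAt_symm hx₀t
    filter_upwards [g.open_target.mem_nhds hz₀t,
      hc1.eventually_mem (by rw [hgz₀]; exact e.open_target.mem_nhds hx₀t),
      hc2.eventually_mem (by rw [hgz₀, hex₀]; exact e'.open_source.mem_nhds hq₀'),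
      hgsc.eventually (by simp)] with z h1 h2 h3 h4
    exact ⟨h1, h2, h3, h4⟩
  obtain ⟨G, hG, hGo, hzG⟩ := eventually_nhds_iff.1 hev
  refine ⟨LinearMap.ker P'.toLinearMap, fun z => e.symm (g.symm z), fun q => pc (e q - x₀), G, hGo,
    hzG, by simp only [hgz₀, hex₀], fun z hz => ?_⟩
  obtain ⟨h1, h2, h3, h4⟩ := hG z hz
  have hΨz : Ψ (g.symm z) = z := g.right_inv h1
  have hes : e.symm (g.symm z) ∈ e.source := e.map_target h2
  refine ⟨?_, ?_, ?_, ?_, ?_⟩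
  · have : P (g.symm z) = z.1 := congrArg Prod.fst hΨz
    rw [← this]
    exact (e'.left_inv h3).symm
  · exact (chart_symm_contMDiffAt q₀ h2).comp z (contMDiffAt_iff_contDiffAt.2 h4)
  · change pc (e (e.symm (g.symm z)) - x₀) = z.2
    rw [e.right_inv h2]
    exact congrArg Prod.snd hΨz
  · have h5 : ContMDiffAt 𝓘(ℂ, CModel d) 𝓘(ℂ, LinearMap.ker P'.toLinearMap) ω
        (fun x => pc (x - x₀)) (e (e.symm (g.symm z))) :=
      contMDiffAt_iff_contDiffAt.2
        (pc.contDiff.contDiffAt.comp _ (contDiffAt_id.sub contDiffAt_const))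
    exact h5.comp _ (chart_contMDiffAt q₀ hes)
  · have hc : ContinuousAt e (e.symm (g.symm z)) := e.continuousAt hes
    filter_upwards [e.open_source.mem_nhds hes,
      hc.eventually_mem (g.open_source.mem_nhds (by rw [e.right_inv h2]; exact g.map_target h1))]
      with q hq hq'
    have : (e' (π q), pc (e q - x₀)) = g (e q) := by
      rw [hg]
      simp only [hΨ, hP, e.left_inv hq]
    rw [this, g.left_inv hq', e.left_inv hq]

/-- Holomorphic local parametrization of the fibres of a holomorphic submersion. -/
theorem exists_fibre_chart (hπ : ContMDiff 𝓘(ℂ, CModel d) 𝓘(ℂ, CModel k) ω π) (q₀ : CM)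
    (hs : Function.Surjective (diff ℂ (CModel d) (CModel k) π q₀)) :
    ∃ (U : Submodule ℂ (CModel d)) (f : U → CM) (ρ : CM → U) (O : Set U),
      IsOpen O ∧ 0 ∈ O ∧ f 0 = q₀ ∧ ∀ u ∈ O, π (f u) = π q₀ ∧
      ContMDiffAt 𝓘(ℂ, U) 𝓘(ℂ, CModel d) ω f u ∧ ρ (f u) = u ∧
      ContMDiffAt 𝓘(ℂ, CModel d) 𝓘(ℂ, U) ω ρ (f u) ∧
      ∀ᶠ q in 𝓝 (f u), π q = π q₀ → f (ρ q) = q := by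
  obtain ⟨U, Φ, ρ, G, hGo, hG0, hΦ0, hG⟩ := exists_local_product hπ q₀ hs
  have hc : Continuous fun u : U => (chartAt (CModel k) (π q₀) (π q₀), u) := by fun_prop
  refine ⟨U, fun u => Φ (chartAt (CModel k) (π q₀) (π q₀), u), ρ, _, hGo.preimage hc, hG0, hΦ0,
    fun u hu => ?_⟩
  obtain ⟨h1, h2, h3, h4, h5⟩ := hG _ hu
  refine ⟨?_, ?_, h3, h4, ?_⟩
  · rw [h1]
    exact (chartAt (CModel k) (π q₀)).left_inv (mem_chart_source _ _)
  · have : ContMDiffAt 𝓘(ℂ, U) 𝓘(ℂ, CModel k × U) ω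
        (fun u : U => (chartAt (CModel k) (π q₀) (π q₀), u)) u :=
      contMDiffAt_iff_contDiffAt.2 (contDiffAt_const.prodMk contDiffAt_id)
    exact h2.comp u this
  · filter_upwards [h5] with q hq hπq
    rwa [hπq] at hq

/-- Holomorphic local sections of a holomorphic submersion. -/
theorem exists_local_section (hπ : ContMDiff 𝓘(ℂ, CModel d) 𝓘(ℂ, CModel k) ω π) (q₀ : CM)
    (hs : Function.Surjective (diff ℂ (CModel d) (CModel k) π q₀)) :
    ∃ s : N → CM, s (π q₀) = q₀ ∧ ContMDiffAt 𝓘(ℂ, CModel k) 𝓘(ℂ, CModel d) ω s (π q₀) ∧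
      ∀ᶠ γ in 𝓝 (π q₀), π (s γ) = γ := by
  obtain ⟨U, Φ, ρ, G, hGo, hG0, hΦ0, hG⟩ := exists_local_product hπ q₀ hs
  have hq := mem_chart_source (CModel k) (π q₀)
  have hc1 : ContMDiffAt 𝓘(ℂ, CModel k) 𝓘(ℂ, CModel k × U) ω
      (fun γ => ((chartAt (CModel k) (π q₀) γ, 0) : CModel k × U)) (π q₀) :=
    (contMDiffAt_iff_contDiffAt (f := fun x : CModel k => ((x, 0) : CModel k × U))).2
      (contDiffAt_id.prodMk contDiffAt_const) |>.comp _ (chart_contMDiffAt (π q₀) hq)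
  refine ⟨fun γ => Φ (chartAt (CModel k) (π q₀) γ, 0), hΦ0,
    ContMDiffAt.comp (g := Φ) (π q₀) (hG _ hG0).2.1 hc1, ?_⟩
  filter_upwards [hc1.continuousAt.eventually_mem (hGo.mem_nhds hG0),
    (chartAt (CModel k) (π q₀)).open_source.mem_nhds hq] with γ h1 h2
  rw [(hG _ h1).1]
  exact (chartAt (CModel k) (π q₀)).left_inv h2

/-- Pushing forward a holomorphic vector field along a holomorphic map into the source. -/
theorem contMDiffAt_push {E : Type*} [NormedAddCommGroup E] [NormedSpace ℂ E]
    {Q : Type*} [TopologicalSpace Q] [ChartedSpace E Q]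
    (hπ : ContMDiff 𝓘(ℂ, CModel d) 𝓘(ℂ, CModel k) ω π) {F : Q → CM} {p : Q}
    (hF : ContMDiffAt 𝓘(ℂ, E) 𝓘(ℂ, CModel d) ω F p) {Z : CM → CModel d} (hZ : HolFieldAt Z (F p)) :
    ContMDiffAt 𝓘(ℂ, E) 𝓘(ℂ, CModel k).tangent ω (fun q =>
      (⟨π (F q), diff ℂ (CModel d) (CModel k) π (F q) (Z (F q))⟩ :
        TangentBundle 𝓘(ℂ, CModel k) N)) p := by
  have h1 := ContMDiffAt.comp p hZ hF
  have h2 := ((hπ.contMDiff_tangentMap (m := ω) (by simp)) ⟨F p, Z (F p)⟩).comp p h1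
  exact h2

/-- The field `Z` need not be projectable; its restriction to the image of a section has a
well-defined image on the leaf space. -/
theorem holFieldAt_push_section (hπ : ContMDiff 𝓘(ℂ, CModel d) 𝓘(ℂ, CModel k) ω π) {s : N → CM}
    {γ : N} (hs : ContMDiffAt 𝓘(ℂ, CModel k) 𝓘(ℂ, CModel d) ω s γ)
    (hπs : ∀ᶠ γ' in 𝓝 γ, π (s γ') = γ') {Z : CM → CModel d} (hZ : HolFieldAt Z (s γ)) :
    HolFieldAt (fun γ' => diff ℂ (CModel d) (CModel k) π (s γ') (Z (s γ'))) γ := by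
  refine (contMDiffAt_push hπ hs hZ).congr_of_eventuallyEq ?_
  filter_upwards [hπs] with γ' h
  rw [h]

/-- Along a fibre all pushed vectors lie in the one tangent space at `γ`, where the coordinate
change of the tangent bundle is the identity. Smoothness in the bundle is thus smoothness of a
vector-valued function. -/
theorem contDiffAt_push_fibre {E : Type*} [NormedAddCommGroup E] [NormedSpace ℂ E]
    (hπ : ContMDiff 𝓘(ℂ, CModel d) 𝓘(ℂ, CModel k) ω π) {f : E → CM} {u : E} {γ : N}
    (hf : ContMDiffAt 𝓘(ℂ, E) 𝓘(ℂ, CModel d) ω f u) (hπf : ∀ᶠ u' in 𝓝 u, π (f u') = γ)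
    {Z : CM → CModel d} (hZ : HolFieldAt Z (f u)) :
    ContDiffAt ℂ ω (fun u' => diff ℂ (CModel d) (CModel k) π (f u') (Z (f u'))) u := by
  have h1 := (Bundle.contMDiffAt_totalSpace.1 (contMDiffAt_push hπ hf hZ)).2
  refine contMDiffAt_iff_contDiffAt.1 (h1.congr_of_eventuallyEq ?_)
  filter_upwards [hπf] with u' h
  rw [hπf.self_of_nhds, h]
  exact (tangentCoordChange_self (I := 𝓘(ℂ, CModel k)) (by simp)).symm

end LocalProduct

end

section

/-! ### Holomorphic sections of distributions. -/

section Sections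

variable {k : ℕ} {Y : Type*} [TopologicalSpace Y] [ChartedSpace (CModel k) Y]

variable [IsManifold 𝓘(ℂ, CModel k) ω Y]

/-- Every vector of the distribution `Δ` at `y` extends to a local holomorphic section of `Δ`. -/
def HasHolSections (Δ : Y → Submodule ℂ (CModel k)) : Prop :=
  ∀ y, ∀ z ∈ Δ y, ∃ Z : Y → CModel k, IsHolSection Δ Z y ∧ Z y = z

theorem HolFieldAt.sum_smul {m : ℕ} {Z : Fin m → Y → CModel k} {y : Y}
    (hZ : ∀ i, HolFieldAt (Z i) y) (c : Fin m → ℂ) :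
    HolFieldAt (fun q => ∑ i, c i • Z i q) y := by
  rw [holFieldAt_iff]
  have h : ∀ i, ContMDiffAt 𝓘(ℂ, CModel k) 𝓘(ℂ, CModel k) ω (fun q => c i •
      diff ℂ (CModel k) (CModel k) (chartAt (CModel k) y) q (Z i q)) y := fun i =>
    (contDiff_const_smul (c i)).contMDiff.contMDiffAt.comp y (holFieldAt_iff.1 (hZ i))
  have h2 := contMDiffAt_finsetSum (t := Finset.univ) (fun i _ => h i)
  refine h2.congr_of_eventuallyEq (Filter.Eventually.of_forall fun q => ?_)
  simp only [map_sum, map_smul]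

theorem hasHolSections_of_frame {Δ : Y → Submodule ℂ (CModel k)} {m : ℕ}
    (h : ∀ y, ∃ Z : Fin m → Y → CModel k, (∀ i, HolFieldAt (Z i) y) ∧
      ∀ᶠ q in 𝓝 y, Δ q = Submodule.span ℂ (Set.range fun i => Z i q)) :
    HasHolSections Δ := by
  intro y z hz
  obtain ⟨Z, hZ, hspan⟩ := h y
  rw [hspan.self_of_nhds, Submodule.mem_span_range_iff_exists_fun] at hz
  obtain ⟨c, hc⟩ := hz
  refine ⟨fun q => ∑ i, c i • Z i q, ⟨HolFieldAt.sum_smul hZ c, ?_⟩, hc⟩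
  filter_upwards [hspan] with q hq
  rw [hq]
  exact Submodule.sum_mem _ fun i _ => Submodule.smul_mem _ _ (Submodule.subset_span ⟨i, rfl⟩)

theorem IsHolSection.add {Δ : Y → Submodule ℂ (CModel k)} {Z W : Y → CModel k} {y : Y}
    (hZ : IsHolSection Δ Z y) (hW : IsHolSection Δ W y) :
    IsHolSection Δ (fun q => Z q + W q) y := by
  refine ⟨?_, ?_⟩
  · rw [holFieldAt_iff]
    refine ((holFieldAt_iff.1 hZ.1).add (holFieldAt_iff.1 hW.1)).congr_of_eventuallyEq
      (Filter.Eventually.of_forall fun q => ?_)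
    exact map_add _ _ _
  · filter_upwards [hZ.2, hW.2] with q h1 h2
    exact add_mem h1 h2

end Sections

/-! ### Adapted frames over one leaf. -/

section Leaf

variable {d k r : ℕ} {CM : Type*} [TopologicalSpace CM] [ChartedSpace (CModel d) CM]
  [IsManifold 𝓘(ℂ, CModel d) ω CM]
  {N : Type*} [TopologicalSpace N] [ChartedSpace (CModel k) N] [IsManifold 𝓘(ℂ, CModel k) ω N]
  {π : CM → N} {τ : CM → CM} {Hc : CM → Submodule ℂ (CModel d)}
  {V : Type*} [NormedAddCommGroup V] [NormedSpace ℂ V] {S : CRSymbol V r}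

/-- Vectors of `π_* Δ` extend to holomorphic sections of `D`, if `Δ ⊆ H ⊕ τ_* H`. -/
theorem exists_holSection_leafD_of_le (hπ : ContMDiff 𝓘(ℂ, CModel d) 𝓘(ℂ, CModel k) ω π)
    (hs : ∀ q, Function.Surjective (diff ℂ (CModel d) (CModel k) π q))
    {Δ : CM → Submodule ℂ (CModel d)} (hΔ : HasHolSections Δ)
    (hle : ∀ q, Δ q ≤ Hc q ⊔ barDist τ Hc q) (q : CM) {ξ : CModel k}
    (hξ : ξ ∈ (Δ q).map (diff ℂ (CModel d) (CModel k) π q)) :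
    ∃ X : N → CModel k, IsHolSection (leafD k τ Hc π) X (π q) ∧ X (π q) = ξ := by
  obtain ⟨z, hz, rfl⟩ := hξ
  obtain ⟨Z, ⟨hZ, hZΔ⟩, rfl⟩ := hΔ q z hz
  obtain ⟨s, hs0, hsc, hsπ⟩ := exists_local_section hπ q (hs q)
  refine ⟨fun γ => diff ℂ (CModel d) (CModel k) π (s γ) (Z (s γ)), ⟨?_, ?_⟩, by simp only [hs0]⟩
  · exact holFieldAt_push_section hπ hsc hsπ (by rw [hs0]; exact hZ)
  · have hc : Filter.Tendsto s (𝓝 (π q)) (𝓝 q) := by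
      have := hsc.continuousAt.tendsto
      rwa [hs0] at this
    filter_upwards [hc.eventually hZΔ, hsπ] with γ h1 h2
    exact Submodule.mem_iSup_of_mem (p := fun q : {q : CM // π q = γ} =>
      (Hc q.1 ⊔ barDist τ Hc q.1).map (diff ℂ (CModel d) (CModel k) π q.1)) ⟨s γ, h2⟩
      ⟨_, hle _ h1, rfl⟩

/-- The contact distribution has holomorphic sections through each of its vectors. -/
theorem exists_holSection_leafD (hπ : ContMDiff 𝓘(ℂ, CModel d) 𝓘(ℂ, CModel k) ω π)
    (hs : ∀ q, Function.Surjective (diff ℂ (CModel d) (CModel k) π q))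
    (hH : HasHolSections Hc) (hbar : HasHolSections (barDist τ Hc))
    {q : CM} {φ : GrFrame V (leafD k τ Hc π (π q))} (hφ : IsAdapted k S τ Hc π (π q) q φ)
    (v : V) : ∃ X : N → CModel k, IsHolSection (leafD k τ Hc π) X (π q) ∧
      X (π q) = φ.deg1 v := by
  -- The frame carries the splitting of `V` to `J⁻` and `J⁺` at `q`, and each of these is the image
  -- of a distribution with enough holomorphic sections.
  obtain ⟨a, ha, b, hb, rfl⟩ := Submodule.mem_sup.1
    (show v ∈ S.Vm ⊔ S.Vp by rw [S.splitting.sup_eq_top]; trivial)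
  have ha' : (φ.deg1 a : CModel k) ∈ Jminus k Hc π q := by
    rw [← hφ.minus]; exact ⟨_, ⟨a, ha, rfl⟩, rfl⟩
  have hb' : (φ.deg1 b : CModel k) ∈ Jplus k τ Hc π q := by
    rw [← hφ.plus]; exact ⟨_, ⟨b, hb, rfl⟩, rfl⟩
  obtain ⟨X, hX, hXv⟩ := exists_holSection_leafD_of_le hπ hs hH (fun q => le_sup_left) q ha'
  obtain ⟨X', hX', hXv'⟩ := exists_holSection_leafD_of_le hπ hs hbar (fun q => le_sup_right) q hb'
  refine ⟨_, hX.add hX', ?_⟩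
  simp only [hXv, hXv', map_add, Submodule.coe_add]

/-- The conformal symplectic form on `D` does not depend on the adapted frame. -/
theorem form_eq_of_isAdapted (hπ : ContMDiff 𝓘(ℂ, CModel d) 𝓘(ℂ, CModel k) ω π)
    (hs : ∀ q, Function.Surjective (diff ℂ (CModel d) (CModel k) π q))
    (hH : HasHolSections Hc) (hbar : HasHolSections (barDist τ Hc)) {γ : N}
    {q q' : CM} {φ φ' : GrFrame V (leafD k τ Hc π γ)} (hq : π q = γ)
    (hφ : IsAdapted k S τ Hc π γ q φ) (hφ' : IsAdapted k S τ Hc π γ q' φ') (x y : V) :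
    φ'.deg2 (S.form x y) =
      φ.deg2 (S.form (φ.deg1.symm (φ'.deg1 x)) (φ.deg1.symm (φ'.deg1 y))) := by
  subst hq
  -- The same pair of sections computes the bracket for both frames, and this bracket at `γ` does
  -- not involve the points `q` and `q'`.
  obtain ⟨X, hX, hX'⟩ := exists_holSection_leafD hπ hs hH hbar hφ (φ.deg1.symm (φ'.deg1 x))
  obtain ⟨Y, hY, hY'⟩ := exists_holSection_leafD hπ hs hH hbar hφ (φ.deg1.symm (φ'.deg1 y))
  rw [hφ.bracket _ _ X Y hX hY hX' hY', hφ'.bracket _ _ X Y hX hY (by rw [hX']; simp)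
    (by rw [hY']; simp)]

/-- The composition of a frame with the automorphism `κ` of `𝔤₋`, given in degrees `-1`, `-2`. -/
def GrFrame.comp {D : Submodule ℂ (CModel k)} (φ : GrFrame V D) (κ₁ : V ≃ₗ[ℂ] V)
    (κ₂ : ℂ ≃ₗ[ℂ] ℂ) : GrFrame V D :=
  ⟨κ₁.trans φ.deg1, κ₂.trans φ.deg2⟩

/-- Composition of adapted frames with an automorphism of the symbol. -/
theorem IsAdapted.comp {γ : N} {q : CM} {φ : GrFrame V (leafD k τ Hc π γ)}
    (hφ : IsAdapted k S τ Hc π γ q φ) {κ₁ : V ≃ₗ[ℂ] V} {κ₂ : ℂ ≃ₗ[ℂ] ℂ}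
    (hm : S.Vm.map κ₁.toLinearMap = S.Vm) (hp : S.Vp.map κ₁.toLinearMap = S.Vp)
    (h2 : (fun A => κ₁.symm.conj A) '' (S.g2 : Set (Module.End ℂ V)) = S.g2)
    (hm2 : (fun A => κ₁.symm.conj A) '' (S.gm2 : Set (Module.End ℂ V)) = S.gm2)
    (hf : ∀ x y, κ₂ (S.form x y) = S.form (κ₁ x) (κ₁ y)) :
    IsAdapted k S τ Hc π γ q (φ.comp κ₁ κ₂) where
  minus := by
    change (S.Vm.map (φ.deg1.toLinearMap ∘ₗ κ₁.toLinearMap)).map _ = _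
    rw [Submodule.map_comp, hm, hφ.minus]
  plus := by
    change (S.Vp.map (φ.deg1.toLinearMap ∘ₗ κ₁.toLinearMap)).map _ = _
    rw [Submodule.map_comp, hp, hφ.plus]
  conj_g2 := by
    conv_rhs => rw [← h2, ← hφ.conj_g2, Set.image_image]
    rfl
  conj_gm2 := by
    conv_rhs => rw [← hm2, ← hφ.conj_gm2, Set.image_image]
    rfl
  bracket x y X Y hX hY hXx hYy := by
    rw [← hφ.bracket (κ₁ x) (κ₁ y) X Y hX hY hXx hYy, ← hf]
    rfl

/-- Two adapted frames at the same point differ by an automorphism of the symbol. -/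
theorem IsAdapted.comp_rel (hπ : ContMDiff 𝓘(ℂ, CModel d) 𝓘(ℂ, CModel k) ω π)
    (hs : ∀ q, Function.Surjective (diff ℂ (CModel d) (CModel k) π q))
    (hH : HasHolSections Hc) (hbar : HasHolSections (barDist τ Hc)) {γ : N}
    {q q' : CM} {φ φ' ψ : GrFrame V (leafD k τ Hc π γ)} (hq : π q = γ)
    (hφ : IsAdapted k S τ Hc π γ q φ) (hφ' : IsAdapted k S τ Hc π γ q φ')
    (hψ : IsAdapted k S τ Hc π γ q' ψ) :
    IsAdapted k S τ Hc π γ q'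
      (ψ.comp (φ'.deg1.trans φ.deg1.symm) (φ'.deg2.trans φ.deg2.symm)) := by
  have hinj : Function.Injective (fun p : Submodule ℂ V =>
      (p.map φ.deg1.toLinearMap).map (leafD k τ Hc π γ).subtype) := by
    intro p p' h
    exact Submodule.map_injective_of_injective φ.deg1.injective
      (Submodule.map_injective_of_injective (Submodule.injective_subtype _) h)
  have hpull : ∀ p : Submodule ℂ V,
      ((p.map (φ'.deg1.trans φ.deg1.symm).toLinearMap).map φ.deg1.toLinearMap) =
        p.map φ'.deg1.toLinearMap := by
    intro p
    rw [← Submodule.map_comp]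
    congr 1
    ext x
    simp
  have hconj : ∀ (A : Module.End ℂ (leafD k τ Hc π γ)),
      (φ'.deg1.trans φ.deg1.symm).symm.conj (φ.deg1.symm.conj A) = φ'.deg1.symm.conj A := by
    intro A
    ext x
    simp [LinearEquiv.conj_apply]
  -- The automorphism `φ⁻¹ ∘ φ'` preserves every part of the symbol, because both frames match the
  -- symbol with the same data at `q`. Hence it may be composed with an adapted frame `ψ` at another
  -- point `q'`.
  refine hψ.comp ?_ ?_ ?_ ?_ ?_
  · apply hinj
    simp only
    rw [hpull, hφ.minus, hφ'.minus]
  · apply hinj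
    simp only
    rw [hpull, hφ.plus, hφ'.plus]
  · conv_lhs => rw [← hφ.conj_g2, Set.image_image]
    simp only [hconj]
    exact hφ'.conj_g2
  · conv_lhs => rw [← hφ.conj_gm2, Set.image_image]
    simp only [hconj]
    exact hφ'.conj_gm2
  · intro x y
    simp only [LinearEquiv.trans_apply]
    rw [form_eq_of_isAdapted hπ hs hH hbar hq hφ hφ' x y, LinearEquiv.symm_apply_apply]

end Leaf

end

section

/-! ### Smooth dependence of projections on complementary subspaces. -/

section Projection

variable {V U : Type*} [NormedAddCommGroup V] [NormedSpace ℂ V] [FiniteDimensional ℂ V]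
  [NormedAddCommGroup U] [NormedSpace ℝ U]

/-- If two complementary families of subspaces have smooth sections through all their vectors
at a point, then the projection onto the first along the second depends smoothly on the parameter
near this point. -/
theorem exists_smooth_projection {Jm Jp : U → Submodule ℂ V} {u₀ : U}
    (hc : ∀ᶠ u in 𝓝 u₀, IsCompl (Jm u) (Jp u))
    (hm : ∀ x ∈ Jm u₀, ∃ α : U → V, α u₀ = x ∧ ContDiffAt ℝ ω α u₀ ∧ ∀ᶠ u in 𝓝 u₀, α u ∈ Jm u)
    (hp : ∀ x ∈ Jp u₀, ∃ α : U → V, α u₀ = x ∧ ContDiffAt ℝ ω α u₀ ∧ ∀ᶠ u in 𝓝 u₀, α u ∈ Jp u) :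
    ∃ P : U → V →L[ℂ] V, ContDiffAt ℝ ω P u₀ ∧ ∀ᶠ u in 𝓝 u₀,
      (∀ v, P u v ∈ Jm u) ∧ ∀ v, v - P u v ∈ Jp u := by
  let b := Module.finBasis ℂ V
  have hdec : ∀ j, ∃ x ∈ Jm u₀, ∃ y ∈ Jp u₀, x + y = b j := fun j =>
    Submodule.mem_sup.1 (by rw [hc.self_of_nhds.sup_eq_top]; trivial)
  choose x hx y hy hxy using hdec
  choose α hα0 hα hαJ using fun j => hm (x j) (hx j)
  choose β hβ0 hβ hβJ using fun j => hp (y j) (hy j)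
  -- `Mm u` and `Mp u` send a basis vector to the extensions of its two components. Their sum is `1`
  -- at `u₀`, hence invertible nearby, and then `Mm (Mm + Mp)⁻¹` is the projection.
  let Mm : U → V →L[ℂ] V := fun u => ∑ j, (b.coord j).toContinuousLinearMap.smulRight (α j u)
  let Mp : U → V →L[ℂ] V := fun u => ∑ j, (b.coord j).toContinuousLinearMap.smulRight (β j u)
  have hMm : ContDiffAt ℝ ω Mm u₀ := by
    refine contDiffAt_clm_of_apply fun v => ?_
    simp only [Mm, sum_apply, ContinuousLinearMap.smulRight_apply]
    exact ContDiffAt.sum fun j _ => contDiffAt_const.smul (hα j)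
  have hMp : ContDiffAt ℝ ω Mp u₀ := by
    refine contDiffAt_clm_of_apply fun v => ?_
    simp only [Mp, sum_apply, ContinuousLinearMap.smulRight_apply]
    exact ContDiffAt.sum fun j _ => contDiffAt_const.smul (hβ j)
  have hB : ContDiffAt ℝ ω (fun u => Mm u + Mp u) u₀ := hMm.add hMp
  have hB0 : Mm u₀ + Mp u₀ = 1 := by
    ext v
    have h : ∑ j, b.coord j v • b j = v := b.sum_repr v
    simp only [Mm, Mp, add_apply, sum_apply,
      ContinuousLinearMap.smulRight_apply, hα0, hβ0, ← Finset.sum_add_distrib, ← smul_add, hxy]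
    exact h
  have hunit : ∀ᶠ u in 𝓝 u₀, IsUnit (Mm u + Mp u) :=
    hB.continuousAt.eventually (by beta_reduce; rw [hB0]; exact Units.nhds 1)
  refine ⟨fun u => Mm u * Ring.inverse (Mm u + Mp u), hMm.mul ?_, ?_⟩
  · refine ContDiffAt.comp (g := Ring.inverse) u₀ ?_ hB
    have h1 := contDiffAt_ringInverse (n := ω) ℝ (1 : (V →L[ℂ] V)ˣ)
    rw [hB0]
    exact h1
  · filter_upwards [hc, hunit, Filter.eventually_all.2 hαJ, Filter.eventually_all.2 hβJ]
      with u h1 h2 h3 h4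
    have hmem : ∀ v, Mm u v ∈ Jm u := fun v => by
      simp only [Mm, sum_apply, ContinuousLinearMap.smulRight_apply]
      exact Submodule.sum_mem _ fun j _ => Submodule.smul_mem _ _ (h3 j)
    have hmemp : ∀ v, Mp u v ∈ Jp u := fun v => by
      simp only [Mp, sum_apply, ContinuousLinearMap.smulRight_apply]
      exact Submodule.sum_mem _ fun j _ => Submodule.smul_mem _ _ (h4 j)
    refine ⟨fun v => hmem _, fun v => ?_⟩
    have h5 := DFunLike.congr_fun (Ring.mul_inverse_cancel _ h2) v
    have h6 : v - (Mm u * Ring.inverse (Mm u + Mp u)) v =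
        Mp u (Ring.inverse (Mm u + Mp u) v) := by
      conv_lhs => enter [1]; rw [show v = (1 : V →L[ℂ] V) v from rfl, ← h5]
      simp
    rw [h6]
    exact hmemp _

end Projection

/-! ### The tangent space of a family of subspaces, read from projections. -/

section TangentFamily

variable {d k : ℕ} {CM : Type*} [TopologicalSpace CM] [ChartedSpace (CModel d) CM]
  {N : Type*} [TopologicalSpace N] [ChartedSpace (CModel k) N]
  {V U : Type*} [NormedAddCommGroup V] [NormedSpace ℂ V] [FiniteDimensional ℂ V]
  [NormedAddCommGroup U] [NormedSpace ℝ U]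

/-- A linear isomorphism onto a subspace has a linear left inverse on the whole space. -/
theorem exists_clm_leftInverse {D : Submodule ℂ (CModel k)} (e₀ : V ≃ₗ[ℂ] D) :
    ∃ T : CModel k →L[ℂ] V, ∀ x : D, T x = e₀.symm x := by
  obtain ⟨g, hg⟩ := LinearMap.exists_extend e₀.symm.toLinearMap
  exact ⟨g.toContinuousLinearMap, fun x => DFunLike.congr_fun hg x⟩

/-- The tangent space of a family of subspaces, in terms of the derivatives of the projections. -/
theorem conj_tangentFamily {π : CM → N} {γ : N} {D : Submodule ℂ (CModel k)} (e₀ : V ≃ₗ[ℂ] D)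
    {J J' : CM → Submodule ℂ (CModel k)} {f : U → CM} {ρ : CM → U} {O : Set U} (hO : IsOpen O)
    (hf : ∀ u ∈ O, π (f u) = γ ∧ ContMDiffAt 𝓘(ℝ, U) 𝓘(ℝ, CModel d) ∞ f u)
    {P : U → V →L[ℂ] V} (hP : ∀ u ∈ O, ContDiffAt ℝ ∞ P u)
    (hPP : ∀ u ∈ O, P u * P u = P u)
    (hJD : ∀ u ∈ O, J (f u) ≤ D)
    (hJ : ∀ u ∈ O, ∀ v, (e₀ v : CModel k) ∈ J (f u) ↔ P u v = v)
    (hJ' : ∀ u ∈ O, ∀ v, (e₀ v : CModel k) ∈ J' (f u) ↔ P u v = 0) {u : U} (hu : u ∈ O)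
    (hρf : ρ (f u) = u) (hρ : ContMDiffAt 𝓘(ℝ, CModel d) 𝓘(ℝ, U) ∞ ρ (f u))
    (hfρ : ∀ᶠ q in 𝓝 (f u), π q = γ → f (ρ q) = q) :
    (fun A => e₀.symm.conj A) '' tangentFamily (d := d) k π γ D J J' (f u) =
      Set.range fun v : U => ((fderiv ℝ P u v * P u : V →L[ℂ] V) : V →ₗ[ℂ] V) := by
  have hPd : HasFDerivAt P (fderiv ℝ P u) u :=
    ((hP u hu).differentiableAt (by simp)).hasFDerivAt
  have hPP' : ∀ x, P u (P u x) = P u x := fun x => DFunLike.congr_fun (hPP u hu) x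
  have hOu : O ∈ 𝓝 u := hO.mem_nhds hu
  obtain ⟨T, hT⟩ := exists_clm_leftInverse e₀
  apply Set.Subset.antisymm
  · rintro _ ⟨A, ⟨hA1, hA2, ε, hε, c, hc, hcγ, hc0, hA⟩, rfl⟩
    have hI : Set.Ioo (-ε) ε ∈ 𝓝 (0 : ℝ) := Ioo_mem_nhds (by linarith) hε
    have hcm : ContMDiffAt 𝓘(ℝ, ℝ) 𝓘(ℝ, CModel d) ∞ c 0 := hc.contMDiffAt hI
    have hct : Filter.Tendsto c (𝓝 0) (𝓝 (f u)) := by rw [← hc0]; exact hcm.continuousAt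
    have hm : ContDiffAt ℝ ∞ (fun t => ρ (c t)) 0 :=
      contMDiffAt_iff_contDiffAt.1 (ContMDiffAt.comp (g := ρ) 0 (by rw [hc0]; exact hρ) hcm)
    have hmd : HasDerivAt (fun t => ρ (c t)) (deriv (fun t => ρ (c t)) 0) 0 :=
      (hm.differentiableAt (by simp)).hasDerivAt
    set v := deriv (fun t => ρ (c t)) 0
    have hm0 : ρ (c 0) = u := by rw [hc0, hρf]
    have hmu : Filter.Tendsto (fun t => ρ (c t)) (𝓝 0) (𝓝 u) := by
      have := hm.continuousAt.tendsto
      rwa [hm0] at this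
    have hPm : HasDerivAt (fun t => P (ρ (c t))) (fderiv ℝ P u v) 0 :=
      HasFDerivAt.comp_hasDerivAt (l := P) 0 (by rw [hm0]; exact hPd) hmd
    -- Differentiating `P e = e` along the curve gives `P'(v) x + P e' = e'`. As `e' - A x` lies in
    -- `J`, the range of `P`, and `A x` in `J'`, its kernel, this says `A x = P'(v) x`.
    have key : ∀ x, P u x = x → e₀.symm (A (e₀ x)) = fderiv ℝ P u v x := by
      intro x hx
      obtain ⟨η, hη, hηε, e, he, heJ, he0, heA⟩ := hA (e₀ x) ((hJ u hu x).2 hx)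
      have hIη : Set.Ioo (-η) η ∈ 𝓝 (0 : ℝ) := Ioo_mem_nhds (by linarith) hη
      have hed : HasDerivAt e (deriv e 0) 0 :=
        ((he.contDiffAt hIη).differentiableAt (by simp)).hasDerivAt
      have hTe : HasDerivAt (fun t => T (e t)) (T (deriv e 0)) 0 :=
        HasFDerivAt.comp_hasDerivAt (l := T) 0 (T.restrictScalars ℝ).hasFDerivAt hed
      have heq : (fun t => P (ρ (c t)) (T (e t))) =ᶠ[𝓝 0] fun t => T (e t) := by
        filter_upwards [hI, hIη, hct.eventually hfρ, hmu.eventually hOu] with t h1 h2 h3 h4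
        have h5 : e t ∈ J (f (ρ (c t))) := by rw [h3 (hcγ t h1)]; exact heJ t h2
        rw [← hJ _ h4]
        have h6 : T (e t) = e₀.symm ⟨e t, hJD _ h4 h5⟩ := hT ⟨e t, hJD _ h4 h5⟩
        rw [h6, LinearEquiv.apply_symm_apply]
        exact h5
      have hd : HasDerivAt (fun t => P (ρ (c t)) (T (e t)))
          (fderiv ℝ P u v (T (e 0)) + P (ρ (c 0)) (T (deriv e 0))) 0 := by
        have hbil : IsBoundedBilinearMap ℝ fun p : (V →L[ℂ] V) × V => p.1 p.2 :=
          { add_left := fun _ _ _ => rfl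
            smul_left := fun _ _ _ => rfl
            add_right := fun _ _ _ => map_add _ _ _
            smul_right := fun c A y => by
              change A (c • y) = c • A y
              rw [← Complex.coe_smul, map_smul, Complex.coe_smul]
            bound := ⟨1, one_pos, fun A y => by rw [one_mul]; exact A.le_opNorm y⟩ }
        have h := (hbil.hasFDerivAt (P (ρ (c 0)), T (e 0))).comp_hasDerivAt (0 : ℝ)
          (hPm.prodMk hTe)
        convert h using 1
        · rfl
        · rw [IsBoundedBilinearMap.deriv_apply, add_comm]
      have hd2 := (hd.congr_of_eventuallyEq heq.symm).unique hTe
      have hTx : T (e 0) = x := by rw [he0, hT, LinearEquiv.symm_apply_apply]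
      rw [hTx, hm0] at hd2
      have hmemD : deriv e 0 ∈ D := by
        have := D.add_mem (hJD u hu heA) (A (e₀ x)).2
        simpa using this
      have hw : P u (T (deriv e 0) - e₀.symm (A (e₀ x))) =
          T (deriv e 0) - e₀.symm (A (e₀ x)) := by
        rw [← hJ u hu, hT ⟨_, hmemD⟩, ← map_sub, LinearEquiv.apply_symm_apply]
        exact heA
      have hy : P u (e₀.symm (A (e₀ x))) = 0 := by
        rw [← hJ' u hu, LinearEquiv.apply_symm_apply]
        exact hA2 _ ((hJ u hu x).2 hx)
      rw [map_sub, hy, sub_zero] at hw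
      rw [hw] at hd2
      have h7 : fderiv ℝ P u v x - e₀.symm (A (e₀ x)) = 0 := by
        have := sub_eq_zero.2 hd2
        rw [← this]; abel
      exact (sub_eq_zero.1 h7).symm
    refine ⟨v, ?_⟩
    ext x
    have h0 : A (e₀ (x - P u x)) = 0 := hA1 _ ((hJ' u hu _).2 (by rw [map_sub, hPP', sub_self]))
    rw [map_sub, map_sub, sub_eq_zero] at h0
    simp only [LinearEquiv.conj_apply_apply, LinearEquiv.symm_symm, h0, key _ (hPP' x)]
    rfl
  · rintro _ ⟨v, rfl⟩
    -- Conversely, the direction `v` is realized by the curve `f (u + t v)` with the vectors `P (u +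
    -- t v) y` in the moving subspaces.
    refine ⟨e₀.conj ((fderiv ℝ P u v * P u : V →L[ℂ] V) : V →ₗ[ℂ] V), ⟨?_, ?_, ?_⟩, ?_⟩
    · intro x hx
      obtain ⟨y, rfl⟩ := e₀.surjective x
      simp [LinearEquiv.conj_apply_apply, (hJ' u hu y).1 hx]
    · intro x hx
      obtain ⟨y, rfl⟩ := e₀.surjective x
      have h1 : (fun u' => P u' * P u') =ᶠ[𝓝 u] P := by
        filter_upwards [hOu] with u' hu' using hPP u' hu'
      have h2 := (hPd.mul' hPd).congr_of_eventuallyEq h1.symm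
      have h3 := DFunLike.congr_fun (h2.unique hPd) v
      -- The derivative of `P² = P`. Multiplied by `P` on the right, it shows that `P' P` takes
      -- values in the kernel of `P`, that is, in `J'`.
      have h4 : P u * fderiv ℝ P u v + fderiv ℝ P u v * P u = fderiv ℝ P u v := by
        simpa using h3
      have h5 : P u (fderiv ℝ P u v (P u y)) = 0 := by
        have h6 := DFunLike.congr_fun h4 (P u y)
        simp only [add_apply, mul_apply_eq_comp, hPP'] at h6
        simpa using h6
      have h7 := (hJ' u hu (fderiv ℝ P u v (P u y))).2 h5
      simpa [LinearEquiv.conj_apply_apply] using h7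
    · have hline : ∀ t, HasDerivAt (fun t : ℝ => u + t • v) v t := fun t => by
        simpa using ((hasDerivAt_id t).smul_const v).const_add u
      have hlc : ContDiff ℝ ∞ (fun t : ℝ => u + t • v) := by fun_prop
      have hev : ∀ᶠ t in 𝓝 (0 : ℝ), u + t • v ∈ O := by
        have : Filter.Tendsto (fun t : ℝ => u + t • v) (𝓝 0) (𝓝 u) := by
          have := hlc.continuous.tendsto 0
          simpa using this
        exact this.eventually hOu
      obtain ⟨ε, hε, hball⟩ := Metric.eventually_nhds_iff.1 hev
      have hline_mem : ∀ t ∈ Set.Ioo (-ε) ε, u + t • v ∈ O := fun t ht =>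
        hball (by rw [Real.dist_eq, sub_zero]; exact abs_lt.2 ht)
      refine ⟨ε, hε, fun t => f (u + t • v), ?_, fun t ht => (hf _ (hline_mem t ht)).1, by simp, ?_⟩
      · intro t ht
        exact (ContMDiffAt.comp (g := f) t (hf _ (hline_mem t ht)).2
          hlc.contMDiff.contMDiffAt).contMDiffWithinAt
      · intro x hx
        obtain ⟨y, rfl⟩ := e₀.surjective x
        have hy := (hJ u hu y).1 hx
        have hcl : ∀ t ∈ Set.Ioo (-ε) ε, ContDiffAt ℝ ∞ (fun t : ℝ => P (u + t • v)) t :=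
          fun t ht => ContDiffAt.comp (g := P) t (hP _ (hline_mem t ht)) hlc.contDiffAt
        let ev : (V →L[ℂ] V) →L[ℝ] CModel k := LinearMap.toContinuousLinearMap
          { toFun := fun B => (e₀ (B y) : CModel k)
            map_add' := fun B B' => by simp
            map_smul' := fun c B => by
              rw [smul_apply, ← Complex.coe_smul, map_smul,
                Submodule.coe_smul, Complex.coe_smul]; rfl }
        refine ⟨ε, hε, le_rfl, fun t => ev (P (u + t • v)), ?_, ?_, ?_, ?_⟩
        · intro t ht
          exact (ev.contDiff.contDiffAt.comp t (hcl t ht)).contDiffWithinAt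
        · intro t ht
          exact (hJ _ (hline_mem t ht) _).2 (DFunLike.congr_fun (hPP _ (hline_mem t ht)) y)
        · change (e₀ (P (u + (0 : ℝ) • v) y) : CModel k) = _
          rw [zero_smul, add_zero, hy]
        · have h1 : HasDerivAt (fun t : ℝ => P (u + t • v)) (fderiv ℝ P u v) 0 :=
            HasFDerivAt.comp_hasDerivAt (l := P) 0 (by simpa using hPd) (hline 0)
          have h2 := (ev.hasFDerivAt.comp_hasDerivAt (0 : ℝ) h1).deriv
          have h3 : deriv (fun t : ℝ => ev (P (u + t • v))) 0 = ev (fderiv ℝ P u v) := h2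
          rw [h3]
          have h4 : ev (fderiv ℝ P u v) - ((e₀.conj
              ((fderiv ℝ P u v * P u : V →L[ℂ] V) : V →ₗ[ℂ] V)) (e₀ y) : CModel k) = 0 := by
            simp [hy, ev]
          rw [h4]
          exact zero_mem _
    · ext x
      simp

end TangentFamily

end

/-! ### Leaf charts and the algebraic description of frames in them. -/

section

variable {d k r : ℕ} {CM : Type*} [TopologicalSpace CM] [ChartedSpace (CModel d) CM]
  [IsManifold 𝓘(ℂ, CModel d) ω CM]
  {N : Type*} [TopologicalSpace N] [ChartedSpace (CModel k) N] [IsManifold 𝓘(ℂ, CModel k) ω N]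
  {π : CM → N} {τ : CM → CM} {Hc : CM → Submodule ℂ (CModel d)}
  {V : Type*} [NormedAddCommGroup V] [NormedSpace ℂ V] {S : CRSymbol V r}
  {U : Type*} [NormedAddCommGroup U] [NormedSpace ℝ U]

theorem IsAdapted.mem_Jminus_iff {γ : N} {q : CM} {φ : GrFrame V (leafD k τ Hc π γ)}
    (hφ : IsAdapted k S τ Hc π γ q φ) (x : leafD k τ Hc π γ) :
    (x : CModel k) ∈ Jminus k Hc π q ↔ φ.deg1.symm x ∈ S.Vm := by
  rw [← hφ.minus]
  constructor
  · rintro ⟨_, ⟨y, hy, rfl⟩, h⟩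
    have h' : φ.deg1 y = x := Subtype.ext h
    rwa [← h', LinearEquiv.symm_apply_apply]
  · intro h
    exact ⟨_, ⟨_, h, rfl⟩, by simp⟩

theorem IsAdapted.mem_Jplus_iff {γ : N} {q : CM} {φ : GrFrame V (leafD k τ Hc π γ)}
    (hφ : IsAdapted k S τ Hc π γ q φ) (x : leafD k τ Hc π γ) :
    (x : CModel k) ∈ Jplus k τ Hc π q ↔ φ.deg1.symm x ∈ S.Vp := by
  rw [← hφ.plus]
  constructor
  · rintro ⟨_, ⟨y, hy, rfl⟩, h⟩
    have h' : φ.deg1 y = x := Subtype.ext h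
    rwa [← h', LinearEquiv.symm_apply_apply]
  · intro h
    exact ⟨_, ⟨_, h, rfl⟩, by simp⟩

theorem Jminus_le_leafD (q : CM) : Jminus k Hc π q ≤ leafD k τ Hc π (π q) :=
  (Submodule.map_mono le_sup_left).trans
    (le_iSup (fun q' : {q' : CM // π q' = π q} =>
      (Hc q'.1 ⊔ barDist τ Hc q'.1).map (diff ℂ (CModel d) (CModel k) π q'.1)) ⟨q, rfl⟩)

theorem Jplus_le_leafD (q : CM) : Jplus k τ Hc π q ≤ leafD k τ Hc π (π q) :=
  (Submodule.map_mono le_sup_right).trans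
    (le_iSup (fun q' : {q' : CM // π q' = π q} =>
      (Hc q'.1 ⊔ barDist τ Hc q'.1).map (diff ℂ (CModel d) (CModel k) π q'.1)) ⟨q, rfl⟩)

theorem HasConstantSymbol.exists_isAdapted (hS : HasConstantSymbol k S τ Hc π) {γ : N} {q : CM}
    (hq : π q = γ) : ∃ φ, IsAdapted k S τ Hc π γ q φ := by
  subst hq
  obtain ⟨φ, hφ⟩ := hS q
  exact ⟨φ, hφ.2⟩

variable [FiniteDimensional ℂ V]

variable (π τ Hc) in
/-- A parametrization `f` of a neighbourhood in the fibre of `π` over `γ`, with inverse `ρ`, and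
the projections `P u` onto `J⁻ (f u)` along `J⁺ (f u)` in the coordinates on `D` given by
a frame. -/
structure IsLeafChart {γ : N} (φ₀ : GrFrame V (leafD k τ Hc π γ)) (f : U → CM) (ρ : CM → U)
    (O : Set U) (P : U → V →L[ℂ] V) : Prop where
  isOpen : IsOpen O
  proj : ∀ u ∈ O, π (f u) = γ
  smooth : ∀ u ∈ O, ContMDiffAt 𝓘(ℝ, U) 𝓘(ℝ, CModel d) ∞ f u
  left_inv : ∀ u ∈ O, ρ (f u) = u
  smooth_inv : ∀ u ∈ O, ContMDiffAt 𝓘(ℝ, CModel d) 𝓘(ℝ, U) ∞ ρ (f u)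
  right_inv : ∀ u ∈ O, ∀ᶠ q in 𝓝 (f u), π q = γ → f (ρ q) = q
  smooth_proj : ∀ u ∈ O, ContDiffAt ℝ ∞ P u
  idem : ∀ u ∈ O, P u * P u = P u
  mem_minus : ∀ u ∈ O, ∀ v, (φ₀.deg1 v : CModel k) ∈ Jminus k Hc π (f u) ↔ P u v = v
  mem_plus : ∀ u ∈ O, ∀ v, (φ₀.deg1 v : CModel k) ∈ Jplus k τ Hc π (f u) ↔ P u v = 0

/-- `J⁻` and `J⁺` are complementary in `D` at all points of the leaf, since each point has an
adapted frame; they vary smoothly, since holomorphic sections of `H` and `τ_* H` can be pushed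
forward along the fibre. -/
theorem exists_leafChart_of_fibre_chart {W : Type*} [NormedAddCommGroup W] [NormedSpace ℂ W]
    (hπ : ContMDiff 𝓘(ℂ, CModel d) 𝓘(ℂ, CModel k) ω π)
    (hH : HasHolSections Hc) (hbar : HasHolSections (barDist τ Hc))
    (hS : HasConstantSymbol k S τ Hc π) {γ : N} (φ₀ : GrFrame V (leafD k τ Hc π γ))
    {f : W → CM} {ρ : CM → W} {O : Set W} (hO : IsOpen O) {u₀ : W} (hu₀ : u₀ ∈ O)
    (hf : ∀ u ∈ O, π (f u) = γ ∧ ContMDiffAt 𝓘(ℂ, W) 𝓘(ℂ, CModel d) ω f u ∧ ρ (f u) = u ∧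
      ContMDiffAt 𝓘(ℂ, CModel d) 𝓘(ℂ, W) ω ρ (f u) ∧ ∀ᶠ q in 𝓝 (f u), π q = γ → f (ρ q) = q) :
    ∃ O' : Set W, u₀ ∈ O' ∧ ∃ P : W → V →L[ℂ] V, IsLeafChart π τ Hc φ₀ f ρ O' P := by
  obtain ⟨T, hT⟩ := exists_clm_leftInverse φ₀.deg1
  have hT' : ∀ {x : CModel k}, x ∈ leafD k τ Hc π γ → (φ₀.deg1 (T x) : CModel k) = x := by
    intro x hx
    rw [hT ⟨x, hx⟩, LinearEquiv.apply_symm_apply]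
  have hOu : O ∈ 𝓝 u₀ := hO.mem_nhds hu₀
  let Jm : W → Submodule ℂ V := fun u =>
    (Jminus k Hc π (f u)).comap ((leafD k τ Hc π γ).subtype ∘ₗ φ₀.deg1.toLinearMap)
  let Jp : W → Submodule ℂ V := fun u =>
    (Jplus k τ Hc π (f u)).comap ((leafD k τ Hc π γ).subtype ∘ₗ φ₀.deg1.toLinearMap)
  have hc : ∀ u ∈ O, IsCompl (Jm u) (Jp u) := by
    intro u hu
    obtain ⟨φ, hφ⟩ := hS.exists_isAdapted (hf u hu).1
    have h := ((Submodule.orderIsoMapComap (φ.deg1.trans φ₀.deg1.symm)).isCompl_iff).1 S.splitting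
    have hJm : Jm u = S.Vm.map (φ.deg1.trans φ₀.deg1.symm).toLinearMap := by
      ext v
      refine (hφ.mem_Jminus_iff (φ₀.deg1 v)).trans ⟨fun h => ⟨_, h, by simp⟩, ?_⟩
      rintro ⟨x, hx, rfl⟩
      simpa using hx
    have hJp : Jp u = S.Vp.map (φ.deg1.trans φ₀.deg1.symm).toLinearMap := by
      ext v
      refine (hφ.mem_Jplus_iff (φ₀.deg1 v)).trans ⟨fun h => ⟨_, h, by simp⟩, ?_⟩
      rintro ⟨x, hx, rfl⟩
      simpa using hx
    rw [hJm, hJp]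
    exact h
  have hfc : Filter.Tendsto f (𝓝 u₀) (𝓝 (f u₀)) := (hf u₀ hu₀).2.1.continuousAt
  have hsec : ∀ {Δ : CM → Submodule ℂ (CModel d)}, HasHolSections Δ →
      (∀ q, (Δ q).map (diff ℂ (CModel d) (CModel k) π q) ≤ leafD k τ Hc π (π q)) → ∀ x,
      (φ₀.deg1 x : CModel k) ∈ (Δ (f u₀)).map (diff ℂ (CModel d) (CModel k) π (f u₀)) →
      ∃ α : W → V, α u₀ = x ∧ ContDiffAt ℝ ω α u₀ ∧ ∀ᶠ u in 𝓝 u₀,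
        (φ₀.deg1 (α u) : CModel k) ∈ (Δ (f u)).map (diff ℂ (CModel d) (CModel k) π (f u)) := by
    intro Δ hΔ hle x hx
    obtain ⟨z, hz, hzx⟩ := hx
    obtain ⟨Z, hZ, rfl⟩ := hΔ _ z hz
    refine ⟨fun u => T (diff ℂ (CModel d) (CModel k) π (f u) (Z (f u))), ?_, ?_, ?_⟩
    · simp only [hzx, hT, LinearEquiv.symm_apply_apply]
    · have h := contDiffAt_push_fibre hπ (hf u₀ hu₀).2.1
        (Filter.eventually_of_mem hOu fun u hu => (hf u hu).1) hZ.1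
      exact (T.contDiff.contDiffAt.comp u₀ h).restrict_scalars ℝ
    · filter_upwards [hfc.eventually hZ.2, hOu] with u h1 h2
      have h3 : diff ℂ (CModel d) (CModel k) π (f u) (Z (f u)) ∈
          (Δ (f u)).map (diff ℂ (CModel d) (CModel k) π (f u)) := ⟨_, h1, rfl⟩
      have h4 := hle _ h3
      rw [(hf u h2).1] at h4
      rwa [hT' h4]
  obtain ⟨P, hP, hPJ⟩ := exists_smooth_projection (Jm := Jm) (Jp := Jp)
    (Filter.eventually_of_mem hOu hc) (hsec hH (fun q => Jminus_le_leafD q))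
    (hsec hbar fun q => Jplus_le_leafD q)
  obtain ⟨O', hO'sub, hO', hu₀'⟩ := mem_nhds_iff.1
    (((hP.eventually (by simp)).and hPJ).and hOu)
  have hmem : ∀ u ∈ O', ∀ v, v ∈ Jm u ↔ P u v = v := by
    intro u hu v
    obtain ⟨⟨-, h1, h2⟩, h3⟩ := hO'sub hu
    refine ⟨fun h => ?_, fun h => h ▸ h1 v⟩
    have h4 : v - P u v ∈ Jm u ⊓ Jp u := ⟨sub_mem h (h1 v), h2 v⟩
    rw [(hc u h3).inf_eq_bot, Submodule.mem_bot] at h4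
    exact (sub_eq_zero.1 h4).symm
  have hmem' : ∀ u ∈ O', ∀ v, v ∈ Jp u ↔ P u v = 0 := by
    intro u hu v
    obtain ⟨⟨-, h1, h2⟩, h3⟩ := hO'sub hu
    refine ⟨fun h => ?_, fun h => by have := h2 v; rwa [h, sub_zero] at this⟩
    have h4 : P u v ∈ Jm u ⊓ Jp u := ⟨h1 v, by simpa using sub_mem h (h2 v)⟩
    rwa [(hc u h3).inf_eq_bot, Submodule.mem_bot] at h4
  refine ⟨O', hu₀', P, hO', fun u hu => (hf u (hO'sub hu).2).1, fun u hu => ?_,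
    fun u hu => (hf u (hO'sub hu).2).2.2.1, fun u hu => ?_,
    fun u hu => (hf u (hO'sub hu).2).2.2.2.2, fun u hu => (hO'sub hu).1.1.of_le le_top,
    fun u hu => ?_, hmem, hmem'⟩
  · exact (ContMDiffAt.restrict_real (hf u (hO'sub hu).2).2.1).of_le le_top
  · exact (ContMDiffAt.restrict_real (hf u (hO'sub hu).2).2.2.2.1).of_le le_top
  · ext v
    exact (hmem u hu _).1 ((hO'sub hu).1.2.1 v)

variable (S) in
/-- The linear automorphism `g` of `𝔤₋₁` and the number `s` describe an adapted frame in
a leaf chart with projections `P` at the point with parameter `u`. -/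
structure IsFibreFrame (P : U → V →L[ℂ] V) (u : U) (g : V →L[ℂ] V) (s : ℂ) : Prop where
  isUnit : IsUnit g
  ne_zero : s ≠ 0
  form : ∀ x y, S.form (g x) (g y) = s * S.form x y
  minus : ∀ x ∈ S.Vm, P u (g x) = g x
  plus : ∀ x ∈ S.Vp, P u (g x) = 0
  g2 : (Set.range fun v : U => ((fderiv ℝ P u v * P u : V →L[ℂ] V) : V →ₗ[ℂ] V)) =
    (fun A : Module.End ℂ V => (g : V →ₗ[ℂ] V) * A * ((Ring.inverse g : V →L[ℂ] V) : V →ₗ[ℂ] V)) ''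
      S.g2
  gm2 : (Set.range fun v : U =>
      ((fderiv ℝ (fun u => 1 - P u) u v * (1 - P u) : V →L[ℂ] V) : V →ₗ[ℂ] V)) =
    (fun A : Module.End ℂ V => (g : V →ₗ[ℂ] V) * A * ((Ring.inverse g : V →L[ℂ] V) : V →ₗ[ℂ] V)) ''
      S.gm2

section

variable {γ : N} {φ₀ : GrFrame V (leafD k τ Hc π γ)} {f : U → CM} {ρ : CM → U} {O : Set U}
  {P : U → V →L[ℂ] V}

theorem IsLeafChart.conj_tangentFamily_minus (h : IsLeafChart π τ Hc φ₀ f ρ O P) {u : U}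
    (hu : u ∈ O) : (fun A => φ₀.deg1.symm.conj A) '' tangentFamily (d := d) k π γ
      (leafD k τ Hc π γ) (Jminus k Hc π) (Jplus k τ Hc π) (f u) =
      Set.range fun v : U => ((fderiv ℝ P u v * P u : V →L[ℂ] V) : V →ₗ[ℂ] V) :=
  conj_tangentFamily φ₀.deg1 h.isOpen (fun u hu => ⟨h.proj u hu, h.smooth u hu⟩) h.smooth_proj
    h.idem (fun u hu => by rw [← h.proj u hu]; exact Jminus_le_leafD _) h.mem_minus h.mem_plus hu
    (h.left_inv u hu) (h.smooth_inv u hu) (h.right_inv u hu)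

theorem IsLeafChart.conj_tangentFamily_plus (h : IsLeafChart π τ Hc φ₀ f ρ O P) {u : U}
    (hu : u ∈ O) : (fun A => φ₀.deg1.symm.conj A) '' tangentFamily (d := d) k π γ
      (leafD k τ Hc π γ) (Jplus k τ Hc π) (Jminus k Hc π) (f u) =
      Set.range fun v : U =>
        ((fderiv ℝ (fun u => 1 - P u) u v * (1 - P u) : V →L[ℂ] V) : V →ₗ[ℂ] V) := by
  refine conj_tangentFamily φ₀.deg1 (P := fun u => 1 - P u) h.isOpen
    (fun u hu => ⟨h.proj u hu, h.smooth u hu⟩)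
    (fun u hu => contDiffAt_const.sub (h.smooth_proj u hu))
    (fun u hu => ?_) (fun u hu => by rw [← h.proj u hu]; exact Jplus_le_leafD _) ?_ ?_ hu
    (h.left_inv u hu) (h.smooth_inv u hu) (h.right_inv u hu)
  · have := h.idem u hu
    simp only [mul_sub, sub_mul, mul_one, one_mul, this, sub_self, sub_zero]
  · intro u hu v
    rw [h.mem_plus u hu]
    simp [sub_eq_self]
  · intro u hu v
    rw [h.mem_minus u hu]
    change _ ↔ v - P u v = 0
    rw [sub_eq_zero, eq_comm]

/-- With `IsLeafChart.isAdapted` this reduces the choice of frames to algebra in `End V`: `g` and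
`s` are the components of `φ₀⁻¹ ∘ φ` in degrees `-1` and `-2`, and the scaling of the form is
`form_eq_of_isAdapted`. -/
theorem IsLeafChart.isFibreFrame (h : IsLeafChart π τ Hc φ₀ f ρ O P)
    (hπ : ContMDiff 𝓘(ℂ, CModel d) 𝓘(ℂ, CModel k) ω π)
    (hs : ∀ q, Function.Surjective (diff ℂ (CModel d) (CModel k) π q))
    (hH : HasHolSections Hc) (hbar : HasHolSections (barDist τ Hc))
    {q₀ : CM} (hq₀ : π q₀ = γ) (hφ₀ : IsAdapted k S τ Hc π γ q₀ φ₀) {u : U} (hu : u ∈ O)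
    {φ : GrFrame V (leafD k τ Hc π γ)} (hφ : IsAdapted k S τ Hc π γ (f u) φ) :
    IsFibreFrame S P u
      ((φ.deg1.trans φ₀.deg1.symm).toContinuousLinearEquiv : V →L[ℂ] V)
      (φ₀.deg2.symm (φ.deg2 1)) := by
  set e := (φ.deg1.trans φ₀.deg1.symm).toContinuousLinearEquiv with he
  have hinv : Ring.inverse (e : V →L[ℂ] V) = (e.symm : V →L[ℂ] V) := by
    rw [ContinuousLinearMap.ringInverse_equiv, ContinuousLinearMap.inverse_equiv]
  have hconj : ∀ A : Module.End ℂ (leafD k τ Hc π γ), ((e : V →L[ℂ] V) : V →ₗ[ℂ] V) *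
      φ.deg1.symm.conj A * ((Ring.inverse (e : V →L[ℂ] V) : V →L[ℂ] V) : V →ₗ[ℂ] V) =
      φ₀.deg1.symm.conj A := by
    intro A
    rw [hinv]
    ext x
    simp [LinearEquiv.conj_apply_apply, he]
  refine ⟨?_, ?_, fun x y => ?_, fun x hx => ?_, fun x hx => ?_, ?_, ?_⟩
  · exact ContinuousLinearMap.isUnit_iff_bijective.2 e.bijective
  · simp
  · have h1 := form_eq_of_isAdapted hπ hs hH hbar hq₀ hφ₀ hφ x y
    have h2 : φ.deg2 (S.form x y) = S.form x y • φ.deg2 1 := by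
      rw [← map_smul, smul_eq_mul, mul_one]
    have h3 := congrArg φ₀.deg2.symm h1
    rw [h2, map_smul, LinearEquiv.symm_apply_apply, smul_eq_mul] at h3
    rw [mul_comm, h3]
    rfl
  · rw [← h.mem_minus u hu, hφ.mem_Jminus_iff]
    simpa [he] using hx
  · rw [← h.mem_plus u hu, hφ.mem_Jplus_iff]
    simpa [he] using hx
  · rw [← h.conj_tangentFamily_minus hu, ← hφ.conj_g2, Set.image_image]
    simp only [hconj]
  · rw [← h.conj_tangentFamily_plus hu, ← hφ.conj_gm2, Set.image_image]
    simp only [hconj]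

/-- `IsFibreFrame` only places the images of `Vm` and `Vp` inside the range and the kernel of `P u`.
Equality follows because `g` is onto and `Vm`, `Vp` together span `V`. -/
theorem IsLeafChart.isAdapted (h : IsLeafChart π τ Hc φ₀ f ρ O P)
    {q₀ : CM} (hφ₀ : IsAdapted k S τ Hc π γ q₀ φ₀) {u : U} (hu : u ∈ O)
    {g : V ≃ₗ[ℂ] V} {s : ℂˣ} (hg : IsFibreFrame S P u (g.toContinuousLinearEquiv : V →L[ℂ] V) s) :
    IsAdapted k S τ Hc π γ (f u) (φ₀.comp g (LinearEquiv.smulOfUnit s)) := by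
  set e := g.toContinuousLinearEquiv with he
  have hinv : Ring.inverse (e : V →L[ℂ] V) = (e.symm : V →L[ℂ] V) := by
    rw [ContinuousLinearMap.ringInverse_equiv, ContinuousLinearMap.inverse_equiv]
  have hconj : ∀ A : Module.End ℂ V, g.symm.conj (((e : V →L[ℂ] V) : V →ₗ[ℂ] V) *
      A * ((Ring.inverse (e : V →L[ℂ] V) : V →L[ℂ] V) : V →ₗ[ℂ] V)) = A := by
    intro A
    rw [hinv]
    ext x
    simp [LinearEquiv.conj_apply_apply, he]
  have hconj' : ∀ A : Module.End ℂ (leafD k τ Hc π γ),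
      (φ₀.comp g (LinearEquiv.smulOfUnit s)).deg1.symm.conj A =
        g.symm.conj (φ₀.deg1.symm.conj A) := by
    intro A
    ext x
    simp [LinearEquiv.conj_apply_apply, GrFrame.comp]
  have hdec : ∀ v, ∃ a ∈ S.Vm, ∃ b ∈ S.Vp, v = g a + g b := by
    intro v
    obtain ⟨a, ha, b, hb, hab⟩ := Submodule.mem_sup.1
      (show g.symm v ∈ S.Vm ⊔ S.Vp by rw [S.splitting.sup_eq_top]; trivial)
    exact ⟨a, ha, b, hb, by rw [← map_add, hab, LinearEquiv.apply_symm_apply]⟩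
  have hm : ∀ a ∈ S.Vm, P u (g a) = g a := hg.minus
  have hp : ∀ b ∈ S.Vp, P u (g b) = 0 := hg.plus
  refine ⟨?_, ?_, ?_, ?_, ?_⟩
  · apply le_antisymm
    · rintro _ ⟨_, ⟨x, hx, rfl⟩, rfl⟩
      exact (h.mem_minus u hu (g x)).2 (hm x hx)
    · intro y hy
      have hyD : y ∈ leafD k τ Hc π γ := by
        rw [← h.proj u hu]; exact Jminus_le_leafD _ hy
      obtain ⟨v, hv⟩ := φ₀.deg1.surjective ⟨y, hyD⟩
      have hv' : (φ₀.deg1 v : CModel k) = y := by rw [hv]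
      rw [← hv', h.mem_minus u hu] at hy
      obtain ⟨a, ha, b, hb, rfl⟩ := hdec v
      rw [map_add, hm a ha, hp b hb, add_zero] at hy
      rw [← hy] at hv'
      exact ⟨_, ⟨a, ha, rfl⟩, hv'⟩
  · apply le_antisymm
    · rintro _ ⟨_, ⟨x, hx, rfl⟩, rfl⟩
      exact (h.mem_plus u hu (g x)).2 (hp x hx)
    · intro y hy
      have hyD : y ∈ leafD k τ Hc π γ := by
        rw [← h.proj u hu]; exact Jplus_le_leafD _ hy
      obtain ⟨v, hv⟩ := φ₀.deg1.surjective ⟨y, hyD⟩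
      have hv' : (φ₀.deg1 v : CModel k) = y := by rw [hv]
      rw [← hv', h.mem_plus u hu] at hy
      obtain ⟨a, ha, b, hb, rfl⟩ := hdec v
      rw [map_add, hm a ha, hp b hb, add_zero] at hy
      rw [hy, zero_add] at hv'
      exact ⟨_, ⟨b, hb, rfl⟩, hv'⟩
  · simp only [hconj']
    rw [← Set.image_image (fun B => g.symm.conj B) (fun A => φ₀.deg1.symm.conj A),
      h.conj_tangentFamily_minus hu, hg.g2, Set.image_image]
    simp only [hconj, Set.image_id']
  · simp only [hconj']
    rw [← Set.image_image (fun B => g.symm.conj B) (fun A => φ₀.deg1.symm.conj A),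
      h.conj_tangentFamily_plus hu, hg.gm2, Set.image_image]
    simp only [hconj, Set.image_id']
  · intro x y X Y hX hY hXx hYy
    rw [← hφ₀.bracket (g x) (g y) X Y hX hY hXx hYy]
    have : S.form (g x) (g y) = s * S.form x y := hg.form x y
    rw [this]
    rfl

end

end

section

/-! ### Linear coordinates on a family of conjugate subspaces. -/

section ConjugateSubspaces

variable {B U : Type*} [NormedRing B] [NormedAlgebra ℝ B] [FiniteDimensional ℝ B]
  [NormedAddCommGroup U] [NormedSpace ℝ U]

/-- If the ranges of a continuous family of linear maps are conjugate to the subspace `G`, then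
linear coordinates on the ranges can be chosen that depend continuously on the parameter. -/
theorem exists_lift_conj_subspace (G : Submodule ℝ B) {L : U → U →L[ℝ] B} {u₀ : U}
    (hL : ContinuousAt L u₀)
    (hex : ∃ g : Bˣ, Set.range (L u₀) = (fun A : B => (g : B) * A * (↑g⁻¹ : B)) '' G) :
    ∃ l : G →L[ℝ] U, ∀ᶠ u in 𝓝 u₀, ∀ g : Bˣ,
      Set.range (L u) = (fun A : B => (g : B) * A * (↑g⁻¹ : B)) '' G →
      ∃ a : (G →L[ℝ] G)ˣ, ∀ X : G, L u (l X) = (g : B) * ((a : G →L[ℝ] G) X : B) * (↑g⁻¹ : B) := by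
  obtain ⟨g₀, hg₀⟩ := hex
  let c : Bˣ → B →L[ℝ] B := fun g => ContinuousLinearMap.mulLeftRight ℝ B (g : B) (↑g⁻¹ : B)
  have hc : ∀ g A, c g A = (g : B) * A * (↑g⁻¹ : B) := fun g A => rfl
  let b := Module.finBasis ℝ G
  have hv : ∀ i, ∃ v, L u₀ v = c g₀ (b i) := fun i => by
    have : c g₀ (b i) ∈ Set.range (L u₀) := by rw [hg₀]; exact ⟨_, (b i).2, rfl⟩
    exact this
  choose v hv using hv
  -- A single `l`, chosen so that `L u₀ ∘ l` is conjugation by `g₀`, serves all nearby `u`: `Q ∘ L u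
  -- ∘ l` is `1` at `u₀`, hence invertible nearby, so `L u ∘ l` stays injective. Any `g` conjugating
  -- `G` to the range then yields an injective, hence invertible, endomorphism `a` of `G`.
  let l : G →L[ℝ] U := (b.constr ℝ v).toContinuousLinearMap
  have hl : ∀ X : G, L u₀ (l X) = c g₀ X := by
    have h : (L u₀).toLinearMap ∘ₗ b.constr ℝ v = (c g₀).toLinearMap ∘ₗ G.subtype :=
      b.ext fun i => by simp [hv]
    exact fun X => DFunLike.congr_fun h X
  obtain ⟨Q, hQ⟩ := LinearMap.exists_leftInverse_of_injective
    ((c g₀).toLinearMap ∘ₗ G.subtype) (LinearMap.ker_eq_bot.2 fun X Y h => by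
      have h' : (g₀ : B) * X * (↑g₀⁻¹ : B) = (g₀ : B) * Y * (↑g₀⁻¹ : B) := h
      simpa using h')
  have hcont : ContinuousAt (fun u => (Q.toContinuousLinearMap ∘L L u) ∘L l) u₀ :=
    (continuousAt_const.clm_comp hL).clm_comp continuousAt_const
  have h0 : (Q.toContinuousLinearMap ∘L L u₀) ∘L l = 1 := by
    ext1 X
    have := DFunLike.congr_fun hQ X
    simpa [hl] using this
  have hcomp : CompleteSpace G := FiniteDimensional.complete ℝ G
  have hunit : ∀ᶠ u in 𝓝 u₀, IsUnit ((Q.toContinuousLinearMap ∘L L u) ∘L l) :=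
    hcont.eventually (by beta_reduce; rw [h0]; exact @Units.nhds (G →L[ℝ] G) _ _ 1)
  refine ⟨l, hunit.mono fun u hu g hg => ?_⟩
  have hmem : ∀ X : G, ((c g⁻¹).comp ((L u).comp l)) X ∈ G := by
    intro X
    obtain ⟨A, hA, hAX⟩ : L u (l X) ∈ (fun A : B => (g : B) * A * (↑g⁻¹ : B)) '' G := by
      rw [← hg]; exact ⟨_, rfl⟩
    have : ((c g⁻¹).comp ((L u).comp l)) X = A := by
      simp only [ContinuousLinearMap.comp_apply, ← hAX, hc]
      simp [mul_assoc]
    rw [this]; exact hA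
  let a : G →L[ℝ] G := ((c g⁻¹).comp ((L u).comp l)).codRestrict G hmem
  have ha : ∀ X : G, L u (l X) = (g : B) * (a X : B) * (↑g⁻¹ : B) := by
    intro X
    change _ = (g : B) * ((↑g⁻¹ : B) * L u (l X) * (↑(g⁻¹)⁻¹ : B)) * (↑g⁻¹ : B)
    simp [mul_assoc]
  have hinj : Function.Injective a := by
    intro X Y hXY
    have h1 : L u (l X) = L u (l Y) := by rw [ha, ha, hXY]
    obtain ⟨w, hw⟩ := hu
    have h2 : ((Q.toContinuousLinearMap ∘L L u) ∘L l) X =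
        ((Q.toContinuousLinearMap ∘L L u) ∘L l) Y := by
      simp only [ContinuousLinearMap.comp_apply, h1]
    rw [← hw] at h2
    have h3 := congrArg (↑w⁻¹ : G →L[ℝ] G) h2
    rw [← mul_apply_eq_comp, ← mul_apply_eq_comp, Units.inv_mul] at h3
    exact h3
  have hsurj : Function.Surjective a :=
    (LinearMap.injective_iff_surjective (f := a.toLinearMap)).1 hinj
  obtain ⟨w, hw⟩ := ContinuousLinearMap.isUnit_iff_bijective.2 ⟨hinj, hsurj⟩
  exact ⟨w, fun X => by rw [ha, hw]⟩

end ConjugateSubspaces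

/-! ### The group action whose orbit contains the symbols. -/

section SymbolAction

variable {B F G G' U : Type*} [NormedRing B] [NormedAlgebra ℝ B] [FiniteDimensional ℝ B]
  [NormedAddCommGroup F] [NormedSpace ℂ F] [FiniteDimensional ℂ F]
  [NormedAddCommGroup G] [NormedSpace ℝ G] [FiniteDimensional ℝ G]
  [NormedAddCommGroup G'] [NormedSpace ℝ G'] [FiniteDimensional ℝ G']
  {θ : B → F →L[ℂ] F}

variable (θ) in
/-- The action of `m` with inverse `n` on the space of symbols, consisting of a form,
a projection, and two parametrized spaces of endomorphisms; the algebra `B` acts on forms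
by `θ`. -/
def symbolAct (m n : B × ℂ × (G →L[ℝ] G) × (G' →L[ℝ] G'))
    (x : F × B × (G →L[ℝ] B) × (G' →L[ℝ] B)) : F × B × (G →L[ℝ] B) × (G' →L[ℝ] B) :=
  (m.2.1 • θ n.1 x.1, m.1 * x.2.1 * n.1,
    (ContinuousLinearMap.mulLeftRight ℝ B m.1 n.1) ∘L (x.2.2.1 ∘L n.2.2.1),
    (ContinuousLinearMap.mulLeftRight ℝ B m.1 n.1) ∘L (x.2.2.2 ∘L n.2.2.2))

theorem symbolAct_mul (hθ : ∀ a b x, θ (a * b) x = θ b (θ a x))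
    (m m' n n' : B × ℂ × (G →L[ℝ] G) × (G' →L[ℝ] G'))
    (x : F × B × (G →L[ℝ] B) × (G' →L[ℝ] B)) :
    symbolAct θ (m * m') (n' * n) x = symbolAct θ m n (symbolAct θ m' n' x) := by
  refine Prod.ext ?_ (Prod.ext ?_ (Prod.ext ?_ ?_))
  · simp [symbolAct, hθ, mul_smul]
  · simp [symbolAct, mul_assoc]
  · ext1 X
    simp [symbolAct, mul_assoc]
  · ext1 X
    simp [symbolAct, mul_assoc]

theorem symbolAct_one (hθ : ∀ x, θ 1 x = x) (x : F × B × (G →L[ℝ] B) × (G' →L[ℝ] B)) :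
    symbolAct θ 1 1 x = x := by
  refine Prod.ext ?_ (Prod.ext ?_ (Prod.ext ?_ ?_))
  · simp [symbolAct, hθ]
  · simp [symbolAct]
  · ext1 X
    simp [symbolAct]
  · ext1 X
    simp [symbolAct]

variable (θ) in
/-- The action of `m` with inverse `n`, as a linear map. -/
def symbolActL (m n : B × ℂ × (G →L[ℝ] G) × (G' →L[ℝ] G')) :
    (F × B × (G →L[ℝ] B) × (G' →L[ℝ] B)) →L[ℝ] F × B × (G →L[ℝ] B) × (G' →L[ℝ] B) :=
  LinearMap.toContinuousLinearMap
    { toFun := symbolAct θ m n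
      map_add' := fun x y => by
        refine Prod.ext ?_ (Prod.ext ?_ (Prod.ext ?_ ?_))
        · simp [symbolAct]
        · simp [symbolAct, mul_add, add_mul]
        · ext1 X
          simp [symbolAct, mul_add, add_mul]
        · ext1 X
          simp [symbolAct, mul_add, add_mul]
      map_smul' := fun c x => by
        refine Prod.ext ?_ (Prod.ext ?_ (Prod.ext ?_ ?_))
        · have h : θ n.1 (c • x.1) = c • θ n.1 x.1 := ((θ n.1).restrictScalars ℝ).map_smul c x.1
          change m.2.1 • θ n.1 (c • x.1) = c • m.2.1 • θ n.1 x.1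
          rw [h, smul_comm]
        · simp [symbolAct]
        · ext1 X
          simp [symbolAct]
        · ext1 X
          simp [symbolAct] }

/-- Keeping `m` and its inverse `n` as independent arguments leaves only products, compositions and
`θ` to check; the inverse is substituted afterwards. -/
theorem contDiff_symbolAct (hθ : ∀ x, ContDiff ℝ ω fun b => θ b x)
    (x : F × B × (G →L[ℝ] B) × (G' →L[ℝ] B)) :
    ContDiff ℝ ω fun p : (B × ℂ × (G →L[ℝ] G) × (G' →L[ℝ] G')) ×
      (B × ℂ × (G →L[ℝ] G) × (G' →L[ℝ] G')) => symbolAct θ p.1 p.2 x := by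
  have h3 : ContDiff ℝ ω fun p : (B × ℂ × (G →L[ℝ] G) × (G' →L[ℝ] G')) ×
      (B × ℂ × (G →L[ℝ] G) × (G' →L[ℝ] G')) =>
      ContinuousLinearMap.mulLeftRight ℝ B p.1.1 p.2.1 :=
    ((ContinuousLinearMap.mulLeftRight ℝ B).contDiff.comp (by fun_prop)).clm_apply (by fun_prop)
  refine ContDiff.prodMk ?_ (ContDiff.prodMk ?_ (ContDiff.prodMk ?_ ?_))
  · exact ContDiff.smul (by fun_prop) ((hθ x.1).comp (by fun_prop))
  · exact ContDiff.mul (ContDiff.mul (by fun_prop) contDiff_const) (by fun_prop)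
  · exact h3.clm_comp (contDiff_const.clm_comp (by fun_prop))
  · exact h3.clm_comp (contDiff_const.clm_comp (by fun_prop))

theorem contDiffAt_symbolAct_inverse (hθ : ∀ x, ContDiff ℝ ω fun b => θ b x)
    (x : F × B × (G →L[ℝ] B) × (G' →L[ℝ] B))
    (m : (B × ℂ × (G →L[ℝ] G) × (G' →L[ℝ] G'))ˣ) :
    ContDiffAt ℝ ω (fun m : B × ℂ × (G →L[ℝ] G) × (G' →L[ℝ] G') =>
      symbolAct θ m (Ring.inverse m) x) m :=
  (contDiff_symbolAct hθ x).contDiffAt.comp (m : B × ℂ × (G →L[ℝ] G) × (G' →L[ℝ] G'))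
    (contDiffAt_id.prodMk (contDiffAt_ringInverse ℝ m))

variable [NormedAddCommGroup U] [NormedSpace ℝ U] [FiniteDimensional ℝ U]

/-- A smooth family of symbols in one orbit is, locally near some point, the image of a smooth
family in the group. -/
theorem exists_smooth_lift_symbolAct (hθ : ∀ x, ContDiff ℝ ω fun b => θ b x)
    (hθm : ∀ a b x, θ (a * b) x = θ b (θ a x)) (hθ1 : ∀ x, θ 1 x = x)
    (x₀ : F × B × (G →L[ℝ] B) × (G' →L[ℝ] B)) {O : Set U} (hO : IsOpen O) (hne : O.Nonempty)
    {W : U → F × B × (G →L[ℝ] B) × (G' →L[ℝ] B)} (hW : ∀ u ∈ O, ContDiffAt ℝ ∞ W u)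
    (horb : ∀ u ∈ O, ∃ m : (B × ℂ × (G →L[ℝ] G) × (G' →L[ℝ] G'))ˣ, W u = symbolAct θ m ↑m⁻¹ x₀) :
    ∃ O' ⊆ O, IsOpen O' ∧ O'.Nonempty ∧ ∃ γ : U → B × ℂ × (G →L[ℝ] G) × (G' →L[ℝ] G'),
      ∀ u ∈ O', ContDiffAt ℝ ∞ γ u ∧ ∃ m : (B × ℂ × (G →L[ℝ] G) × (G' →L[ℝ] G'))ˣ,
        γ u = m ∧ W u = symbolAct θ m ↑m⁻¹ x₀ := by
  obtain ⟨O', hsub, hO', hne', γ, hγ⟩ := exists_smooth_lift_of_orbit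
    (o := fun m : B × ℂ × (G →L[ℝ] G) × (G' →L[ℝ] G') => symbolAct θ m (Ring.inverse m) x₀)
    (ρ := fun m => symbolActL θ (m : B × ℂ × (G →L[ℝ] G) × (G' →L[ℝ] G')) ↑m⁻¹)
    (contDiffAt_symbolAct_inverse hθ x₀)
    (fun g h => by
      rw [Ring.inverse_unit, Ring.inverse_unit, mul_inv_rev, Units.val_mul, Units.val_mul,
        symbolAct_mul hθm]
      rfl)
    (fun g x => by
      change symbolAct θ _ _ (symbolAct θ _ _ x) = x
      rw [← symbolAct_mul hθm, inv_inv, Units.inv_mul, symbolAct_one hθ1])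
    hO hne hW (fun u hu => by
      obtain ⟨m, hm⟩ := horb u hu
      exact ⟨m, by rw [hm, Ring.inverse_unit]⟩)
  refine ⟨O', hsub, hO', hne', γ, fun u hu => ?_⟩
  obtain ⟨h1, ⟨m, hm⟩, h2⟩ := hγ u hu
  refine ⟨h1, m, hm.symm, ?_⟩
  rw [← h2, ← hm, Ring.inverse_unit]

end SymbolAction

end

section

/-! ### From pointwise to smooth conjugation. -/

section Abstract

variable {B F U : Type*} [NormedRing B] [NormedAlgebra ℝ B] [FiniteDimensional ℝ B]
  [NormedAddCommGroup F] [NormedSpace ℂ F] [FiniteDimensional ℂ F]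
  [NormedAddCommGroup U] [NormedSpace ℝ U]
  {θ : B → F →L[ℂ] F}

/-- Since `a` is invertible, `L ∘ l` already covers the range of `L`; the second description of `L ∘
l`, with `n` invertible, then identifies this range through `g'`. -/
theorem range_eq_conj_of_param {G : Submodule ℝ B} {L : U →L[ℝ] B} {l : G →L[ℝ] U} {g g' : Bˣ}
    {a n : (G →L[ℝ] G)ˣ} (h : ∀ X : G, L (l X) = (g : B) * ((a : G →L[ℝ] G) X : B) * (↑g⁻¹ : B))
    (h' : ∀ X : G, L (l X) = (g' : B) * ((n : G →L[ℝ] G) X : B) * (↑g'⁻¹ : B))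
    (hr : Set.range L = (fun A : B => (g : B) * A * (↑g⁻¹ : B)) '' G) :
    Set.range L = (fun A : B => (g' : B) * A * (↑g'⁻¹ : B)) '' G := by
  have hinv : ∀ (a : (G →L[ℝ] G)ˣ) (X : G), (a : G →L[ℝ] G) ((↑a⁻¹ : G →L[ℝ] G) X) = X := by
    intro a X
    rw [← mul_apply_eq_comp, Units.mul_inv]
    rfl
  apply Set.Subset.antisymm
  · rw [hr]
    rintro _ ⟨A, hA, rfl⟩
    refine ⟨_, ((n : G →L[ℝ] G) ((↑a⁻¹ : G →L[ℝ] G) ⟨A, hA⟩)).2, ?_⟩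
    beta_reduce
    rw [← h', h, hinv]
  · rintro _ ⟨A, hA, rfl⟩
    refine ⟨l ((↑n⁻¹ : G →L[ℝ] G) ⟨A, hA⟩), ?_⟩
    rw [h', hinv]

variable [FiniteDimensional ℝ U]

/-- If a smooth family of forms, projections and subspaces consists of conjugates of the given
ones, then locally near some point the conjugation can be done by a smooth family. -/
theorem exists_smooth_conjugating_family (hθ : ∀ x, ContDiff ℝ ω fun b => θ b x)
    (hθm : ∀ a b x, θ (a * b) x = θ b (θ a x)) (hθ1 : ∀ x, θ 1 x = x)
    (form : F) (e : B) (G G' : Submodule ℝ B) {O : Set U} (hO : IsOpen O) (hne : O.Nonempty)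
    {P : U → B} {L L' : U → U →L[ℝ] B} (hP : ∀ u ∈ O, ContDiffAt ℝ ∞ P u)
    (hL : ∀ u ∈ O, ContDiffAt ℝ ∞ L u) (hL' : ∀ u ∈ O, ContDiffAt ℝ ∞ L' u)
    (h : ∀ u ∈ O, ∃ (g : Bˣ) (s : ℂˣ), (s : ℂ) • θ (↑g⁻¹ : B) form = form ∧
      P u = (g : B) * e * (↑g⁻¹ : B) ∧
      Set.range (L u) = (fun A : B => (g : B) * A * (↑g⁻¹ : B)) '' G ∧
      Set.range (L' u) = (fun A : B => (g : B) * A * (↑g⁻¹ : B)) '' G') :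
    ∃ O' ⊆ O, IsOpen O' ∧ O'.Nonempty ∧ ∃ (γ : U → B) (σ : U → ℂ), ∀ u ∈ O',
      ContDiffAt ℝ ∞ γ u ∧ ContDiffAt ℝ ∞ σ u ∧ ∃ (g : Bˣ) (s : ℂˣ), γ u = g ∧ σ u = s ∧
      (s : ℂ) • θ (↑g⁻¹ : B) form = form ∧
      P u = (g : B) * e * (↑g⁻¹ : B) ∧
      Set.range (L u) = (fun A : B => (g : B) * A * (↑g⁻¹ : B)) '' G ∧
      Set.range (L' u) = (fun A : B => (g : B) * A * (↑g⁻¹ : B)) '' G' := by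
  obtain ⟨u₀, hu₀⟩ := hne
  obtain ⟨l, hl⟩ := exists_lift_conj_subspace G (hL u₀ hu₀).continuousAt
    (by obtain ⟨g, s, h1, h2, h3, h4⟩ := h u₀ hu₀; exact ⟨g, h3⟩)
  obtain ⟨l', hl'⟩ := exists_lift_conj_subspace G' (hL' u₀ hu₀).continuousAt
    (by obtain ⟨g, s, h1, h2, h3, h4⟩ := h u₀ hu₀; exact ⟨g, h4⟩)
  obtain ⟨O₁, hsub, hO₁, hu₁⟩ := mem_nhds_iff.1 ((hl.and hl').and (hO.mem_nhds hu₀))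
  -- Through `l` and `l'` the two subspaces become points of fixed vector spaces, at the price of
  -- enlarging the group by the linear automorphisms of `G` and `G'`. The form component of `W` is
  -- constant.
  obtain ⟨O', hO'sub, hO', hne', γ, hγ⟩ := exists_smooth_lift_symbolAct hθ hθm hθ1
    ((form, e, G.subtypeL, G'.subtypeL) : F × B × (G →L[ℝ] B) × (G' →L[ℝ] B)) hO₁ ⟨u₀, hu₁⟩
    (W := fun u => (form, P u, (L u) ∘L l, (L' u) ∘L l'))
    (fun u hu => by
      have hu' := (hsub hu).2
      exact contDiffAt_const.prodMk ((hP u hu').prodMk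
        (((hL u hu').clm_comp contDiffAt_const).prodMk ((hL' u hu').clm_comp contDiffAt_const))))
    (fun u hu => by
      obtain ⟨g, s, h1, h2, h3, h4⟩ := h u (hsub hu).2
      obtain ⟨a, ha⟩ := (hsub hu).1.1 g h3
      obtain ⟨a', ha'⟩ := (hsub hu).1.2 g h4
      -- The action precomposes a parametrization with the inverse of the group element, hence `a⁻¹`
      -- and `a'⁻¹`.
      refine ⟨MulEquiv.prodUnits.symm (g, MulEquiv.prodUnits.symm (s, MulEquiv.prodUnits.symm
        (a⁻¹, a'⁻¹))), Prod.ext h1.symm (Prod.ext h2 (Prod.ext ?_ ?_))⟩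
      · ext1 X
        exact ha X
      · ext1 X
        exact ha' X)
  refine ⟨O', fun u hu => (hsub (hO'sub hu)).2, hO', hne', fun u => (γ u).1, fun u => (γ u).2.1,
    fun u hu => ?_⟩
  obtain ⟨hγu, m, hm, hW⟩ := hγ u hu
  obtain ⟨g, s, h1, h2, h3, h4⟩ := h u (hsub (hO'sub hu)).2
  obtain ⟨a, ha⟩ := (hsub (hO'sub hu)).1.1 g h3
  obtain ⟨a', ha'⟩ := (hsub (hO'sub hu)).1.2 g h4
  let m₁ := MulEquiv.prodUnits m
  let m₂ := MulEquiv.prodUnits m₁.2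
  let m₃ := MulEquiv.prodUnits m₂.2
  have hW3 : (L u) ∘L l = _ := congrArg (fun x => x.2.2.1) hW
  have hW4 : (L' u) ∘L l' = _ := congrArg (fun x => x.2.2.2) hW
  refine ⟨hγu.fst, hγu.snd.fst, m₁.1, m₂.1, by beta_reduce; rw [hm]; rfl,
    by beta_reduce; rw [hm]; rfl,
    (congrArg (fun x => x.1) hW).symm, congrArg (fun x => x.2.1) hW,
    range_eq_conj_of_param (n := m₃.1⁻¹) ha (fun X => DFunLike.congr_fun hW3 X) h3,
    range_eq_conj_of_param (n := m₃.2⁻¹) ha' (fun X => DFunLike.congr_fun hW4 X) h4⟩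

end Abstract

/-! ### Smooth choice of frames in a leaf chart. -/

section FibreFrame

variable {V : Type*} [NormedAddCommGroup V] [NormedSpace ℂ V] [FiniteDimensional ℂ V]

variable (V) in
/-- The pull-back of bilinear forms by an endomorphism. -/
def formPullback (h : V →L[ℂ] V) : (V →L[ℂ] V →L[ℂ] ℂ) →L[ℂ] (V →L[ℂ] V →L[ℂ] ℂ) :=
  (ContinuousLinearMap.compL ℂ V (V →L[ℂ] ℂ) (V →L[ℂ] ℂ)
    ((ContinuousLinearMap.compL ℂ V V ℂ).flip h)) ∘L
    ((ContinuousLinearMap.compL ℂ V V (V →L[ℂ] ℂ)).flip h)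

theorem formPullback_apply (h : V →L[ℂ] V) (x : V →L[ℂ] V →L[ℂ] ℂ) (v w : V) :
    formPullback V h x v w = x (h v) (h w) := rfl

theorem contDiff_formPullback (x : V →L[ℂ] V →L[ℂ] ℂ) :
    ContDiff ℝ ω fun h : V →L[ℂ] V => formPullback V h x := by
  have h4 : ∀ v, ContDiff ℝ ω fun h : V →L[ℂ] V => h v := by
    intro v
    let ev : (V →L[ℂ] V) →L[ℝ] V := (ContinuousLinearMap.apply ℂ V v).restrictScalars ℝ
    exact ev.contDiff
  let ev : V →L[ℝ] V →L[ℝ] ℂ :=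
    (ContinuousLinearMap.restrictScalarsL ℂ V ℂ ℝ ℝ).comp (x.restrictScalars ℝ)
  refine contDiff_iff_contDiffAt.2 fun p => ?_
  exact contDiffAt_clm_of_apply fun v => contDiffAt_clm_of_apply fun w =>
    ((ev.contDiff.comp (h4 v)).clm_apply (h4 w)).contDiffAt

variable {r : ℕ} {S : CRSymbol V r} {U : Type*} [NormedAddCommGroup U] [NormedSpace ℝ U]

/-- The real space of continuous linear maps that underlies a space of endomorphisms. -/
def clmSubmodule (g : Submodule ℂ (Module.End ℂ V)) : Submodule ℝ (V →L[ℂ] V) where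
  carrier := {A | (A : V →ₗ[ℂ] V) ∈ g}
  add_mem' := fun hA hB => g.add_mem hA hB
  zero_mem' := g.zero_mem
  smul_mem' := fun c A hA => by
    have := g.smul_mem (c : ℂ) hA
    exact this

theorem exists_projection_symbol (S : CRSymbol V r) :
    ∃ e : V →L[ℂ] V, (∀ x ∈ S.Vm, e x = x) ∧ ∀ x ∈ S.Vp, e x = 0 :=
  ⟨(S.Vm.subtype ∘ₗ S.Vm.projectionOnto S.Vp S.splitting).toContinuousLinearMap,
    fun x hx => congrArg Subtype.val (Submodule.projectionOnto_apply_left S.splitting ⟨x, hx⟩),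
    fun _ hx => congrArg Subtype.val
      ((Submodule.projectionOnto_apply_eq_zero_iff S.splitting).2 hx)⟩

theorem range_coe_eq_iff {L : U → V →L[ℂ] V} {g : (V →L[ℂ] V)ˣ}
    {g2 : Submodule ℂ (Module.End ℂ V)} :
    ((Set.range fun v : U => ((L v : V →L[ℂ] V) : V →ₗ[ℂ] V)) =
      (fun A : Module.End ℂ V => ((g : V →L[ℂ] V) : V →ₗ[ℂ] V) * A *
        ((Ring.inverse (g : V →L[ℂ] V) : V →L[ℂ] V) : V →ₗ[ℂ] V)) '' g2) ↔
    Set.range L = (fun A => (g : V →L[ℂ] V) * A * (↑g⁻¹ : V →L[ℂ] V)) '' (clmSubmodule g2) := by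
  have hinj : Function.Injective fun A : V →L[ℂ] V => (A : V →ₗ[ℂ] V) :=
    ContinuousLinearMap.coe_injective
  rw [← (Set.image_injective.2 hinj).eq_iff, ← Set.range_comp, Ring.inverse_unit, Set.image_image]
  have : (fun A : Module.End ℂ V => ((g : V →L[ℂ] V) : V →ₗ[ℂ] V) * A *
        ((↑g⁻¹ : V →L[ℂ] V) : V →ₗ[ℂ] V)) '' g2 =
      (fun A : V →L[ℂ] V => (((g : V →L[ℂ] V) * A * (↑g⁻¹ : V →L[ℂ] V) : V →L[ℂ] V) :
        V →ₗ[ℂ] V)) '' (clmSubmodule g2) := by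
    apply Set.Subset.antisymm
    · rintro _ ⟨A, hA, rfl⟩
      exact ⟨LinearMap.toContinuousLinearMap A, hA, rfl⟩
    · rintro _ ⟨A, hA, rfl⟩
      exact ⟨A, hA, rfl⟩
  rw [this]
  rfl

/-- A linear map is determined by its values on the images of `Vm` and `Vp`, so the two conditions
on `P u` amount to `P u` being conjugate to the model projection `e`. This puts the data at `u` in
the orbit of the model data. -/
theorem isFibreFrame_iff {P : U → V →L[ℂ] V} {u : U} {e : V →L[ℂ] V} (hem : ∀ x ∈ S.Vm, e x = x)
    (hep : ∀ x ∈ S.Vp, e x = 0) {form : V →L[ℂ] V →L[ℂ] ℂ} (hform : ∀ x y, form x y = S.form x y)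
    (g : (V →L[ℂ] V)ˣ) (s : ℂˣ) :
    IsFibreFrame S P u g s ↔ (s : ℂ) • formPullback V (↑g⁻¹ : V →L[ℂ] V) form = form ∧
      P u = (g : V →L[ℂ] V) * e * (↑g⁻¹ : V →L[ℂ] V) ∧
      Set.range (fun v => fderiv ℝ P u v * P u) =
        (fun A => (g : V →L[ℂ] V) * A * (↑g⁻¹ : V →L[ℂ] V)) '' (clmSubmodule S.g2) ∧
      Set.range (fun v => fderiv ℝ (fun u => 1 - P u) u v * (1 - P u)) =
        (fun A => (g : V →L[ℂ] V) * A * (↑g⁻¹ : V →L[ℂ] V)) '' (clmSubmodule S.gm2) := by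
  have hgi : ∀ x, (g : V →L[ℂ] V) ((↑g⁻¹ : V →L[ℂ] V) x) = x := fun x => by
    rw [← mul_apply_eq_comp, Units.mul_inv]; rfl
  have hig : ∀ x, (↑g⁻¹ : V →L[ℂ] V) ((g : V →L[ℂ] V) x) = x := fun x => by
    rw [← mul_apply_eq_comp, Units.inv_mul]; rfl
  constructor
  · intro h
    refine ⟨?_, ?_, range_coe_eq_iff.1 h.g2, range_coe_eq_iff.1 h.gm2⟩
    · ext x y
      have h1 := h.form ((↑g⁻¹ : V →L[ℂ] V) x) ((↑g⁻¹ : V →L[ℂ] V) y)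
      rw [hgi, hgi] at h1
      simp only [smul_apply, formPullback_apply, hform, smul_eq_mul]
      exact h1.symm
    · ext x
      obtain ⟨a, ha, b, hb, hab⟩ := Submodule.mem_sup.1
        (show (↑g⁻¹ : V →L[ℂ] V) x ∈ S.Vm ⊔ S.Vp by rw [S.splitting.sup_eq_top]; trivial)
      have hx : x = (g : V →L[ℂ] V) a + (g : V →L[ℂ] V) b := by rw [← map_add, hab, hgi]
      rw [mul_apply_eq_comp, mul_apply_eq_comp, ← hab, map_add e, hem a ha, hep b hb, add_zero,
        hx, map_add, h.minus a ha, h.plus b hb, add_zero]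
  · rintro ⟨h1, h2, h3, h4⟩
    refine ⟨g.isUnit, s.ne_zero, fun x y => ?_, fun x hx => ?_, fun x hx => ?_,
      range_coe_eq_iff.2 h3, range_coe_eq_iff.2 h4⟩
    · have := DFunLike.congr_fun (DFunLike.congr_fun h1 ((g : V →L[ℂ] V) x)) ((g : V →L[ℂ] V) y)
      simp only [smul_apply, formPullback_apply, hform, smul_eq_mul, hig] at this
      exact this.symm
    · rw [h2, mul_apply_eq_comp, mul_apply_eq_comp, hig, hem x hx]
    · rw [h2, mul_apply_eq_comp, mul_apply_eq_comp, hig, hep x hx, map_zero]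

/-- Adapted frames over the points of a leaf chart can be chosen smoothly near some point. -/
theorem exists_smooth_isFibreFrame [FiniteDimensional ℝ U] {P : U → V →L[ℂ] V} {O : Set U}
    (hO : IsOpen O) (hne : O.Nonempty) (hP : ∀ u ∈ O, ContDiffAt ℝ ∞ P u)
    (h : ∀ u ∈ O, ∃ g s, IsFibreFrame S P u g s) :
    ∃ O' ⊆ O, IsOpen O' ∧ O'.Nonempty ∧ ∃ (γ : U → V →L[ℂ] V) (σ : U → ℂ), ∀ u ∈ O',
      ContDiffAt ℝ ∞ γ u ∧ ContDiffAt ℝ ∞ σ u ∧ IsFibreFrame S P u (γ u) (σ u) := by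
  obtain ⟨e, hem, hep⟩ := exists_projection_symbol S
  let form : V →L[ℂ] V →L[ℂ] ℂ :=
    LinearMap.toContinuousLinearMap (LinearMap.toContinuousLinearMap.toLinearMap ∘ₗ S.form)
  have hform : ∀ x y, form x y = S.form x y := fun x y => rfl
  have hLs : ∀ {Q : U → V →L[ℂ] V} {u : U}, ContDiffAt ℝ ∞ Q u →
      ContDiffAt ℝ ∞ (fun u => ((ContinuousLinearMap.mul ℝ (V →L[ℂ] V)).flip (Q u)) ∘L
        fderiv ℝ Q u) u := by
    intro Q u hQ
    exact (((ContinuousLinearMap.mul ℝ (V →L[ℂ] V)).flip.contDiff.contDiffAt.comp u hQ).clm_comp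
      (hQ.fderiv_right (m := ∞) (by simp)))
  obtain ⟨O', hsub, hO', hne', γ, σ, hγ⟩ := exists_smooth_conjugating_family
    (θ := formPullback V) contDiff_formPullback (fun a b x => by ext v w; rfl)
    (fun x => by ext v w; rfl) form e (clmSubmodule S.g2) (clmSubmodule S.gm2) hO hne hP
    (L := fun u => ((ContinuousLinearMap.mul ℝ (V →L[ℂ] V)).flip (P u)) ∘L fderiv ℝ P u)
    (L' := fun u => ((ContinuousLinearMap.mul ℝ (V →L[ℂ] V)).flip (1 - P u)) ∘L
      fderiv ℝ (fun u => 1 - P u) u)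
    (fun u hu => hLs (hP u hu)) (fun u hu => hLs (contDiffAt_const.sub (hP u hu)))
    (fun u hu => by
      obtain ⟨g, s, hg⟩ := h u hu
      obtain ⟨g, rfl⟩ := hg.isUnit
      exact ⟨g, Units.mk0 s hg.ne_zero,
        (isFibreFrame_iff hem hep hform g (Units.mk0 s hg.ne_zero)).1 hg⟩)
  refine ⟨O', hsub, hO', hne', γ, σ, fun u hu => ?_⟩
  obtain ⟨h1, h2, g, s, hg, hs, h3⟩ := hγ u hu
  rw [hg, hs]
  exact ⟨h1, h2, (isFibreFrame_iff hem hep hform g s).2 h3⟩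

end FibreFrame

end

section

/-! ### Frames as elements of a group. -/

section Rel

variable {k : ℕ} {V : Type*} [NormedAddCommGroup V] [NormedSpace ℂ V] [FiniteDimensional ℂ V]
  {D : Submodule ℂ (CModel k)}

/-- The endomorphism `φ⁻¹ ∘ ψ` of `𝔤₋`, as a continuous linear map. -/
def GrFrame.relL (φ ψ : GrFrame V D) : (V × ℂ) →L[ℂ] (V × ℂ) :=
  LinearMap.toContinuousLinearMap (φ.rel ψ)

theorem GrFrame.relL_apply (φ ψ : GrFrame V D) (x : V × ℂ) :
    φ.relL ψ x = (φ.deg1.symm (ψ.deg1 x.1), φ.deg2.symm (ψ.deg2 x.2)) := rfl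

theorem GrFrame.relL_mul (φ ψ χ : GrFrame V D) : φ.relL ψ * ψ.relL χ = φ.relL χ := by
  refine ContinuousLinearMap.ext fun x => ?_
  simp [GrFrame.relL_apply]

theorem GrFrame.relL_self (φ : GrFrame V D) : φ.relL φ = 1 := by
  refine ContinuousLinearMap.ext fun x => ?_
  simp [GrFrame.relL_apply]

theorem GrFrame.inverse_relL (φ ψ : GrFrame V D) : Ring.inverse (φ.relL ψ) = ψ.relL φ := by
  let w : ((V × ℂ) →L[ℂ] (V × ℂ))ˣ :=
    ⟨φ.relL ψ, ψ.relL φ, by rw [relL_mul, relL_self], by rw [relL_mul, relL_self]⟩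
  exact Ring.inverse_unit w

theorem GrFrame.isUnit_relL (φ ψ : GrFrame V D) : IsUnit (φ.relL ψ) :=
  ⟨⟨φ.relL ψ, ψ.relL φ, by rw [relL_mul, relL_self], by rw [relL_mul, relL_self]⟩, rfl⟩

theorem GrFrame.comp_rel_self (φ ψ : GrFrame V D) :
    φ.comp (ψ.deg1.trans φ.deg1.symm) (ψ.deg2.trans φ.deg2.symm) = ψ := by
  rcases ψ with ⟨a, b⟩
  simp only [GrFrame.comp, GrFrame.mk.injEq]
  exact ⟨by ext; simp, by ext; simp⟩

theorem GrFrame.relL_comp_rel (χ φ ψ ψ' : GrFrame V D) :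
    χ.relL (φ.comp (ψ'.deg1.trans ψ.deg1.symm) (ψ'.deg2.trans ψ.deg2.symm)) =
      χ.relL φ * ψ.relL ψ' := by
  refine ContinuousLinearMap.ext fun x => ?_
  rfl

end Rel

/-! ### Curves of adapted frames and the modified symbol. -/

variable {d k r : ℕ} {CM : Type*} [TopologicalSpace CM] [ChartedSpace (CModel d) CM]
  [IsManifold 𝓘(ℂ, CModel d) ω CM]
  {N : Type*} [TopologicalSpace N] [ChartedSpace (CModel k) N] [IsManifold 𝓘(ℂ, CModel k) ω N]
  {π : CM → N} {τ : CM → CM} {Hc : CM → Submodule ℂ (CModel d)}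
  {V : Type*} [NormedAddCommGroup V] [NormedSpace ℂ V] [FiniteDimensional ℂ V] {S : CRSymbol V r}
  {γ : N} {g₀ : Submodule ℂ (Module.End ℂ (V × ℂ))}

/-- The logarithmic derivatives of curves of adapted frames belong to the modified symbol. -/
theorem mem_of_curve (hmod : ∀ ψ ∈ P0 k S τ Hc π γ, modSymbol k S τ Hc π γ ψ = g₀)
    {c : ℝ → CM × GrFrame V (leafD k τ Hc π γ)} {ε : ℝ} (hε : 0 < ε)
    (hc : ∀ t ∈ Set.Ioo (-ε) ε, c t ∈ P0 k S τ Hc π γ)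
    (hsm : ContMDiffOn 𝓘(ℝ, ℝ) 𝓘(ℝ, CModel d) ∞ (fun t => (c t).1) (Set.Ioo (-ε) ε))
    {χ : GrFrame V (leafD k τ Hc π γ)}
    (hR : ContDiffOn ℝ ∞ (fun t => χ.relL (c t).2) (Set.Ioo (-ε) ε))
    {A : (V × ℂ) →L[ℂ] (V × ℂ)} (hd : HasDerivAt (fun t => χ.relL (c t).2) A 0) :
    (c 0).2.relL χ * A ∈ clmSubmodule g₀ := by
  have h0 : (0 : ℝ) ∈ Set.Ioo (-ε) ε := ⟨by linarith, hε⟩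
  -- Changing the reference frame multiplies the curve on the left by a constant, which does not
  -- change its logarithmic derivative.
  have hrel : (fun t => (c 0).2.relL (c t).2) = fun t => (c 0).2.relL χ * χ.relL (c t).2 := by
    funext t
    rw [GrFrame.relL_mul]
  have hR' : ContDiffOn ℝ ∞ (fun t => (c 0).2.relL (c t).2) (Set.Ioo (-ε) ε) := by
    rw [hrel]
    exact contDiffOn_const.mul hR
  have hd' : HasDerivAt (fun t => (c 0).2.relL (c t).2) ((c 0).2.relL χ * A) 0 := by
    rw [hrel]
    exact hd.const_mul _
  have hmem : (((c 0).2.relL χ * A : (V × ℂ) →L[ℂ] (V × ℂ)) : (V × ℂ) →ₗ[ℂ] (V × ℂ)) ∈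
      modSymbol k S τ Hc π γ (c 0) := by
    refine ⟨ε, hε, c, hc, rfl, hsm, fun x => ?_, fun x => ?_⟩
    · let ev : ((V × ℂ) →L[ℂ] (V × ℂ)) →L[ℝ] V × ℂ :=
        (ContinuousLinearMap.apply ℂ (V × ℂ) x).restrictScalars ℝ
      exact ev.contDiff.comp_contDiffOn hR'
    · let ev : ((V × ℂ) →L[ℂ] (V × ℂ)) →L[ℝ] V × ℂ :=
        (ContinuousLinearMap.apply ℂ (V × ℂ) x).restrictScalars ℝ
      exact ev.hasFDerivAt.comp_hasDerivAt (0 : ℝ) hd'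
  rw [hmod _ (hc 0 h0)] at hmem
  exact hmem

/-- The elements of the modified symbol are logarithmic derivatives of curves of adapted frames. -/
theorem exists_curve (hmod : ∀ ψ ∈ P0 k S τ Hc π γ, modSymbol k S τ Hc π γ ψ = g₀)
    {ψ : CM × GrFrame V (leafD k τ Hc π γ)} (hψ : ψ ∈ P0 k S τ Hc π γ)
    {x : (V × ℂ) →L[ℂ] (V × ℂ)} (hx : x ∈ clmSubmodule g₀) :
    ∃ c : ℝ → CM × GrFrame V (leafD k τ Hc π γ), ∃ ε : ℝ, 0 < ε ∧
      (∀ t ∈ Set.Ioo (-ε) ε, c t ∈ P0 k S τ Hc π γ) ∧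
      ContMDiffOn 𝓘(ℝ, ℝ) 𝓘(ℝ, CModel d) ∞ (fun t => (c t).1) (Set.Ioo (-ε) ε) ∧ c 0 = ψ ∧
      ContDiffOn ℝ ∞ (fun t => ψ.2.relL (c t).2) (Set.Ioo (-ε) ε) ∧
      HasDerivAt (fun t => ψ.2.relL (c t).2) x 0 := by
  have hx' : (x : (V × ℂ) →ₗ[ℂ] (V × ℂ)) ∈ modSymbol k S τ Hc π γ ψ := by
    rw [hmod ψ hψ]; exact hx
  obtain ⟨ε, hε, c, hc, hc0, hsm, hR, hd⟩ := hx'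
  exact ⟨c, ε, hε, hc, hsm, hc0, contDiffOn_clm_of_apply hR, hasDerivAt_clm_of_apply hd⟩

/-- The modified symbol is invariant under the automorphisms of the symbol that relate two adapted
frames at the same point. -/
theorem conj_relL_mem (hπ : ContMDiff 𝓘(ℂ, CModel d) 𝓘(ℂ, CModel k) ω π)
    (hs : ∀ q, Function.Surjective (diff ℂ (CModel d) (CModel k) π q))
    (hH : HasHolSections Hc) (hbar : HasHolSections (barDist τ Hc))
    (hmod : ∀ ψ ∈ P0 k S τ Hc π γ, modSymbol k S τ Hc π γ ψ = g₀) {q : CM} (hq : π q = γ)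
    {φ φ' : GrFrame V (leafD k τ Hc π γ)} (hφ : IsAdapted k S τ Hc π γ q φ)
    (hφ' : IsAdapted k S τ Hc π γ q φ') {x : (V × ℂ) →L[ℂ] (V × ℂ)}
    (hx : x ∈ clmSubmodule g₀) : φ.relL φ' * x * φ'.relL φ ∈ clmSubmodule g₀ := by
  -- A curve through `φ'` with logarithmic derivative `x`, composed on the right with the
  -- automorphism `φ'⁻¹ ∘ φ`, is a curve of adapted frames through `φ`. With `κ = φ⁻¹ ∘ φ'`, its
  -- logarithmic derivative is `κ x κ⁻¹`.
  obtain ⟨c, ε, hε, hc, hsm, hc0, hR, hd⟩ := exists_curve hmod (ψ := (q, φ')) ⟨hq, hφ'⟩ hx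
  have h := mem_of_curve hmod (χ := φ') (c := fun t => ((c t).1, (c t).2.comp
      (φ.deg1.trans φ'.deg1.symm) (φ.deg2.trans φ'.deg2.symm))) hε
    (fun t ht => ⟨(hc t ht).1, IsAdapted.comp_rel hπ hs hH hbar hq hφ' hφ (hc t ht).2⟩) hsm
    (by
      simp only [GrFrame.relL_comp_rel]
      exact hR.mul contDiffOn_const) (A := x * φ'.relL φ)
    (by
      simp only [GrFrame.relL_comp_rel]
      exact hd.mul_const _)
  simp only [hc0, GrFrame.comp_rel_self] at h
  rwa [mul_assoc]

/-- The modified symbol consists of derivations of the Heisenberg algebra. -/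
theorem modSymbol_subset_csp (hπ : ContMDiff 𝓘(ℂ, CModel d) 𝓘(ℂ, CModel k) ω π)
    (hs : ∀ q, Function.Surjective (diff ℂ (CModel d) (CModel k) π q))
    (hH : HasHolSections Hc) (hbar : HasHolSections (barDist τ Hc))
    {ψ : CM × GrFrame V (leafD k τ Hc π γ)} (hψ : ψ ∈ P0 k S τ Hc π γ) {A : Module.End ℂ (V × ℂ)}
    (hA : A ∈ modSymbol k S τ Hc π γ ψ) : A ∈ csp S := by
  obtain ⟨ε, hε, c, hc, hc0, hsm, hR, hd⟩ := hA
  have hI : Set.Ioo (-ε) ε ∈ 𝓝 (0 : ℝ) := Ioo_mem_nhds (by linarith) hε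
  have hrel0 : ∀ x, ψ.2.rel (c 0).2 x = x := by
    intro x
    rw [hc0]
    exact DFunLike.congr_fun (GrFrame.relL_self ψ.2) x
  refine ⟨fun v => ?_, fun z => ?_, fun x y => ?_⟩
  · have h1 : HasDerivAt (fun _ : ℝ => (0 : ℂ)) (A (v, 0)).2 0 := by
      have h2 : HasDerivAt (fun t => (ψ.2.rel (c t).2 (v, 0)).2) (A (v, 0)).2 0 :=
        (hd (v, 0)).snd
      refine h2.congr_of_eventuallyEq (Filter.Eventually.of_forall fun t => ?_)
      simp [GrFrame.rel]
    exact h1.unique (hasDerivAt_const _ _)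
  · have h1 : HasDerivAt (fun _ : ℝ => (0 : V)) (A (0, z)).1 0 := by
      have h2 : HasDerivAt (fun t => (ψ.2.rel (c t).2 (0, z)).1) (A (0, z)).1 0 :=
        (hd (0, z)).fst
      refine h2.congr_of_eventuallyEq (Filter.Eventually.of_forall fun t => ?_)
      simp [GrFrame.rel]
    exact h1.unique (hasDerivAt_const _ _)
  · let form : V →L[ℂ] V →L[ℂ] ℂ :=
      LinearMap.toContinuousLinearMap (LinearMap.toContinuousLinearMap.toLinearMap ∘ₗ S.form)
    let formR : V →L[ℝ] V →L[ℝ] ℂ :=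
      (ContinuousLinearMap.restrictScalarsL ℂ V ℂ ℝ ℝ).comp (form.restrictScalars ℝ)
    have hx1 : HasDerivAt (fun t => (ψ.2.rel (c t).2 x).1) (A x).1 0 := (hd x).fst
    have hy1 : HasDerivAt (fun t => (ψ.2.rel (c t).2 y).1) (A y).1 0 := (hd y).fst
    have h1 : HasDerivAt
        (fun t => formR (ψ.2.rel (c t).2 x).1 (ψ.2.rel (c t).2 y).1)
        (formR (A x).1 (ψ.2.rel (c 0).2 y).1 + formR (ψ.2.rel (c 0).2 x).1 (A y).1) 0 :=
      (formR.hasFDerivAt.comp_hasDerivAt (0 : ℝ) hx1).clm_apply hy1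
    have h2 : HasDerivAt (fun t => (0 : V))
      (0 : V) (0 : ℝ) := hasDerivAt_const _ _
    have h3 := h2.prodMk h1
    refine ((hd (heis S x y)).congr_of_eventuallyEq ?_).unique (h3.congr_deriv ?_)
    · filter_upwards [hI] with t ht
      -- The frames along the curve scale the same form; the derivative at `0` of this identity is
      -- the derivation rule for `A`.
      have h4 := form_eq_of_isAdapted hπ hs hH hbar hψ.1 hψ.2 (hc t ht).2 x.1 y.1
      have h5 : ψ.2.rel (c t).2 (heis S x y) =
          (0, ψ.2.deg2.symm ((c t).2.deg2 (S.form x.1 y.1))) := by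
        simp [GrFrame.rel, heis]
      rw [h5, h4, LinearEquiv.symm_apply_apply]
      rfl
    · rw [hrel0, hrel0]
      simp only [heis, Prod.mk_add_mk, add_zero]
      rfl

end

/-! ### Closure of the modified symbol under commutators. -/

section

variable {d k r : ℕ} {CM : Type*} [TopologicalSpace CM] [ChartedSpace (CModel d) CM]
  [IsManifold 𝓘(ℂ, CModel d) ω CM]
  {N : Type*} [TopologicalSpace N] [ChartedSpace (CModel k) N] [IsManifold 𝓘(ℂ, CModel k) ω N]
  {π : CM → N} {τ : CM → CM} {Hc : CM → Submodule ℂ (CModel d)}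
  {V : Type*} [NormedAddCommGroup V] [NormedSpace ℂ V] [FiniteDimensional ℂ V] {S : CRSymbol V r}
  {γ : N} {g₀ : Submodule ℂ (Module.End ℂ (V × ℂ))}
  {U : Type*} [NormedAddCommGroup U] [NormedSpace ℝ U]

/-- There is a smooth family of adapted frames over a part of a leaf chart. -/
theorem IsLeafChart.exists_smooth_frames [FiniteDimensional ℝ U]
    {φ₀ : GrFrame V (leafD k τ Hc π γ)} {f : U → CM} {ρ : CM → U} {O : Set U} {P : U → V →L[ℂ] V}
    (h : IsLeafChart π τ Hc φ₀ f ρ O P) (hne : O.Nonempty)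
    (hπ : ContMDiff 𝓘(ℂ, CModel d) 𝓘(ℂ, CModel k) ω π)
    (hs : ∀ q, Function.Surjective (diff ℂ (CModel d) (CModel k) π q))
    (hH : HasHolSections Hc) (hbar : HasHolSections (barDist τ Hc))
    (hS : HasConstantSymbol k S τ Hc π)
    {q₀ : CM} (hq₀ : π q₀ = γ) (hφ₀ : IsAdapted k S τ Hc π γ q₀ φ₀) :
    ∃ O' ⊆ O, IsOpen O' ∧ O'.Nonempty ∧ ∃ Φ : U → GrFrame V (leafD k τ Hc π γ), ∀ u ∈ O',
      IsAdapted k S τ Hc π γ (f u) (Φ u) ∧ ContDiffAt ℝ ∞ (fun u => φ₀.relL (Φ u)) u := by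
  obtain ⟨O', hsub, hO', hne', g, σ, hg⟩ := exists_smooth_isFibreFrame (S := S) h.isOpen hne
    h.smooth_proj (fun u hu => by
      obtain ⟨φ, hφ⟩ := hS.exists_isAdapted (h.proj u hu)
      exact ⟨_, _, h.isFibreFrame hπ hs hH hbar hq₀ hφ₀ hu hφ⟩)
  have hex : ∀ u, ∃ Φ : GrFrame V (leafD k τ Hc π γ), u ∈ O' →
      IsAdapted k S τ Hc π γ (f u) Φ ∧ ∀ x, φ₀.relL Φ x = (g u x.1, σ u * x.2) := by
    intro u
    by_cases hu : u ∈ O'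
    · have hF := (hg u hu).2.2
      let e : V ≃ₗ[ℂ] V := LinearEquiv.ofBijective (g u : V →ₗ[ℂ] V)
        (ContinuousLinearMap.isUnit_iff_bijective.1 hF.isUnit)
      have he : (e.toContinuousLinearEquiv : V →L[ℂ] V) = g u := by ext x; rfl
      refine ⟨φ₀.comp e (LinearEquiv.smulOfUnit (Units.mk0 (σ u) hF.ne_zero)), fun _ =>
        ⟨h.isAdapted hφ₀ (hsub hu) (by rw [he]; exact hF), fun x => ?_⟩⟩
      rw [GrFrame.relL_apply]
      refine Prod.ext ?_ ?_
      · exact φ₀.deg1.symm_apply_apply _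
      · exact φ₀.deg2.symm_apply_apply _
    -- Outside `O'` the frame is an arbitrary default.
    · exact ⟨φ₀, fun h => absurd h hu⟩
  choose Φ hΦ using hex
  refine ⟨O', hsub, hO', hne', Φ, fun u hu => ⟨(hΦ u hu).1, contDiffAt_clm_of_apply fun x => ?_⟩⟩
  let ev : (V →L[ℂ] V) →L[ℝ] V := (ContinuousLinearMap.apply ℂ V x.1).restrictScalars ℝ
  have h1 : ContDiffAt ℝ ∞ (fun u => (g u x.1, σ u * x.2)) u :=
    (ev.contDiff.contDiffAt.comp u (hg u hu).1).prodMk ((hg u hu).2.1.mul contDiffAt_const)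
  refine h1.congr_of_eventuallyEq ?_
  filter_upwards [hO'.mem_nhds hu] with u' hu' using (hΦ u' hu').2 x

section

variable {φ₀ : GrFrame V (leafD k τ Hc π γ)} {f : U → CM} {ρ : CM → U} {O : Set U}
  {Φ : U → GrFrame V (leafD k τ Hc π γ)}

/-- The logarithmic derivatives of a smooth family of adapted frames belong to the modified
symbol. -/
theorem maurerCartan_mem (hmod : ∀ ψ ∈ P0 k S τ Hc π γ, modSymbol k S τ Hc π γ ψ = g₀)
    (hO : IsOpen O) (hf : ∀ u ∈ O, π (f u) = γ ∧ ContMDiffAt 𝓘(ℝ, U) 𝓘(ℝ, CModel d) ∞ f u)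
    (hΦ : ∀ u ∈ O, IsAdapted k S τ Hc π γ (f u) (Φ u))
    (hΦs : ∀ u ∈ O, ContDiffAt ℝ ∞ (fun u => φ₀.relL (Φ u)) u) {u : U} (hu : u ∈ O) (v : U) :
    Ring.inverse (φ₀.relL (Φ u)) * fderiv ℝ (fun u => φ₀.relL (Φ u)) u v ∈ clmSubmodule g₀ := by
  have hlc : ContDiff ℝ ∞ (fun t : ℝ => u + t • v) := by fun_prop
  have hline : HasDerivAt (fun t : ℝ => u + t • v) v 0 := by
    simpa using ((hasDerivAt_id (0 : ℝ)).smul_const v).const_add u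
  have hev : ∀ᶠ t in 𝓝 (0 : ℝ), u + t • v ∈ O := by
    have : Filter.Tendsto (fun t : ℝ => u + t • v) (𝓝 0) (𝓝 u) := by
      have := hlc.continuous.tendsto 0
      simpa using this
    exact this.eventually (hO.mem_nhds hu)
  obtain ⟨ε, hε, hball⟩ := Metric.eventually_nhds_iff.1 hev
  have hline_mem : ∀ t ∈ Set.Ioo (-ε) ε, u + t • v ∈ O := fun t ht =>
    hball (by rw [Real.dist_eq, sub_zero]; exact abs_lt.2 ht)
  have h0 : u + (0 : ℝ) • v = u := by simp
  have hd : HasFDerivAt (fun u => φ₀.relL (Φ u)) (fderiv ℝ (fun u => φ₀.relL (Φ u)) u) u :=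
    ((hΦs u hu).differentiableAt (by simp)).hasFDerivAt
  have h := mem_of_curve hmod (c := fun t : ℝ => (f (u + t • v), Φ (u + t • v))) hε
    (fun t ht => ⟨(hf _ (hline_mem t ht)).1, hΦ _ (hline_mem t ht)⟩)
    (fun t ht => (ContMDiffAt.comp (g := f) t (hf _ (hline_mem t ht)).2
      hlc.contMDiff.contMDiffAt).contMDiffWithinAt) (χ := φ₀)
    (fun t ht => (ContDiffAt.comp (g := fun u => φ₀.relL (Φ u)) t (hΦs _ (hline_mem t ht))
      hlc.contDiffAt).contDiffWithinAt)
    (HasFDerivAt.comp_hasDerivAt (l := fun u => φ₀.relL (Φ u)) 0 (by rw [h0]; exact hd) hline)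
  simp only [h0] at h
  rwa [GrFrame.inverse_relL]

/-- Every element of the modified symbol is the sum of a logarithmic derivative of the smooth family
of adapted frames and an element that normalizes the modified symbol. -/
theorem exists_normalizing_decomposition
    (hπ : ContMDiff 𝓘(ℂ, CModel d) 𝓘(ℂ, CModel k) ω π)
    (hs : ∀ q, Function.Surjective (diff ℂ (CModel d) (CModel k) π q))
    (hH : HasHolSections Hc) (hbar : HasHolSections (barDist τ Hc))
    (hmod : ∀ ψ ∈ P0 k S τ Hc π γ, modSymbol k S τ Hc π γ ψ = g₀)
    (hO : IsOpen O) (hf : ∀ u ∈ O, π (f u) = γ ∧ ContMDiffAt 𝓘(ℝ, U) 𝓘(ℝ, CModel d) ∞ f u)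
    (hΦ : ∀ u ∈ O, IsAdapted k S τ Hc π γ (f u) (Φ u))
    (hΦs : ∀ u ∈ O, ContDiffAt ℝ ∞ (fun u => φ₀.relL (Φ u)) u) {u : U} (hu : u ∈ O)
    (hρf : ρ (f u) = u) (hρ : ContMDiffAt 𝓘(ℝ, CModel d) 𝓘(ℝ, U) ∞ ρ (f u))
    (hfρ : ∀ᶠ q in 𝓝 (f u), π q = γ → f (ρ q) = q) {x : (V × ℂ) →L[ℂ] (V × ℂ)}
    (hx : x ∈ clmSubmodule g₀) :
    ∃ v : U, ∃ z ∈ clmSubmodule g₀,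
      x = z + Ring.inverse (φ₀.relL (Φ u)) * fderiv ℝ (fun u => φ₀.relL (Φ u)) u v ∧
      ∀ y ∈ clmSubmodule g₀, z * y - y * z ∈ clmSubmodule g₀ := by
  obtain ⟨c, ε, hε, hc, hsm, hc0, hR, hd⟩ := exists_curve hmod (ψ := (f u, Φ u))
    ⟨(hf u hu).1, hΦ u hu⟩ hx
  have hI : Set.Ioo (-ε) ε ∈ 𝓝 (0 : ℝ) := Ioo_mem_nhds (by linarith) hε
  have hc0' : (c 0).1 = f u := by rw [hc0]
  have hcm : ContMDiffAt 𝓘(ℝ, ℝ) 𝓘(ℝ, CModel d) ∞ (fun t => (c t).1) 0 := hsm.contMDiffAt hI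
  have hct : Filter.Tendsto (fun t => (c t).1) (𝓝 0) (𝓝 (f u)) := by
    have := hcm.continuousAt.tendsto
    rwa [hc0'] at this
  have hm : ContDiffAt ℝ ∞ (fun t => ρ (c t).1) 0 :=
    contMDiffAt_iff_contDiffAt.1 (ContMDiffAt.comp (g := ρ) 0 (by rw [hc0']; exact hρ) hcm)
  have hmd : HasDerivAt (fun t => ρ (c t).1) (deriv (fun t => ρ (c t).1) 0) 0 :=
    (hm.differentiableAt (by simp)).hasDerivAt
  set v := deriv (fun t => ρ (c t).1) 0
  have hm0 : ρ (c 0).1 = u := by rw [hc0', hρf]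
  have hmu : Filter.Tendsto (fun t => ρ (c t).1) (𝓝 0) (𝓝 u) := by
    have := hm.continuousAt.tendsto
    rwa [hm0] at this
  have hΓd : HasFDerivAt (fun u => φ₀.relL (Φ u)) (fderiv ℝ (fun u => φ₀.relL (Φ u)) u) u :=
    ((hΦs u hu).differentiableAt (by simp)).hasFDerivAt
  set η := Ring.inverse (φ₀.relL (Φ u)) * fderiv ℝ (fun u => φ₀.relL (Φ u)) u v with hη
  have hDd : HasDerivAt (fun t => (Φ u).relL (Φ (ρ (c t).1))) η 0 := by
    have h1 : HasDerivAt (fun t => φ₀.relL (Φ (ρ (c t).1)))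
        (fderiv ℝ (fun u => φ₀.relL (Φ u)) u v) 0 :=
      HasFDerivAt.comp_hasDerivAt (l := fun u => φ₀.relL (Φ u)) 0 (by rw [hm0]; exact hΓd) hmd
    have h2 := h1.const_mul ((Φ u).relL φ₀)
    rw [hη, GrFrame.inverse_relL]
    simpa only [GrFrame.relL_mul] using h2
  have hEd : HasDerivAt (fun t => (Φ (ρ (c t).1)).relL (Φ u)) (-η) 0 := by
    have h1 := hasFDerivAt_ringInverse (𝕜 := ℝ) (1 : ((V × ℂ) →L[ℂ] (V × ℂ))ˣ)
    have h2 := HasFDerivAt.comp_hasDerivAt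
      (l := Ring.inverse) (f := fun t => (Φ u).relL (Φ (ρ (c t).1))) 0
      (by rw [hm0, GrFrame.relL_self]; exact h1) hDd
    simp only [Function.comp_def, GrFrame.inverse_relL] at h2
    simpa using h2
  -- `κ t` compares the given curve with the smooth family over the same base curve, so its
  -- derivative at `0` is the difference of the two logarithmic derivatives.
  have hκ : HasDerivAt (fun t => (Φ (ρ (c t).1)).relL (c t).2) (x - η) 0 := by
    have h1 := hEd.mul hd
    have h2 : (fun t => (Φ (ρ (c t).1)).relL (c t).2) =
        (fun t => (Φ (ρ (c t).1)).relL (Φ u)) * fun t => (Φ u).relL (c t).2 := by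
      funext t
      exact (GrFrame.relL_mul _ _ _).symm
    rw [h2]
    refine h1.congr_deriv ?_
    rw [hm0, hc0, GrFrame.relL_self, mul_one, one_mul]
    abel
  refine ⟨v, x - η, ?_, by abel, fun y hy => ?_⟩
  · exact sub_mem hx (maurerCartan_mem hmod hO hf hΦ hΦs hu v)
  · refine lie_mem_of_conj_mem (clmSubmodule g₀) hκ ?_ ?_
    · rw [hm0, hc0, GrFrame.relL_self]
    · filter_upwards [hI, hct.eventually hfρ, hmu.eventually (hO.mem_nhds hu)] with t h1 h2 h3
      -- The parameter `ρ (c t).1` recovers the base point of `c t`, so both frames entering `κ t`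
      -- are adapted at the same point and conjugation by `κ t` preserves `g₀`.
      have h4 := h2 (hc t h1).1
      rw [GrFrame.inverse_relL]
      have h5 := hΦ _ h3
      rw [h4] at h5
      exact conj_relL_mem hπ hs hH hbar hmod (hc t h1).1 h5 (hc t h1).2 hy

/-- The constant modified symbol is closed under commutators. -/
theorem lie_mem_of_smooth_frames
    (hπ : ContMDiff 𝓘(ℂ, CModel d) 𝓘(ℂ, CModel k) ω π)
    (hs : ∀ q, Function.Surjective (diff ℂ (CModel d) (CModel k) π q))
    (hH : HasHolSections Hc) (hbar : HasHolSections (barDist τ Hc))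
    (hmod : ∀ ψ ∈ P0 k S τ Hc π γ, modSymbol k S τ Hc π γ ψ = g₀)
    (hO : IsOpen O) (hf : ∀ u ∈ O, π (f u) = γ ∧ ContMDiffAt 𝓘(ℝ, U) 𝓘(ℝ, CModel d) ∞ f u)
    (hΦ : ∀ u ∈ O, IsAdapted k S τ Hc π γ (f u) (Φ u))
    (hΦs : ∀ u ∈ O, ContDiffAt ℝ ∞ (fun u => φ₀.relL (Φ u)) u) {u : U} (hu : u ∈ O)
    (hρf : ρ (f u) = u) (hρ : ContMDiffAt 𝓘(ℝ, CModel d) 𝓘(ℝ, U) ∞ ρ (f u))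
    (hfρ : ∀ᶠ q in 𝓝 (f u), π q = γ → f (ρ q) = q) {x y : (V × ℂ) →L[ℂ] (V × ℂ)}
    (hx : x ∈ clmSubmodule g₀) (hy : y ∈ clmSubmodule g₀) : x * y - y * x ∈ clmSubmodule g₀ := by
  obtain ⟨v, z, -, hxz, hz⟩ := exists_normalizing_decomposition hπ hs hH hbar hmod hO hf hΦ hΦs hu
    hρf hρ hfρ hx
  obtain ⟨v', z', -, hyz, hz'⟩ := exists_normalizing_decomposition hπ hs hH hbar hmod hO hf hΦ hΦs
    hu hρf hρ hfρ hy
  have hη := maurerCartan_mem hmod hO hf hΦ hΦs hu v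
  have h3 := lie_mem_of_maurerCartan (clmSubmodule g₀) hO hΦs
    (fun u _ => GrFrame.isUnit_relL _ _) (fun u hu v => maurerCartan_mem hmod hO hf hΦ hΦs hu v)
    hu v v'
  set η := Ring.inverse (φ₀.relL (Φ u)) * fderiv ℝ (fun u => φ₀.relL (Φ u)) u v
  set η' := Ring.inverse (φ₀.relL (Φ u)) * fderiv ℝ (fun u => φ₀.relL (Φ u)) u v'
  have h1 := hz y hy
  have h2 := hz' η hη
  have h4 := add_mem (sub_mem h1 h2) h3
  -- The first two brackets are controlled by the normalizing parts `z` and `z'`, the last one by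
  -- the structure equation.
  have h5 : x * y - y * x = z * y - y * z - (z' * η - η * z') + (η * η' - η' * η) := by
    rw [hxz, hyz]
    noncomm_ring
  rw [h5]
  exact h4

end

/-- If the modified symbol is constant along a leaf, it is closed under commutators. -/
theorem commutator_mem_of_constant
    (hπ : ContMDiff 𝓘(ℂ, CModel d) 𝓘(ℂ, CModel k) ω π)
    (hs : ∀ q, Function.Surjective (diff ℂ (CModel d) (CModel k) π q))
    (hH : HasHolSections Hc) (hbar : HasHolSections (barDist τ Hc))
    (hS : HasConstantSymbol k S τ Hc π) (q₀ : CM)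
    (hmod : ∀ ψ ∈ P0 k S τ Hc π (π q₀), modSymbol k S τ Hc π (π q₀) ψ = g₀)
    {x y : (V × ℂ) →L[ℂ] (V × ℂ)} (hx : x ∈ clmSubmodule g₀) (hy : y ∈ clmSubmodule g₀) :
    x * y - y * x ∈ clmSubmodule g₀ := by
  obtain ⟨φ₀, hφ₀⟩ := hS q₀
  obtain ⟨U, f, ρ, O, hO, h0, hf0, hf⟩ := exists_fibre_chart hπ q₀ (hs q₀)
  obtain ⟨O₁, h0₁, P, hP⟩ := exists_leafChart_of_fibre_chart hπ hH hbar hS φ₀ hO h0 hf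
  obtain ⟨O', hsub, hO', ⟨u, hu⟩, Φ, hΦ⟩ :=
    hP.exists_smooth_frames ⟨0, h0₁⟩ hπ hs hH hbar hS rfl hφ₀.2
  exact lie_mem_of_smooth_frames hπ hs hH hbar hmod hO'
    (fun u hu => ⟨hP.proj u (hsub hu), hP.smooth u (hsub hu)⟩) (fun u hu => (hΦ u hu).1)
    (fun u hu => (hΦ u hu).2) hu (hP.left_inv u (hsub hu)) (hP.smooth_inv u (hsub hu))
    (hP.right_inv u (hsub hu)) hx hy

end

end CRGeom

end

/-! ### The theorem. -/

theorem mainTheorem11 {n r k : ℕ}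
    -- a real-analytic manifold of dimension `2 n + 1` with a 2-nondegenerate CR structure `H`
    -- of hypersurface type, whose Levi kernel `K` has constant rank `r`
    {M : Type*} [TopologicalSpace M] [T2Space M] [Nonempty M]
    [ChartedSpace (CRGeom.RModel (2 * n + 1)) M]
    [IsManifold 𝓘(ℝ, CRGeom.RModel (2 * n + 1)) ω M]
    (H K : M → Submodule ℂ (CRGeom.CModel (2 * n + 1)))
    (hH : CRGeom.IsCRStructure n H)
    (hK : CRGeom.IsLeviKernel H K) (hKr : CRGeom.IsAnalyticDistribution r K)
    (hnd : CRGeom.IsTwoNondegenerate H K)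
    -- a complexification
    {CM : Type*} [TopologicalSpace CM] [T2Space CM]
    [ChartedSpace (CRGeom.CModel (2 * n + 1)) CM]
    [IsManifold 𝓘(ℂ, CRGeom.CModel (2 * n + 1)) ω CM]
    (ι : M → CM) (τ : CM → CM) (Hc Kc : CM → Submodule ℂ (CRGeom.CModel (2 * n + 1)))
    (hCM : CRGeom.IsComplexification n r H K ι τ Hc Kc)
    -- its Levi leaf space
    {N : Type*} [TopologicalSpace N] [T2Space N] [ChartedSpace (CRGeom.CModel k) N]
    [IsManifold 𝓘(ℂ, CRGeom.CModel k) ω N]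
    (π : CM → N) (hπ : CRGeom.IsLeviLeafSpace k τ Kc π)
    -- the model symbol
    {V : Type*} [NormedAddCommGroup V] [NormedSpace ℂ V] [FiniteDimensional ℂ V]
    (S : CRGeom.CRSymbol V r) (hS : CRGeom.HasConstantSymbol k S τ Hc π)
    -- the degree zero component of the constant modified symbol
    (g₀ : Submodule ℂ (Module.End ℂ (V × ℂ)))
    (hmod : CRGeom.HasConstantModifiedSymbol k S τ Hc π g₀) :
    ∃ L : LieSubalgebra ℂ (Module.End ℂ (V × ℂ)), L ≤ CRGeom.csp S ∧ L.toSubmodule = g₀ := by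
  have hHs : CRGeom.HasHolSections Hc :=
    CRGeom.hasHolSections_of_frame fun y => (hCM.H_holomorphic y).2
  have hbar : CRGeom.HasHolSections (CRGeom.barDist τ Hc) :=
    CRGeom.hasHolSections_of_frame (CRGeom.exists_frame_barDist hCM.τ_analytic
      hCM.τ_antiholomorphic hCM.τ_involutive hCM.H_holomorphic)
  -- The point `ι p` provides a leaf that carries adapted frames; constancy of the modified symbol
  -- makes this one leaf sufficient.
  obtain ⟨p⟩ := ‹Nonempty M›
  refine ⟨{ g₀ with
    lie_mem' := fun {x y} hx hy => ?_ }, fun A hA => ?_, rfl⟩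
  · exact CRGeom.commutator_mem_of_constant hπ.holomorphic hπ.submersion hHs hbar hS (ι p)
      (hmod _) (x := LinearMap.toContinuousLinearMap x) (y := LinearMap.toContinuousLinearMap y)
      hx hy
  · obtain ⟨φ, hφ⟩ := hS (ι p)
    refine CRGeom.modSymbol_subset_csp hπ.holomorphic hπ.submersion hHs hbar hφ ?_
    rw [hmod _ _ hφ]
    exact hA
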